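/- Let $F$ be a locally finite Borel measure without atoms on $\mathbb{R}$ and let $W$ be a centred Gaussian random measure on a probability space $(\Omega,P)$ with control measure $F$, i.e. $\mathbb{E}\,W(A)\overline{W(B)}=F(A\cap B)$ for Borel sets $A,B$ of finite $F$-measure, the $W(A)$ being jointly Gaussian. We are in one of two settings: the real one, $\sigma(x)=x$ (so $W$ is real-valued), or the complex Hermitian one, $\sigma(x)=-x$, where $F$ is symmetric and $W(-A)=\overline{W(A)}$. For $q\ge 0$ and $f\in L^2(\mathbb{R}^q,F^{\otimes q})$ that is symmetric under permutations of its variables and satisfies $f(\sigma x_1,\dots,\sigma x_q)=\overline{f(x_1,\dots,x_q)}$, let $$I_q(f)=\int f(x_1,\dots,x_q)\,W(dx_1)\cdots W(dx_q)$$ be the multiple Wiener–Itô integral (real-valued a.s.), with the hyper-diagonals $x_a=x_b$ and $x_a=\sigma x_b$ ($a\ne b$) excluded: the $L^2(P)$-limit of the integrals of simple kernels vanishing on these diagonals that converge to $f$ in $L^2(F^{\otimes q})$. For two such kernels $f,g$ of $p$ and $q$ variables and $1\le r\le p\wedge q$, define the contraction $$(f\otimes_r g)(x,y)=\int_{\mathbb{R}^r}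 f(x,s_1,\dots,s_r)\,g(y,\sigma s_1,\dots,\sigma s_r)\,F(ds_1)\cdots F(ds_r),\qquad x\in\mathbb{R}^{p-r},\ y\in\mathbb{R}^{q-r},$$ and let $\|\cdot\|$ be the $L^2$ norm with respect to the powers of $F$. For $j=1,\dots,J$ and $N\in\mathbb{N}$ let $$\mathbf{U}_{j,N}=\bigl(I_{q_{1,j}}(f_{1,j,N}),\dots,I_{q_{I_j,j}}(f_{I_j,j,N})\bigr),$$ where the $f_{i,j,N}$ are kernels as above of $q_{i,j}$ variables. Assume that $$\lim_{N\to\infty}\|f_{i_1,j_1,N}\otimes_r f_{i_2,j_2,N}\|=0$$ for all $j_1\neq j_2$, all $i_1\in\{1,\dots,I_{j_1}\}$, $i_2\in\{1,\dots,I_{j_2}\}$ and all $r=1,\dots,q_{i_1,j_1}\wedge q_{i_2,j_2}$, and that for each $j$, as $N\to\infty$, $\mathbf{U}_{j,N}$ converges in distribution to a probability law $\nu_j$ on $\mathbb{R}^{I_j}$ each of whose one-dimensional marginals is moment-determinate (has finite moments of all orders and is the only probability measure on $\mathbb{R}$ with these moments). Then there are independent random vectors $\mathbf{U}_1,\dots,\mathbf{U}_J$,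 with $\mathbf{U}_j$ of law $\nu_j$, such that $$(\mathbf{U}_{1,N},\dots,\mathbf{U}_{J,N})\overset{d}{\longrightarrow}(\mathbf{U}_1,\dots,\mathbf{U}_J)\qquad\text{as } N\to\infty .$$ -/

import Mathlib

open MeasureTheory ProbabilityTheory Filter
open scoped ENNReal Topology ComplexConjugate

noncomputable section

namespace WienerIto

variable {Ω : Type*} [MeasurableSpace Ω]

/-- `W` is a centred Gaussian random measure on `ℝ` with control measure `F` and reflection
symmetry `W (σ⁻¹ A) = conj (W A)`. It is indexed by the Borel sets of finite `F`-measure, and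
`E [W(A) conj W(B)] = F (A ∩ B)`.
For `σ = id` this is a real Gaussian random measure (a Brownian motion if `F` is Lebesgue measure);
for `σ x = -x` it is a complex Hermitian Gaussian random measure, as in the spectral
representation of stationary Gaussian sequences. -/
structure IsGaussianRandomMeasure (σ : ℝ → ℝ) (F : Measure ℝ) (W : Set ℝ → Ω → ℂ)
    (P : Measure Ω) : Prop where
  /-- All finite families `(W A₁, …, W Aₙ)` are jointly Gaussian in `ℂⁿ` as a real space, that is,
  all real and imaginary parts are jointly Gaussian. -/
  gaussian : IsGaussianProcess
    (fun A : {A : Set ℝ // MeasurableSet A ∧ F A < ∞} => W A.1) P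
  centred : ∀ A : Set ℝ, MeasurableSet A → F A < ∞ → ∫ ω, W A ω ∂P = 0
  covariance : ∀ A B : Set ℝ, MeasurableSet A → F A < ∞ → MeasurableSet B → F B < ∞ →
    ∫ ω, W A ω * conj (W B ω) ∂P = (F.real (A ∩ B) : ℂ)
  reflection : ∀ A : Set ℝ, MeasurableSet A → F A < ∞ →
    W (σ ⁻¹' A) =ᵐ[P] fun ω => conj (W A ω)

/-- The product measure `F(dx₁) ⋯ F(dx_q)` on `ℝ^q`. -/
abbrev powMeasure (F : Measure ℝ) (q : ℕ) : Measure (Fin q → ℝ) := Measure.pi fun _ => F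

/-- Simple kernels in `q` variables: finite combinations of indicators of products of pairwise
disjoint sets of finite measure, vanishing on the generalized diagonals `x_a = x_b` and
`x_a = σ x_b`, `a ≠ b`. The system of sets is closed under the reflection, and the coefficients
satisfy the Hermitian symmetry. -/
structure SimpleKernel (σ : ℝ → ℝ) (F : Measure ℝ) (q : ℕ) where
  /-- the number of sets in the system -/
  n : ℕ
  /-- the sets of the system -/
  A : Fin n → Set ℝ
  measurableSet : ∀ k, MeasurableSet (A k)
  measure_lt_top : ∀ k, F (A k) < ∞
  disjoint : Pairwise fun k l => Disjoint (A k) (A l)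
  /-- the index of the reflected set -/
  star : Fin n → Fin n
  star_star : ∀ k, star (star k) = k
  A_star : ∀ k, A (star k) = σ ⁻¹' A k
  /-- the coefficients -/
  coeff : (Fin q → Fin n) → ℂ
  coeff_diag : ∀ (i : Fin q → Fin n) (a b : Fin q), a ≠ b →
    (i a = i b ∨ i a = star (i b)) → coeff i = 0
  coeff_star : ∀ i : Fin q → Fin n, coeff (fun a => star (i a)) = conj (coeff i)

/-- The function `∑ c_{i₁,…,i_q} 1_{A_{i₁} × ⋯ × A_{i_q}}`. -/
def SimpleKernel.toFun {σ : ℝ → ℝ} {F : Measure ℝ} {q : ℕ} (g : SimpleKernel σ F q)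
    (x : Fin q → ℝ) : ℂ :=
  ∑ i : Fin q → Fin g.n, g.coeff i * ∏ a : Fin q, (g.A (i a)).indicator (fun _ => (1 : ℂ)) (x a)

/-- The multiple integral `∑ c_{i₁,…,i_q} W(A_{i₁}) ⋯ W(A_{i_q})` of a simple kernel. -/
def SimpleKernel.integral {σ : ℝ → ℝ} {F : Measure ℝ} {q : ℕ} (g : SimpleKernel σ F q)
    (W : Set ℝ → Ω → ℂ) (ω : Ω) : ℂ :=
  ∑ i : Fin q → Fin g.n, g.coeff i * ∏ a : Fin q, W (g.A (i a)) ω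

/-- `X` is (a version of) the `q`-fold multiple Wiener-Itô integral
`I_q(f) = ∫ f(x₁,…,x_q) W(dx₁) ⋯ W(dx_q)` with the generalized diagonals excluded: `X` is the
`L²(P)`-limit of the integrals of simple kernels that converge to `f` in `L²(F^q)`.
By the isometry property this determines `X` up to almost sure equality. -/
def IsMultipleIntegral (σ : ℝ → ℝ) (F : Measure ℝ) (W : Set ℝ → Ω → ℂ) (P : Measure Ω)
    (q : ℕ) (f : (Fin q → ℝ) → ℂ) (X : Ω → ℝ) : Prop :=
  MemLp X 2 P ∧
  ∃ g : ℕ → SimpleKernel σ F q,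
    Tendsto (fun n => eLpNorm (fun x => (g n).toFun x - f x) 2 (powMeasure F q)) atTop (𝓝 0) ∧
    Tendsto (fun n => eLpNorm (fun ω => (g n).integral W ω - (X ω : ℂ)) 2 P) atTop (𝓝 0)

/-- Admissible kernels of `q` variables: square integrable, symmetric under permutations of the
variables, and Hermitian, `f(σ x₁, …, σ x_q) = conj (f(x₁, …, x_q))` (which for `σ = id` says that
`f` is real-valued), the symmetries being understood almost everywhere. -/
structure IsKernel (σ : ℝ → ℝ) (F : Measure ℝ) (q : ℕ) (f : (Fin q → ℝ) → ℂ) : Prop where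
  memLp : MemLp f 2 (powMeasure F q)
  symmetric : ∀ π : Equiv.Perm (Fin q),
    (fun x : Fin q → ℝ => f fun a => x (π a)) =ᵐ[powMeasure F q] f
  hermitian : (fun x : Fin q → ℝ => f fun a => σ (x a)) =ᵐ[powMeasure F q] fun x => conj (f x)

/-- The point `(x₁, …, x_{p-r}, s₁, …, s_r)`, for `r ≤ p`. -/
def joinVars (p r : ℕ) (x : Fin (p - r) → ℝ) (s : Fin r → ℝ) (a : Fin p) : ℝ :=
  if h : (a : ℕ) < p - r then x ⟨a, h⟩ else s ⟨a - (p - r), by have := a.2; omega⟩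

/-- The contraction of order `r ≤ min p q`,
`(f ⊗_r g)(x, y) = ∫ f(x, s) g(y, σ s) F(ds₁) ⋯ F(ds_r)`. For `σ = id` this is
`∫ f(x, s) g(y, s) ds`. -/
def contraction (σ : ℝ → ℝ) (F : Measure ℝ) {p q : ℕ} (r : ℕ) (f : (Fin p → ℝ) → ℂ)
    (g : (Fin q → ℝ) → ℂ) (z : (Fin (p - r) → ℝ) × (Fin (q - r) → ℝ)) : ℂ :=
  ∫ s : Fin r → ℝ, f (joinVars p r z.1 s) * g (joinVars q r z.2 fun a => σ (s a)) ∂(powMeasure F r)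

/-- The `L²` norm of the contraction `f ⊗_r g`, in `p + q - 2r` variables. -/
def contractionNorm (σ : ℝ → ℝ) (F : Measure ℝ) {p q : ℕ} (r : ℕ) (f : (Fin p → ℝ) → ℂ)
    (g : (Fin q → ℝ) → ℂ) : ℝ≥0∞ :=
  eLpNorm (contraction σ F r f g) 2 ((powMeasure F (p - r)).prod (powMeasure F (q - r)))

/-- A law on `ℝ` is moment-determinate if all its moments are finite and it is the only
probability measure with these moments. -/
def MomentDeterminate (μ : Measure ℝ) : Prop :=
  (∀ n : ℕ, Integrable (fun x : ℝ => x ^ n) μ) ∧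
  ∀ ν : Measure ℝ, IsProbabilityMeasure ν → (∀ n : ℕ, Integrable (fun x : ℝ => x ^ n) ν) →
    (∀ n : ℕ, ∫ x, x ^ n ∂ν = ∫ x, x ^ n ∂μ) → ν = μ

end WienerIto

end

/-!
The asymptotic independence of the blocks is proved on the level of characteristic functions, from
a quantitative bound: for multiple integrals `X_a` with kernels `f_a` and real coefficients
`s_a`, `t_a`, the difference
`E exp(i ∑ (s_a + t_a) X_a) - E exp(i ∑ s_a X_a) * E exp(i ∑ t_a X_a)` is at most
`∑ |s_a| |t_b| C(p_a, p_b) ∑_{r ≥ 1} ‖f_a ⊗_r f_b‖` (`enorm_integral_cexp_sub_le`). If `s` and `t`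
are supported on different blocks, the right-hand side tends to `0` by the contraction condition,
so that the joint characteristic function of the blocks has the same limit as the product of their
characteristic functions (`tendsto_integral_cexp_blocks`), and Lévy's theorem concludes.

The bound is obtained for simple kernels, whose integrals are polynomials in a centred Gaussian
vector `w` with law `μ`. Let `A` and `B` be two such real polynomials, homogeneous with coefficient
tensors `a` and `b`, and `Φ = exp (i A)`, `Ψ = exp (i B)`; linear combinations are handled term by
term. With an independent copy `w'` of `w`, the function
`h(θ) = E Φ(w) Ψ(w cos θ + w' sin θ)` interpolates between `E Φ(w) Ψ(w)` and the product
`E Φ(w) E Ψ(w)` (`norm_integral_mul_sub_le`). Gaussian integration by parts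
(`integral_clm_mul`), applied to the forms in `-w sin θ + w' cos θ`, which are uncorrelated with
those in `w cos θ + w' sin θ`, expresses `h'(θ)` through the polynomial
`Q = ∑ K_{kl} ∂_k A(w) ∂_l B(w cos θ + w' sin θ)`, `K` being the covariance matrix of the forms,
which up to a numerical factor is the bihomogeneous polynomial with
coefficients `a ⊗_1 b` (`norm_interpolation_deriv_le`). Its second moment is estimated by the norms
of its own contractions, that is of the contractions of `a` and `b` of all orders `r ≥ 1`
(`secondMoment_le`), by induction on the degree and again integration by parts.
Only covariances of the sets of the two systems enter, so no common refinement of the systems is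
needed. The contractions of the coefficients have the same norms as the contractions of the
simple kernels (`SimpleKernel.contractionNorm_sq`), and the bound passes to general kernels since
contraction is continuous in `L²` (`contractionNorm_le_add`) and symmetrization of a simple kernel
does not move it away from a symmetric limit (`SimpleKernel.eLpNorm_symm_sub_le`).
-/

noncomputable section

namespace WienerIto

/-! ### Integration by parts for real Gaussian forms -/

section

/-- Stein's identity for a centred Gaussian law on the real line. -/
lemma integral_mul_gaussianReal_eq {s : NNReal} (hs : s ≠ 0) {h h' : ℝ → ℂ}
    (hder : ∀ t, HasDerivAt h (h' t) t) (hi : Integrable h (gaussianReal 0 s))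
    (hi' : Integrable h' (gaussianReal 0 s))
    (hti : Integrable (fun t : ℝ => (t : ℂ) * h t) (gaussianReal 0 s)) :
    ∫ t, (t : ℂ) * h t ∂gaussianReal 0 s = s * ∫ t, h' t ∂gaussianReal 0 s := by
  have key : ∀ f : ℝ → ℂ, Integrable f (gaussianReal 0 s) →
      Integrable (fun t => (gaussianPDFReal 0 s t : ℂ) * f t) := by
    intro f hf
    rw [gaussianReal_of_var_ne_zero _ hs,
      integrable_withDensity_iff_integrable_smul₀' (measurable_gaussianPDF _ _).aemeasurable
        (ae_of_all _ fun _ => gaussianPDF_lt_top)] at hf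
    simpa [toReal_gaussianPDF, Complex.real_smul] using hf
  have hs' : (s : ℝ) ≠ 0 := by exact_mod_cast hs
  have hpdf : ∀ t, HasDerivAt (fun t => (gaussianPDFReal 0 s t : ℂ))
      ((-(t / s) * gaussianPDFReal 0 s t : ℝ) : ℂ) t := by
    intro t
    apply HasDerivAt.ofReal_comp
    have h1 : HasDerivAt (fun t : ℝ => -(t - 0) ^ 2 / (2 * s)) (-(t / s)) t := by
      have := (((hasDerivAt_id t).sub_const 0).pow 2).neg.div_const (2 * (s : ℝ))
      refine this.congr_deriv ?_
      simp only [id, Nat.cast_ofNat, Nat.add_one_sub_one, pow_one]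
      field_simp
      ring
    have h2 := (h1.exp).const_mul ((√(2 * Real.pi * s))⁻¹)
    unfold gaussianPDFReal
    refine h2.congr_deriv ?_
    ring
  have ibp := integral_mul_deriv_eq_deriv_mul_of_integrable
    (u := fun t => (gaussianPDFReal 0 s t : ℂ))
    (u' := fun t => ((-(t / s) * gaussianPDFReal 0 s t : ℝ) : ℂ))
    (v := h) (v' := h') (fun t _ => hpdf t) (fun t _ => hder t) (key _ hi')
    (by
      have := (key _ hti).const_mul (-(s : ℂ)⁻¹)
      refine this.congr (ae_of_all _ fun t => ?_)
      simp only [Pi.mul_apply]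
      push_cast
      ring)
    (key _ hi)
  rw [integral_gaussianReal_eq_integral_smul hs, integral_gaussianReal_eq_integral_smul hs]
  simp only [Complex.real_smul]
  rw [ibp, ← integral_neg, ← integral_const_mul]
  congr 1
  ext t
  push_cast
  have : (s : ℂ) ≠ 0 := by exact_mod_cast hs
  field_simp

variable {E : Type*} [NormedAddCommGroup E] [NormedSpace ℝ E] [MeasurableSpace E] [BorelSpace E]
  [CompleteSpace E] [SecondCountableTopology E]

/-- The covariance vector of the functional `L`: the vector `v` with
`M v = ∫ L x * M x ∂μ` for all continuous functionals `M`. -/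
def covVec (μ : Measure E) (L : E →L[ℝ] ℝ) : E := ∫ x, L x • x ∂μ

lemma integrable_smul_id (μ : Measure E) [IsGaussian μ] (L : E →L[ℝ] ℝ) :
    Integrable (fun x => L x • x) μ :=
  (IsGaussian.memLp_two_id (μ := μ)).smul (IsGaussian.memLp_dual μ L 2 (by simp))
    |>.integrable le_rfl

lemma clm_covVec (μ : Measure E) [IsGaussian μ] (L : E →L[ℝ] ℝ) {G : Type*}
    [NormedAddCommGroup G] [NormedSpace ℝ G] [CompleteSpace G] (M : E →L[ℝ] G) :
    M (covVec μ L) = ∫ x, L x • M x ∂μ := by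
  unfold covVec
  rw [← M.integral_comp_comm (integrable_smul_id μ L)]
  simp

/-- Gaussian integration by parts along a real functional `L`. The proof splits `x` into `L x`
and an independent remainder, and applies Stein's identity in the first variable. -/
lemma integral_dual_mul_eq (μ : Measure E) [IsGaussian μ] (hμ : ∫ x, x ∂μ = 0) (L : E →L[ℝ] ℝ)
    {H H' : E → ℂ}
    (hder : ∀ x, HasDerivAt (fun t : ℝ => H (x + t • covVec μ L)) (H' x) 0)
    (hi : Integrable H μ) (hi' : Integrable H' μ)
    (hLi : Integrable (fun x => (L x : ℂ) * H x) μ) :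
    ∫ x, (L x : ℂ) * H x ∂μ = ∫ x, H' x ∂μ := by
  have hL0 : ∀ M : E →L[ℝ] ℝ, ∫ x, M x ∂μ = 0 := fun M => by
    rw [IsGaussian.integral_dual, hμ, map_zero]
  have hmem : ∀ M : E →L[ℝ] ℝ, MemLp M 2 μ := fun M => IsGaussian.memLp_dual μ M 2 (by simp)
  have hcov : ∀ M N : E →L[ℝ] ℝ, cov[M, N; μ] = M (covVec μ N) := fun M N => by
    rw [covariance_eq_sub (hmem M) (hmem N), hL0, hL0, clm_covVec]
    simp [mul_comm]
  set v := covVec μ L with hv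
  by_cases hs : L v = 0
  · -- a degenerate direction: `L = 0` almost surely, and `v = 0`
    have hL : (fun x => L x) =ᵐ[μ] 0 := by
      have h1 : ∫ x, L x * L x ∂μ = 0 := by rw [← hs, hv, clm_covVec]; rfl
      have h2 := (integral_eq_zero_iff_of_nonneg (fun x => mul_self_nonneg (L x))
        ((hmem L).integrable_mul (hmem L))).1 h1
      filter_upwards [h2] with x hx
      simpa using hx
    have hv0 : v = 0 := by
      rw [hv, covVec, integral_eq_zero_of_ae]
      filter_upwards [hL] with x hx
      simp [hx]
    have hH' : ∀ x, H' x = 0 := fun x => by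
      have := hder x
      simp only [hv0, smul_zero, add_zero] at this
      exact this.unique (hasDerivAt_const _ _)
    rw [integral_eq_zero_of_ae, integral_eq_zero_of_ae]
    · exact ae_of_all _ hH'
    · filter_upwards [hL] with x hx
      simp [hx]
  · set u := (L v)⁻¹ • v with hu
    set R : E →L[ℝ] E := ContinuousLinearMap.id ℝ E - L.smulRight u with hR
    have hRx : ∀ x, L x • u + R x = x := fun x => by simp [hR]
    have hpair : HasGaussianLaw (fun x => (L x, R x)) μ :=
      (IsGaussian.hasGaussianLaw_id (μ := μ)).map_fun (L.prod R)
    have hind : IndepFun (fun x => L x) (fun x => R x) μ := by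
      refine hpair.indepFun_of_covariance_strongDual fun L₁ L₂ => ?_
      have h1 : (L₁ ∘ fun x => L x) = ⇑(L₁.comp L) := rfl
      have h2 : (L₂ ∘ fun x => R x) = ⇑(L₂.comp R) := rfl
      rw [h1, h2, covariance_comm, hcov]
      have h3 : covVec μ (L₁.comp L) = L₁ 1 • v := by
        rw [hv, covVec, covVec, ← integral_smul]
        congr 1
        ext x
        have : L₁ (L x) = L x * L₁ 1 := by
          conv_lhs => rw [show L x = L x • (1 : ℝ) by simp]
          rw [map_smul]; rfl
        simp [this, smul_smul, mul_comm]
      have h4 : R v = 0 := by simp [hR, hu, smul_smul, hs]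
      rw [h3, map_smul]
      simp [h4]
    have hprod := (indepFun_iff_map_prod_eq_prod_map_map (by fun_prop) (by fun_prop)).1 hind
    have hmapL : μ.map (fun x => L x) = gaussianReal 0 (L v).toNNReal := by
      have h1 : HasGaussianLaw (fun x => L x) μ :=
        (IsGaussian.hasGaussianLaw_id (μ := μ)).map_fun L
      rw [h1.map_eq_gaussianReal, ← covariance_self (by fun_prop)]
      have h2 : cov[fun x => L x, fun x => L x; μ] = L v := hcov L L
      rw [h2, hL0]
    have hsn : (L v).toNNReal ≠ 0 := by
      have : 0 ≤ L v := by
        rw [hv, clm_covVec]; exact integral_nonneg fun x => mul_self_nonneg (L x)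
      rw [Ne, Real.toNNReal_eq_zero, not_le]
      exact lt_of_le_of_ne this (Ne.symm hs)
    have hvpos : 0 ≤ L v := by
      rw [hv, clm_covVec]; exact integral_nonneg fun x => mul_self_nonneg (L x)
    set ν := μ.map (fun x => R x) with hν
    set g := gaussianReal 0 (L v).toNNReal with hg
    rw [hmapL] at hprod
    have hme : MeasurableEmbedding (fun x => (L x, R x)) := by
      have : Continuous fun x : E => (L x, R x) := by fun_prop
      refine this.measurableEmbedding fun x y hxy => ?_
      simp only [Prod.mk.injEq] at hxy
      rw [← hRx x, ← hRx y, hxy.1, hxy.2]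
    have hT : ∀ f : E → ℂ, Integrable f μ →
        Integrable (fun p : ℝ × E => f (p.1 • u + p.2)) (g.prod ν) ∧
        ∫ x, f x ∂μ = ∫ p, f (p.1 • u + p.2) ∂(g.prod ν) := by
      intro f hf
      rw [← hprod, hme.integrable_map_iff, hme.integral_map]
      refine ⟨hf.congr (ae_of_all _ fun x => ?_), integral_congr_ae (ae_of_all _ fun x => ?_)⟩
      all_goals simp [hRx]
    have hν_prob : IsProbabilityMeasure ν := Measure.isProbabilityMeasure_map (by fun_prop)
    obtain ⟨a1, a2⟩ := hT _ hLi
    obtain ⟨b1, b2⟩ := hT _ hi'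
    obtain ⟨c1, -⟩ := hT _ hi
    have hν0 : ∀ᵐ y ∂ν, L y = 0 := by
      rw [hν, ae_map_iff (by fun_prop) (measurableSet_eq_fun (by fun_prop) (by fun_prop))]
      refine ae_of_all _ fun x => ?_
      simp [hR, hu, hs]
    have hLu : L u = 1 := by simp [hu, hs]
    rw [a2, b2, integral_prod_symm _ a1, integral_prod_symm _ b1]
    refine integral_congr_ae ?_
    filter_upwards [hν0, a1.prod_left_ae, b1.prod_left_ae, c1.prod_left_ae] with y hy hya hyb hyc
    simp only [map_add, map_smul, hy, hLu, smul_eq_mul, mul_one, add_zero] at hya ⊢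
    have hd : ∀ t : ℝ, HasDerivAt (fun t : ℝ => H (t • u + y))
        ((L v : ℂ)⁻¹ * H' (t • u + y)) t := by
      intro t
      have e : ∀ r : ℝ, r • u + y = (t • u + y) + ((r - t) * (L v)⁻¹) • v := fun r => by
        rw [hu, smul_smul, smul_smul, sub_mul, sub_smul]; abel
      have h1 : HasDerivAt (fun r : ℝ => (r - t) * (L v)⁻¹) ((L v)⁻¹) t := by
        simpa using ((hasDerivAt_id t).sub_const t).mul_const (L v)⁻¹
      have h2 : HasDerivAt (fun r : ℝ => H ((t • u + y) + r • v)) (H' (t • u + y))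
          ((t - t) * (L v)⁻¹) := by simpa using hder (t • u + y)
      have h3 := h2.scomp t h1
      refine (h3.congr_of_eventuallyEq (Eventually.of_forall fun r => ?_)).congr_deriv ?_
      · simp only [Function.comp]
        rw [e r]
      · simp [Complex.real_smul]
    rw [integral_mul_gaussianReal_eq hsn hd hyc (hyb.const_mul _) hya, integral_const_mul,
      ← mul_assoc, ← hg]
    have : ((L v).toNNReal : ℂ) * (L v : ℂ)⁻¹ = 1 := by
      rw [show (((L v).toNNReal : NNReal) : ℂ) = ((L v : ℝ) : ℂ) by
        rw [← Complex.ofReal_inj.2 (Real.coe_toNNReal _ hvpos)]]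
      exact mul_inv_cancel₀ (by exact_mod_cast hs)
    rw [this, one_mul]

end

/-! ### Functions of polynomial growth and complex Gaussian integration by parts -/

section

variable {E : Type*} [NormedAddCommGroup E]

/-- `f` is bounded by a polynomial in the norm. -/
def PolyBdd {G : Type*} [Norm G] (f : E → G) : Prop :=
  ∃ (C : ℝ) (m : ℕ), ∀ x, ‖f x‖ ≤ C * (1 + ‖x‖) ^ m

namespace PolyBdd

variable {G₁ G₂ G₃ : Type*} [SeminormedAddCommGroup G₁] [SeminormedAddCommGroup G₂]
  [SeminormedAddCommGroup G₃]

lemma of_le_mul {f : E → G₁} {g : E → G₂} {h : E → G₃} (hf : PolyBdd f) (hg : PolyBdd g)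
    (H : ∀ x, ‖h x‖ ≤ ‖f x‖ * ‖g x‖) : PolyBdd h := by
  obtain ⟨C, m, hC⟩ := hf
  obtain ⟨D, n, hD⟩ := hg
  refine ⟨C * D, m + n, fun x => (H x).trans ?_⟩
  calc ‖f x‖ * ‖g x‖ ≤ (C * (1 + ‖x‖) ^ m) * (D * (1 + ‖x‖) ^ n) :=
        mul_le_mul (hC x) (hD x) (norm_nonneg _) ((norm_nonneg _).trans (hC x))
    _ = C * D * (1 + ‖x‖) ^ (m + n) := by ring

lemma of_le_add {f : E → G₁} {g : E → G₂} {h : E → G₃} (hf : PolyBdd f) (hg : PolyBdd g)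
    (H : ∀ x, ‖h x‖ ≤ ‖f x‖ + ‖g x‖) : PolyBdd h := by
  obtain ⟨C, m, hC⟩ := hf
  obtain ⟨D, n, hD⟩ := hg
  refine ⟨|C| + |D|, m + n, fun x => (H x).trans ?_⟩
  have h1 : (1 : ℝ) ≤ 1 + ‖x‖ := by linarith [norm_nonneg x]
  have h2 : (1 + ‖x‖) ^ m ≤ (1 + ‖x‖) ^ (m + n) := pow_le_pow_right₀ h1 (by omega)
  have h3 : (1 + ‖x‖) ^ n ≤ (1 + ‖x‖) ^ (m + n) := pow_le_pow_right₀ h1 (by omega)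
  have h4 : C * (1 + ‖x‖) ^ m ≤ |C| * (1 + ‖x‖) ^ (m + n) :=
    mul_le_mul (le_abs_self C) h2 (by positivity) (abs_nonneg _)
  have h5 : D * (1 + ‖x‖) ^ n ≤ |D| * (1 + ‖x‖) ^ (m + n) :=
    mul_le_mul (le_abs_self D) h3 (by positivity) (abs_nonneg _)
  linarith [hC x, hD x]

lemma of_bound {f : E → G₁} (C : ℝ) (H : ∀ x, ‖f x‖ ≤ C) : PolyBdd f :=
  ⟨C, 0, fun x => by simpa using H x⟩

lemma of_le {f : E → G₁} {h : E → G₂} (hf : PolyBdd f) (H : ∀ x, ‖h x‖ ≤ ‖f x‖) : PolyBdd h := by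
  obtain ⟨C, m, hC⟩ := hf
  exact ⟨C, m, fun x => (H x).trans (hC x)⟩

lemma id_self : PolyBdd (fun x : E => x) := ⟨1, 1, fun x => by simp⟩

lemma comp_clm [NormedSpace ℝ E] {E' : Type*} [NormedAddCommGroup E'] [NormedSpace ℝ E']
    {f : E → G₁} (hf : PolyBdd f) (A : E' →L[ℝ] E) : PolyBdd fun x => f (A x) := by
  obtain ⟨C, m, h⟩ := hf
  refine ⟨|C| * (1 + ‖A‖) ^ m, m, fun x => (h (A x)).trans ?_⟩
  rw [mul_assoc, ← mul_pow]
  refine mul_le_mul (le_abs_self _) (pow_le_pow_left₀ (by positivity) ?_ m) (by positivity)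
    (abs_nonneg _)
  have := A.le_opNorm x
  nlinarith [norm_nonneg x, norm_nonneg A]

lemma integrable [NormedSpace ℝ E] [MeasurableSpace E] [BorelSpace E]
    [CompleteSpace E] [SecondCountableTopology E] {G : Type*} [NormedAddCommGroup G] {f : E → G}
    (hf : PolyBdd f) {μ : Measure E}
    [IsGaussian μ] (hm : AEStronglyMeasurable f μ) : Integrable f μ := by
  obtain ⟨C, m, hC⟩ := hf
  have h0 : MemLp (fun x : E => x) (m : ℝ≥0∞) μ :=
    IsGaussian.memLp_id μ m (ENNReal.natCast_ne_top m)
  have h1 : MemLp (fun x : E => (1 : ℝ) + ‖x‖) (m : ℝ≥0∞) μ := (memLp_const (1 : ℝ)).add h0.norm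
  have h2 : Integrable (fun x : E => (1 + ‖x‖) ^ m) μ := by
    refine h1.integrable_norm_pow'.congr (ae_of_all _ fun x => ?_)
    have : 0 ≤ 1 + ‖x‖ := by positivity
    simp only [Real.norm_eq_abs, abs_of_nonneg this]
  exact (h2.const_mul C).mono' hm (ae_of_all _ hC)

end PolyBdd

variable [NormedSpace ℝ E]

/-- Differentiable functions which are polynomially bounded together with their derivative. -/
structure TestFun (H : E → ℂ) : Prop where
  diff : Differentiable ℝ H
  bdd : PolyBdd H
  bdd_fderiv : PolyBdd (fderiv ℝ H)

namespace TestFun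

lemma const (c : ℂ) : TestFun (fun _ : E => c) :=
  ⟨differentiable_const c, .of_bound ‖c‖ fun _ => le_rfl, .of_bound 0 fun x => by simp⟩

lemma clm (M : E →L[ℝ] ℂ) : TestFun (fun x => M x) where
  diff := M.differentiable
  bdd := .of_le_mul (.of_bound (f := fun _ : E => M) ‖M‖ fun _ => le_rfl) .id_self
    fun x => M.le_opNorm x
  bdd_fderiv := .of_bound ‖M‖ fun x => by rw [M.fderiv]

lemma add {G H : E → ℂ} (hG : TestFun G) (hH : TestFun H) : TestFun (fun x => G x + H x) where
  diff := hG.diff.add hH.diff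
  bdd := hG.bdd.of_le_add hH.bdd fun x => norm_add_le _ _
  bdd_fderiv := hG.bdd_fderiv.of_le_add hH.bdd_fderiv fun x => by
    rw [fderiv_fun_add (hG.diff x) (hH.diff x)]; exact norm_add_le _ _

lemma mul {G H : E → ℂ} (hG : TestFun G) (hH : TestFun H) : TestFun (fun x => G x * H x) where
  diff := hG.diff.mul hH.diff
  bdd := hG.bdd.of_le_mul hH.bdd fun x => norm_mul_le _ _
  bdd_fderiv := by
    refine PolyBdd.of_le_add
      (f := fun x => ‖G x‖ * ‖fderiv ℝ H x‖) (g := fun x => ‖H x‖ * ‖fderiv ℝ G x‖)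
      ?_ ?_ fun x => ?_
    · exact hG.bdd.of_le_mul hH.bdd_fderiv fun x => by simp
    · exact hH.bdd.of_le_mul hG.bdd_fderiv fun x => by simp
    · rw [fderiv_fun_mul (hG.diff x) (hH.diff x)]
      refine (norm_add_le _ _).trans (le_of_eq ?_)
      rw [norm_smul, norm_smul]
      simp

lemma sum {κ : Type*} {s : Finset κ} {H : κ → E → ℂ} (h : ∀ k ∈ s, TestFun (H k)) :
    TestFun (fun x => ∑ k ∈ s, H k x) := by
  classical
  induction s using Finset.induction_on with
  | empty => simpa using const (E := E) 0
  | insert a s ha ih =>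
    simp only [Finset.sum_insert ha]
    exact (h a (Finset.mem_insert_self _ _)).add
      (ih fun k hk => h k (Finset.mem_insert_of_mem hk))

lemma star {H : E → ℂ} (hH : TestFun H) : TestFun (fun x => conj (H x)) where
  diff := fun x => (Complex.conjCLE.hasFDerivAt.comp x (hH.diff x).hasFDerivAt).differentiableAt
  bdd := hH.bdd.of_le fun x => by simp
  bdd_fderiv := hH.bdd_fderiv.of_le fun x => by
    have := (Complex.conjCLE.hasFDerivAt.comp x (hH.diff x).hasFDerivAt).fderiv
    change ‖fderiv ℝ (⇑Complex.conjCLE ∘ H) x‖ ≤ _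
    rw [this]
    refine ContinuousLinearMap.opNorm_le_bound _ (norm_nonneg _) fun v => ?_
    simpa using (fderiv ℝ H x).le_opNorm v

/-- `exp (i H)` for a real-valued `H`. -/
lemma cexp {H : E → ℂ} (hH : TestFun H) (hr : ∀ x, (H x).im = 0) :
    TestFun (fun x => Complex.exp (Complex.I * H x)) := by
  have hn : ∀ x, ‖Complex.exp (Complex.I * H x)‖ = 1 := fun x => by
    rw [Complex.norm_exp]; simp [hr]
  refine ⟨fun x => ((hH.diff x).const_mul _).cexp, .of_bound 1 fun x => (hn x).le,
    hH.bdd_fderiv.of_le fun x => ?_⟩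
  rw [(((hH.diff x).hasFDerivAt.const_mul Complex.I).cexp).fderiv, norm_smul, hn, norm_smul]
  simp

lemma comp_clm {E' : Type*} [NormedAddCommGroup E'] [NormedSpace ℝ E'] {H : E → ℂ}
    (hH : TestFun H) (A : E' →L[ℝ] E) : TestFun (fun x => H (A x)) := by
  refine ⟨hH.diff.comp A.differentiable, hH.bdd.comp_clm A, ?_⟩
  refine PolyBdd.of_le_mul (hH.bdd_fderiv.comp_clm A)
    (.of_bound (f := fun _ => A) ‖A‖ fun _ => le_rfl) fun x => ?_
  have := ((hH.diff (A x)).hasFDerivAt.comp x A.hasFDerivAt).fderiv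
  change ‖fderiv ℝ (H ∘ A) x‖ ≤ _
  rw [this]
  exact ContinuousLinearMap.opNorm_comp_le _ _

end TestFun

/-- Complex conjugate of a complex-valued form. -/
def conjForm (w : E →L[ℝ] ℂ) : E →L[ℝ] ℂ := (Complex.conjCLE : ℂ →L[ℝ] ℂ).comp w

@[simp] lemma conjForm_apply (w : E →L[ℝ] ℂ) (x : E) : conjForm w x = conj (w x) := rfl

variable [MeasurableSpace E]

/-- The derivative of `H` in the complexified covariance direction of the complex-valued form `w`:
the operator for which Gaussian integration by parts reads
`∫ w * H ∂μ = ∫ wderiv μ w H ∂μ`. -/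
def wderiv (μ : Measure E) (w : E →L[ℝ] ℂ) (H : E → ℂ) (x : E) : ℂ :=
  fderiv ℝ H x (covVec μ (Complex.reCLM.comp w)) +
    Complex.I * fderiv ℝ H x (covVec μ (Complex.imCLM.comp w))

lemma wderiv_of_hasFDerivAt {μ : Measure E} {w : E →L[ℝ] ℂ} {H : E → ℂ} {x : E}
    {D : E →L[ℝ] ℂ} (h : HasFDerivAt H D x) : wderiv μ w H x =
      D (covVec μ (Complex.reCLM.comp w)) + Complex.I * D (covVec μ (Complex.imCLM.comp w)) := by
  rw [wderiv, h.fderiv]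

lemma wderiv_mul {μ : Measure E} {w : E →L[ℝ] ℂ} {G H : E → ℂ} (hG : TestFun G) (hH : TestFun H)
    (x : E) : wderiv μ w (fun x => G x * H x) x = wderiv μ w G x * H x + G x * wderiv μ w H x := by
  rw [wderiv_of_hasFDerivAt ((hG.diff x).hasFDerivAt.fun_mul (hH.diff x).hasFDerivAt)]
  simp only [wderiv, add_apply, smul_apply, smul_eq_mul]
  ring

lemma wderiv_cexp {μ : Measure E} {w : E →L[ℝ] ℂ} {H : E → ℂ} (hH : TestFun H) (x : E) :
    wderiv μ w (fun x => Complex.exp (Complex.I * H x)) x =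
      Complex.I * wderiv μ w H x * Complex.exp (Complex.I * H x) := by
  rw [wderiv_of_hasFDerivAt (((hH.diff x).hasFDerivAt.const_mul _).cexp)]
  simp only [wderiv, smul_apply, smul_eq_mul]
  ring

lemma wderiv_conj {μ : Measure E} {w : E →L[ℝ] ℂ} {H : E → ℂ} (hH : TestFun H)
    (x : E) : wderiv μ w (fun x => conj (H x)) x = conj (wderiv μ (conjForm w) H x) := by
  have h0 : HasFDerivAt (fun x => conj (H x)) (conjForm (fderiv ℝ H x)) x :=
    Complex.conjCLE.hasFDerivAt.comp x (hH.diff x).hasFDerivAt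
  have h1 : Complex.reCLM.comp (conjForm w) = Complex.reCLM.comp w := by ext; simp
  have h2 : covVec μ (Complex.imCLM.comp (conjForm w)) = - covVec μ (Complex.imCLM.comp w) := by
    rw [covVec, covVec, ← integral_neg]
    simp
  rw [wderiv_of_hasFDerivAt h0, wderiv, h1, h2]
  simp

variable [BorelSpace E] [CompleteSpace E] [SecondCountableTopology E]

lemma TestFun.integrable {H : E → ℂ} (hH : TestFun H) (μ : Measure E) [IsGaussian μ] :
    Integrable H μ :=
  hH.bdd.integrable hH.diff.continuous.aestronglyMeasurable

/-- **Gaussian integration by parts** for complex-valued forms. -/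
lemma integral_clm_mul (μ : Measure E) [IsGaussian μ] (hμ : ∫ x, x ∂μ = 0) (w : E →L[ℝ] ℂ)
    {H : E → ℂ} (hH : TestFun H) : ∫ x, w x * H x ∂μ = ∫ x, wderiv μ w H x ∂μ := by
  have hd : ∀ v : E, Integrable (fun x => fderiv ℝ H x v) μ := fun v => by
    refine PolyBdd.integrable (hH.bdd_fderiv.of_le_mul
      (.of_bound (f := fun _ => v) ‖v‖ fun _ => le_rfl) fun x => ?_)
      (measurable_fderiv_apply_const ℝ H v).aestronglyMeasurable
    exact (fderiv ℝ H x).le_opNorm v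
  have key : ∀ L : E →L[ℝ] ℝ, Integrable (fun x => (L x : ℂ) * H x) μ ∧
      ∫ x, (L x : ℂ) * H x ∂μ = ∫ x, fderiv ℝ H x (covVec μ L) ∂μ := by
    intro L
    have h1 : Integrable (fun x => (L x : ℂ) * H x) μ :=
      ((TestFun.clm (Complex.ofRealCLM.comp L)).mul hH).integrable μ
    refine ⟨h1, integral_dual_mul_eq μ hμ L (fun x => ?_) (hH.integrable μ) (hd _) h1⟩
    have h2 : HasFDerivAt H (fderiv ℝ H x) (x + (0 : ℝ) • covVec μ L) := by
      simpa using (hH.diff x).hasFDerivAt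
    have h3 : HasDerivAt (fun t : ℝ => x + t • covVec μ L) (covVec μ L) 0 := by
      simpa using ((hasDerivAt_id (0 : ℝ)).smul_const (covVec μ L)).const_add x
    exact h2.comp_hasDerivAt (0 : ℝ) h3
  obtain ⟨a1, a2⟩ := key (Complex.reCLM.comp w)
  obtain ⟨b1, b2⟩ := key (Complex.imCLM.comp w)
  unfold wderiv
  rw [integral_add (hd _) ((hd _).const_mul _), integral_const_mul, ← a2, ← b2,
    ← integral_const_mul, ← integral_add a1 (b1.const_mul _)]
  congr 1
  ext x
  simp only [ContinuousLinearMap.comp_apply, Complex.reCLM_apply, Complex.imCLM_apply]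
  conv_lhs => rw [← Complex.re_add_im (w x)]
  ring

lemma clm_covVec_add (μ : Measure E) [IsGaussian μ] (w M : E →L[ℝ] ℂ) :
    M (covVec μ (Complex.reCLM.comp w)) + Complex.I * M (covVec μ (Complex.imCLM.comp w)) =
      ∫ x, w x * M x ∂μ := by
  rw [clm_covVec, clm_covVec, ← integral_const_mul, ← integral_add]
  · congr 1
    ext x
    simp only [ContinuousLinearMap.comp_apply, Complex.reCLM_apply, Complex.imCLM_apply,
      Complex.real_smul]
    conv_rhs => rw [← Complex.re_add_im (w x)]
    ring
  · exact ((TestFun.clm (Complex.ofRealCLM.comp (Complex.reCLM.comp w))).mul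
      (TestFun.clm M)).integrable μ
  · exact (((TestFun.clm (Complex.ofRealCLM.comp (Complex.imCLM.comp w))).mul
      (TestFun.clm M)).integrable μ).const_mul _

end

/-! ### Symmetric tensors and their polynomials -/

section Tensors

variable {ι ι' A : Type*}

/-- Invariance of a tensor under permutations of its indices. -/
def IsSymm {p : ℕ} (c : (Fin p → ι) → A) : Prop :=
  ∀ (π : Equiv.Perm (Fin p)) (i : Fin p → ι), c (fun a => i (π a)) = c i

/-- The tensor vanishes as soon as two of its indices are related by `R`. -/
def OffDiag [Zero A] (R : ι → ι → Prop) {p : ℕ} (c : (Fin p → ι) → A) : Prop :=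
  ∀ (i : Fin p → ι) (a b : Fin p), a ≠ b → R (i a) (i b) → c i = 0

/-- Fix the last index of a tensor to be `k`; scalars (tensors of order `0`) are sent to `0`. -/
def del [Zero A] : {p : ℕ} → ((Fin p → ι) → A) → ι → (Fin (p - 1) → ι) → A
  | 0, _, _ => fun _ => 0
  | _ + 1, c, k => fun i => c (Fin.snoc (α := fun _ => ι) i k)

@[simp] lemma del_zero_order [Zero A] (c : (Fin 0 → ι) → A) (k : ι) : del c k = 0 := rfl

lemma del_succ [Zero A] {p : ℕ} (c : (Fin (p + 1) → ι) → A) (k : ι) (i : Fin p → ι) :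
    del c k i = c (Fin.snoc (α := fun _ => ι) i k) := rfl

lemma del_zero [Zero A] {p : ℕ} (k : ι) : del (0 : (Fin p → ι) → A) k = 0 := by
  cases p <;> rfl

/-- Extend a permutation of `Fin p` to `Fin (p + 1)` by fixing the last point. -/
def permSnoc {p : ℕ} (π : Equiv.Perm (Fin p)) : Equiv.Perm (Fin (p + 1)) :=
  (finSuccEquivLast (n := p)).trans ((Equiv.optionCongr π).trans finSuccEquivLast.symm)

lemma snoc_permSnoc {p : ℕ} (π : Equiv.Perm (Fin p)) (i : Fin p → ι) (k : ι) :
    (fun a => (Fin.snoc (α := fun _ => ι) i k : Fin (p + 1) → ι) (permSnoc π a)) =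
      Fin.snoc (α := fun _ => ι) (fun a => i (π a)) k := by
  ext a
  refine Fin.lastCases ?_ (fun a => ?_) a <;> simp [permSnoc]

lemma IsSymm.del [Zero A] {p : ℕ} {c : (Fin p → ι) → A} (hc : IsSymm c) (k : ι) :
    IsSymm (del c k) := by
  cases p with
  | zero => intro π i; rfl
  | succ p =>
    intro π i
    exact (congrArg c (snoc_permSnoc (p := p) π i k)).symm.trans (hc (permSnoc (p := p) π) _)

lemma OffDiag.del [Zero A] {R : ι → ι → Prop} {p : ℕ} {c : (Fin p → ι) → A} (hc : OffDiag R c)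
    (k : ι) : OffDiag R (del c k) := by
  cases p with
  | zero => intro i a b _ _; rfl
  | succ p =>
    intro i a b hab h
    rw [del_succ]
    refine hc _ (Fin.castSucc a) (Fin.castSucc b) (by simpa using hab) ?_
    simpa using h

lemma OffDiag.del_del [Zero A] {R : ι → ι → Prop} {p : ℕ} {c : (Fin p → ι) → A}
    (hc : OffDiag R c) {k m : ι} (h : R k m) : WienerIto.del (WienerIto.del c k) m = 0 := by
  match p, c, hc with
  | 0, c, hc => rfl
  | 1, c, hc => rfl
  | p + 2, c, hc =>
    ext1 i
    change c (Fin.snoc (α := fun _ => ι) (Fin.snoc (α := fun _ => ι) i m : Fin (p + 1) → ι) k) = 0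
    refine hc _ (Fin.last _) (Fin.castSucc (Fin.last _)) (Fin.castSucc_lt_last _).ne' ?_
    simp [h]

lemma IsSymm.del_comm [Zero A] {p : ℕ} {c : (Fin p → ι) → A} (hc : IsSymm c) (k m : ι) :
    WienerIto.del (WienerIto.del c k) m = WienerIto.del (WienerIto.del c m) k := by
  match p, c, hc with
  | 0, c, hc => rfl
  | 1, c, hc => rfl
  | p + 2, c, hc =>
    ext1 i
    change c (Fin.snoc (α := fun _ => ι) (Fin.snoc (α := fun _ => ι) i m : Fin (p + 1) → ι) k) =
      c (Fin.snoc (α := fun _ => ι) (Fin.snoc (α := fun _ => ι) i k : Fin (p + 1) → ι) m)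
    rw [← hc (Equiv.swap (Fin.last _) (Fin.castSucc (Fin.last _)))]
    congr 1
    ext a
    refine Fin.lastCases ?_ (fun a => ?_) a
    · simp
    · refine Fin.lastCases ?_ (fun a => ?_) a
      · simp
      · rw [Equiv.swap_apply_of_ne_of_ne (Fin.castSucc_lt_last _).ne
          (by simp)]
        simp

lemma del_flip {a b : ℕ} (T : (Fin a → ι) → (Fin b → ι') → ℂ) (k : ι) (l : ι')
    (i : Fin (a - 1) → ι) (j : Fin (b - 1) → ι') :
    del (del T k i) l j = del (del (flip T) l j) k i := by
  cases a <;> cases b <;> rfl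

/-- The tensors for which the second moment of `bpoly` is estimated: symmetric in each of the two
blocks of indices, and vanishing on the diagonals of each block. -/
structure GoodTensor {a b : ℕ} (R : ι → ι → Prop) (R' : ι' → ι' → Prop)
    (T : (Fin a → ι) → (Fin b → ι') → ℂ) : Prop where
  symX : IsSymm T
  symY : ∀ i, IsSymm (T i)
  offX : OffDiag R T
  offY : ∀ i, OffDiag R' (T i)

lemma GoodTensor.flip {a b : ℕ} {R : ι → ι → Prop} {R' : ι' → ι' → Prop}
    {T : (Fin a → ι) → (Fin b → ι') → ℂ} (h : GoodTensor R R' T) : GoodTensor R' R (flip T) where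
  symX π j := funext fun i => h.symY i π j
  symY j π i := congrFun (h.symX π i) j
  offX j c d hcd hR := funext fun i => h.offY i j c d hcd hR
  offY j i c d hcd hR := congrFun (h.offX i c d hcd hR) j

lemma GoodTensor.delX {a b : ℕ} {R : ι → ι → Prop} {R' : ι' → ι' → Prop}
    {T : (Fin a → ι) → (Fin b → ι') → ℂ} (h : GoodTensor R R' T) (k : ι) :
    GoodTensor R R' (del T k) where
  symX := h.symX.del k
  symY i := by
    cases a with
    | zero => intro π j; rfl
    | succ a => exact h.symY _
  offX := h.offX.del k
  offY i := by
    cases a with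
    | zero => intro j c d _ _; rfl
    | succ a => exact h.offY _

lemma del_flip_eq {a b : ℕ} (T : (Fin a → ι) → (Fin b → ι') → ℂ) (l : ι') :
    del (flip T) l = flip fun i => del (T i) l := by
  cases b <;> rfl

lemma GoodTensor.delY {a b : ℕ} {R : ι → ι → Prop} {R' : ι' → ι' → Prop}
    {T : (Fin a → ι) → (Fin b → ι') → ℂ} (h : GoodTensor R R' T) (l : ι') :
    GoodTensor R R' fun i => del (T i) l := by
  have := (h.flip.delX l).flip
  rwa [del_flip_eq] at this

lemma sum_snoc [Fintype ι] [AddCommMonoid A] {p : ℕ} (f : (Fin (p + 1) → ι) → A) :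
    ∑ i, f i = ∑ k : ι, ∑ i : Fin p → ι, f (Fin.snoc (α := fun _ => ι) i k) := by
  rw [← (Fin.snocEquiv fun _ => ι).sum_comp, Fintype.sum_prod_type]
  rfl

variable [Fintype ι] [Fintype ι']

/-- The homogeneous polynomial `∑ c_{i₁,…,i_p} x_{i₁} ⋯ x_{i_p}`. -/
def mpoly {p : ℕ} (c : (Fin p → ι) → ℂ) (x : ι → ℂ) : ℂ := ∑ i, c i * ∏ a, x (i a)

/-- The bihomogeneous polynomial `∑ T_{i,j} x_{i₁} ⋯ x_{i_a} y_{j₁} ⋯ y_{j_b}`. -/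
def bpoly {a b : ℕ} (T : (Fin a → ι) → (Fin b → ι') → ℂ) (x : ι → ℂ) (y : ι' → ℂ) : ℂ :=
  mpoly (fun i => mpoly (T i) y) x

lemma mpoly_zero {p : ℕ} (x : ι → ℂ) : mpoly (0 : (Fin p → ι) → ℂ) x = 0 := by simp [mpoly]

lemma mpoly_sum {p : ℕ} {κ : Type*} (s : Finset κ) (c : κ → (Fin p → ι) → ℂ) (x : ι → ℂ) :
    mpoly (fun i => ∑ k ∈ s, c k i) x = ∑ k ∈ s, mpoly (c k) x := by
  simp only [mpoly, Finset.sum_mul]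
  rw [Finset.sum_comm]

lemma mpoly_const_mul {p : ℕ} (r : ℂ) (c : (Fin p → ι) → ℂ) (x : ι → ℂ) :
    mpoly (fun i => r * c i) x = r * mpoly c x := by
  simp only [mpoly, Finset.mul_sum, mul_assoc]

lemma mpoly_mul_const {p : ℕ} (r : ℂ) (c : (Fin p → ι) → ℂ) (x : ι → ℂ) :
    mpoly (fun i => c i * r) x = mpoly c x * r := by
  rw [mul_comm, ← mpoly_const_mul]
  simp only [mul_comm]

lemma mpoly_succ {p : ℕ} (c : (Fin (p + 1) → ι) → ℂ) (x : ι → ℂ) :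
    mpoly c x = ∑ k, x k * mpoly (del c k) x := by
  rw [mpoly, sum_snoc]
  refine Finset.sum_congr rfl fun k _ => ?_
  rw [mpoly, Finset.mul_sum]
  refine Finset.sum_congr rfl fun i _ => ?_
  rw [Fin.prod_univ_castSucc, del_succ]
  simp only [Fin.snoc_castSucc, Fin.snoc_last]
  change _ = x k * (c _ * ∏ a : Fin p, x (i a))
  ring

lemma bpoly_flip {a b : ℕ} (T : (Fin a → ι) → (Fin b → ι') → ℂ) (x : ι → ℂ) (y : ι' → ℂ) :
    bpoly T x y = bpoly (flip T) y x := by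
  simp only [bpoly, mpoly, flip, Finset.sum_mul]
  rw [Finset.sum_comm]
  exact Finset.sum_congr rfl fun _ _ => Finset.sum_congr rfl fun _ _ => by ring

lemma bpoly_zero {a b : ℕ} (x : ι → ℂ) (y : ι' → ℂ) :
    bpoly (0 : (Fin a → ι) → (Fin b → ι') → ℂ) x y = 0 := by simp [bpoly, mpoly]

lemma bpoly_succ {a b : ℕ} (T : (Fin (a + 1) → ι) → (Fin b → ι') → ℂ) (x : ι → ℂ) (y : ι' → ℂ) :
    bpoly T x y = ∑ k, x k * bpoly (del T k) x y := by
  rw [bpoly, mpoly_succ]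
  rfl

/-- The contraction of one pair of indices of a two-block tensor, one index from each block,
through the matrix `K`. -/
def contr {a b : ℕ} (K : ι → ι' → ℝ) (T : (Fin a → ι) → (Fin b → ι') → ℂ) :
    (Fin (a - 1) → ι) → (Fin (b - 1) → ι') → ℂ :=
  fun i j => ∑ k, ∑ l, (K k l : ℂ) * del (del T k i) l j

lemma contr_flip {a b : ℕ} (K : ι → ι' → ℝ) (T : (Fin a → ι) → (Fin b → ι') → ℂ) :
    contr (flip K) (flip T) = flip (contr K T) := by
  ext j i
  simp only [contr, flip]
  rw [Finset.sum_comm]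
  exact Finset.sum_congr rfl fun _ _ => Finset.sum_congr rfl fun _ _ => by rw [del_flip]; rfl

lemma contr_del {a b : ℕ} (K : ι → ι' → ℝ) {T : (Fin a → ι) → (Fin b → ι') → ℂ} (hT : IsSymm T)
    (k : ι) : contr K (del T k) = del (contr K T) k := by
  ext i j
  simp only [contr]
  simp only [hT.del_comm k]
  match a, T with
  | 0, T => simp [del_zero]
  | 1, T => simp [del_zero]
  | a + 2, T => rfl

lemma bpoly_contr {a b : ℕ} (K : ι → ι' → ℝ) (T : (Fin a → ι) → (Fin b → ι') → ℂ)
    (x : ι → ℂ) (y : ι' → ℂ) : bpoly (contr K T) x y =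
      ∑ k, ∑ l, (K k l : ℂ) * bpoly (fun i => del (del T k i) l) x y := by
  unfold contr bpoly
  simp only [mpoly_sum, mpoly_const_mul]

variable {a b : ℕ} {R : ι → ι → Prop} {R' : ι' → ι' → Prop} {T : (Fin a → ι) → (Fin b → ι') → ℂ}

lemma GoodTensor.contr (h : GoodTensor R R' T) (K : ι → ι' → ℝ) :
    GoodTensor R R' (contr K T) where
  symX π i := by
    ext j
    simp only [WienerIto.contr]
    exact Finset.sum_congr rfl fun k _ => Finset.sum_congr rfl fun l _ => by
      rw [(h.delX k).symX π i]
  symY i π j := by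
    simp only [WienerIto.contr]
    exact Finset.sum_congr rfl fun k _ => Finset.sum_congr rfl fun l _ => by
      rw [((h.delX k).symY i).del l π j]
  offX i c d hcd hR := by
    ext j
    simp only [WienerIto.contr]
    exact Finset.sum_eq_zero fun k _ => Finset.sum_eq_zero fun l _ => by
      rw [(h.delX k).offX i c d hcd hR, del_zero]; simp
  offY i j c d hcd hR := by
    simp only [WienerIto.contr]
    exact Finset.sum_eq_zero fun k _ => Finset.sum_eq_zero fun l _ => by
      rw [((h.delX k).offY i).del l j c d hcd hR]; simp

/-- The squared weighted `ℓ²` norm of the `r`-fold contraction of a two-block tensor. -/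
def contrNormSq (K : ι → ι' → ℝ) (F : ι → ℝ) (F' : ι' → ℝ) :
    ℕ → {a b : ℕ} → ((Fin a → ι) → (Fin b → ι') → ℂ) → ℝ
  | 0, _, _, T => ∑ i, ∑ j, (∏ c, F (i c)) * (∏ d, F' (j d)) * ‖T i j‖ ^ 2
  | r + 1, _, _, T => contrNormSq K F F' r (contr K T)

variable {K : ι → ι' → ℝ} {F : ι → ℝ} {F' : ι' → ℝ}

lemma contrNormSq_nonneg (hF : ∀ k, 0 ≤ F k) (hF' : ∀ l, 0 ≤ F' l) (r : ℕ) {a b : ℕ}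
    (T : (Fin a → ι) → (Fin b → ι') → ℂ) : 0 ≤ contrNormSq K F F' r T := by
  induction r generalizing a b with
  | zero =>
    exact Finset.sum_nonneg fun i _ => Finset.sum_nonneg fun j _ => mul_nonneg
      (mul_nonneg (Finset.prod_nonneg fun _ _ => hF _) (Finset.prod_nonneg fun _ _ => hF' _))
      (sq_nonneg _)
  | succ r ih => exact ih _

lemma contrNormSq_zero (r : ℕ) {a b : ℕ} :
    contrNormSq K F F' r (0 : (Fin a → ι) → (Fin b → ι') → ℂ) = 0 := by
  induction r generalizing a b with
  | zero => simp [contrNormSq]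
  | succ r ih =>
    have : contr K (0 : (Fin a → ι) → (Fin b → ι') → ℂ) = 0 := by
      ext i j; simp [contr, del_zero]
    rw [contrNormSq, this, ih]

lemma contrNormSq_flip (r : ℕ) {a b : ℕ} (T : (Fin a → ι) → (Fin b → ι') → ℂ) :
    contrNormSq (flip K) F' F r (flip T) = contrNormSq K F F' r T := by
  induction r generalizing a b with
  | zero =>
    rw [contrNormSq, contrNormSq, Finset.sum_comm]
    refine Finset.sum_congr rfl fun _ _ => Finset.sum_congr rfl fun _ _ => ?_
    simp only [flip]
    ring
  | succ r ih => rw [contrNormSq, contrNormSq, contr_flip, ih]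

lemma sum_contrNormSq_del_le (hF : ∀ k, 0 ≤ F k) (hF' : ∀ l, 0 ≤ F' l) (r : ℕ) {a b : ℕ}
    {T : (Fin a → ι) → (Fin b → ι') → ℂ} (hT : GoodTensor R R' T) :
    ∑ k, F k * contrNormSq K F F' r (del T k) ≤ contrNormSq K F F' r T := by
  induction r generalizing a b with
  | zero =>
    cases a with
    | zero =>
      simp only [del_zero_order, contrNormSq_zero, mul_zero, Finset.sum_const_zero]
      exact contrNormSq_nonneg hF hF' 0 T
    | succ a =>
      apply le_of_eq
      simp only [contrNormSq]
      rw [sum_snoc]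
      refine Finset.sum_congr rfl fun k _ => ?_
      rw [Finset.mul_sum]
      refine Finset.sum_congr rfl fun i _ => ?_
      rw [Finset.mul_sum]
      refine Finset.sum_congr rfl fun j _ => ?_
      rw [Fin.prod_univ_castSucc, del_succ]
      simp only [Fin.snoc_castSucc, Fin.snoc_last]
      change F k * ((∏ c : Fin a, F (i c)) * _ * _) = (∏ c : Fin a, F (i c)) * _ * _ * _
      ring
  | succ r ih =>
    simp only [contrNormSq, contr_del K hT.symX]
    exact ih (hT.contr K)

lemma sum_contrNormSq_del_right_le (hF : ∀ k, 0 ≤ F k) (hF' : ∀ l, 0 ≤ F' l) (r : ℕ) {a b : ℕ}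
    {T : (Fin a → ι) → (Fin b → ι') → ℂ} (hT : GoodTensor R R' T) :
    ∑ l, F' l * contrNormSq K F F' r (fun i => del (T i) l) ≤ contrNormSq K F F' r T := by
  rw [← contrNormSq_flip r T]
  refine (le_of_eq ?_).trans (sum_contrNormSq_del_le (K := flip K) hF' hF r hT.flip)
  refine Finset.sum_congr rfl fun l _ => ?_
  rw [← contrNormSq_flip]
  congr 2
  exact (del_flip_eq T l).symm

end Tensors

section Derivatives

variable {E : Type*} [NormedAddCommGroup E] [NormedSpace ℝ E]
variable {ι ι' : Type*} [Fintype ι] [Fintype ι']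

lemma testFun_mpoly {p : ℕ} (c : (Fin p → ι) → ℂ) (X : ι → E →L[ℝ] ℂ) :
    TestFun (fun e => mpoly c fun k => X k e) := by
  induction p with
  | zero => simpa [mpoly] using TestFun.const _
  | succ p ih =>
    simp only [mpoly_succ]
    exact TestFun.sum fun k _ => (TestFun.clm _).mul (ih _)

lemma testFun_bpoly {a b : ℕ} (T : (Fin a → ι) → (Fin b → ι') → ℂ) (X : ι → E →L[ℝ] ℂ)
    (Y : ι' → E →L[ℝ] ℂ) : TestFun (fun e => bpoly T (fun k => X k e) fun l => Y l e) := by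
  induction a with
  | zero => simpa [bpoly, mpoly] using testFun_mpoly (T _) Y
  | succ a ih =>
    simp only [bpoly_succ]
    exact TestFun.sum fun k _ => (TestFun.clm _).mul (ih _)

lemma hasFDerivAt_mpoly {p : ℕ} {c : (Fin p → ι) → ℂ} (hc : IsSymm c) (X : ι → E →L[ℝ] ℂ) (e : E) :
    HasFDerivAt (fun e => mpoly c fun k => X k e)
      (∑ k, ((p : ℂ) * mpoly (del c k) fun k => X k e) • X k) e := by
  induction p with
  | zero =>
    have h : HasFDerivAt (fun e : E => mpoly c fun k => X k e) (0 : E →L[ℝ] ℂ) e := by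
      simpa [mpoly] using hasFDerivAt_const (𝕜 := ℝ) (c default) e
    refine h.congr_fderiv ?_
    ext v
    simp
  | succ p ih =>
    simp only [mpoly_succ]
    have h := HasFDerivAt.fun_sum (u := Finset.univ) fun k (_ : k ∈ Finset.univ) =>
      (X k).hasFDerivAt.fun_mul (x := e) (ih (hc.del k))
    refine h.congr_fderiv ?_
    rw [Finset.sum_add_distrib, add_comm]
    have h2 : ∑ k, X k e • ∑ m, ((p : ℂ) * mpoly (del (del c k) m) fun k => X k e) • X m =
        ∑ m, ((p : ℂ) * mpoly (del c m) fun k => X k e) • X m := by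
      simp only [Finset.smul_sum, smul_smul]
      rw [Finset.sum_comm]
      refine Finset.sum_congr rfl fun m _ => ?_
      rw [← Finset.sum_smul]
      congr 1
      cases p with
      | zero => simp
      | succ p =>
        rw [mpoly_succ, Finset.mul_sum]
        refine Finset.sum_congr rfl fun k _ => ?_
        rw [hc.del_comm k m]
        ring
    rw [h2, ← Finset.sum_add_distrib]
    refine Finset.sum_congr rfl fun m _ => ?_
    rw [← add_smul]
    congr 1
    push_cast
    change mpoly (del c m) _ + p * mpoly (del c m) _ = _
    ring

lemma hasFDerivAt_bpoly {a b : ℕ} {T : (Fin a → ι) → (Fin b → ι') → ℂ} (hX : IsSymm T)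
    (hY : ∀ i, IsSymm (T i)) (X : ι → E →L[ℝ] ℂ) (Y : ι' → E →L[ℝ] ℂ) (e : E) :
    HasFDerivAt (fun e => bpoly T (fun k => X k e) fun l => Y l e)
      (∑ k, ((a : ℂ) * bpoly (del T k) (fun k => X k e) fun l => Y l e) • X k +
        ∑ l, ((b : ℂ) * bpoly (fun i => del (T i) l) (fun k => X k e) fun l => Y l e) • Y l) e := by
  -- the product rule, with the derivatives in the two groups of variables identified separately
  set D : (Fin b → ι') → E →L[ℝ] ℂ := fun j => fderiv ℝ (fun e => ∏ d, Y (j d) e) e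
  have hD : ∀ j, HasFDerivAt (fun e => ∏ d, Y (j d) e) (D j) e := fun j => by
    refine DifferentiableAt.hasFDerivAt ?_
    classical
    have := (testFun_mpoly (fun j' => if j' = j then (1 : ℂ) else 0) Y).diff e
    simpa [mpoly] using this
  have hsX : ∀ j, IsSymm fun i => T i j := fun j π i => congrFun (hX π i) j
  have e1 : (fun e => bpoly T (fun k => X k e) fun l => Y l e) =
      fun e => ∑ j, mpoly (fun i => T i j) (fun k => X k e) * ∏ d, Y (j d) e := by
    ext e
    rw [bpoly_flip]
    rfl
  rw [e1]
  have h := HasFDerivAt.fun_sum (u := Finset.univ) fun j (_ : j ∈ Finset.univ) =>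
    (hasFDerivAt_mpoly (hsX j) X e).fun_mul (hD j)
  refine h.congr_fderiv ?_
  have h2 := HasFDerivAt.fun_sum (u := Finset.univ) fun j (_ : j ∈ Finset.univ) =>
    (hD j).const_mul (mpoly (fun i => T i j) fun k => X k e)
  have hs : IsSymm (fun j => mpoly (fun i => T i j) fun k => X k e) := fun π j => by
    simp only [hY _ π j]
  have h3 := hasFDerivAt_mpoly hs Y e
  rw [Finset.sum_add_distrib, h2.unique h3, add_comm]
  congr 1
  · simp only [Finset.smul_sum, smul_smul]
    rw [Finset.sum_comm]
    refine Finset.sum_congr rfl fun k _ => ?_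
    rw [← Finset.sum_smul]
    congr 1
    rw [bpoly_flip, bpoly, mpoly, Finset.mul_sum]
    refine Finset.sum_congr rfl fun j _ => ?_
    have : del (fun i => T i j) k = flip (del T k) j := by cases a <;> rfl
    rw [this]
    ring
  · refine Finset.sum_congr rfl fun l _ => ?_
    rw [bpoly_flip, bpoly]
    have : (fun i => mpoly (flip (fun i => del (T i) l) i) fun k => X k e) =
        del (fun j => mpoly (fun i => T i j) fun k => X k e) l := by
      cases b with
      | zero => ext j; simp [flip, mpoly]
      | succ b => rfl
    rw [this]

end Derivatives

/-! ### Second moments of bihomogeneous polynomials in Gaussian forms -/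

section

variable {E : Type*} [NormedAddCommGroup E] [NormedSpace ℝ E] [MeasurableSpace E]
variable {ι ι' : Type*} [Fintype ι] [Fintype ι']

/-- Two families of complex-valued forms on a Gaussian space, with weights `F` and `F'`. Each
family is orthogonal in the Hermitian sense, `E [X_k X_m]` vanishes unless `R k m`, and the two
families are correlated through `ρ K` and, in the Hermitian sense, through `ρ K'`, where `K'` is a
nonnegative matrix with row and column sums dominated by the weights. -/
structure CorrForms [DecidableEq ι] [DecidableEq ι'] (μ : Measure E) (X : ι → E →L[ℝ] ℂ)
    (Y : ι' → E →L[ℝ] ℂ) (F : ι → ℝ) (F' : ι' → ℝ) (R : ι → ι → Prop) (R' : ι' → ι' → Prop)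
    (K K' : ι → ι' → ℝ) (ρ : ℝ) : Prop where
  XX : ∀ k m, ¬ R k m → ∫ e, X k e * X m e ∂μ = 0
  YY : ∀ k m, ¬ R' k m → ∫ e, Y k e * Y m e ∂μ = 0
  conjXX : ∀ k m, ∫ e, conj (X k e) * X m e ∂μ = if k = m then (F k : ℂ) else 0
  conjYY : ∀ k m, ∫ e, conj (Y k e) * Y m e ∂μ = if k = m then (F' k : ℂ) else 0
  XY : ∀ k l, ∫ e, X k e * Y l e ∂μ = ρ * K k l
  conjXY : ∀ k l, ∫ e, conj (X k e) * Y l e ∂μ = ρ * K' k l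
  nonneg : ∀ k l, 0 ≤ K' k l
  row : ∀ k, ∑ l, K' k l ≤ F k
  col : ∀ l, ∑ k, K' k l ≤ F' l
  abs_le : |ρ| ≤ 1

/-- The second moment of `bpoly T X Y`. -/
def secondMoment (μ : Measure E) (X : ι → E →L[ℝ] ℂ) (Y : ι' → E →L[ℝ] ℂ) {a b : ℕ}
    (T : (Fin a → ι) → (Fin b → ι') → ℂ) : ℝ :=
  ∫ e, ‖bpoly T (fun k => X k e) fun l => Y l e‖ ^ 2 ∂μ

variable {μ : Measure E} {X : ι → E →L[ℝ] ℂ} {Y : ι' → E →L[ℝ] ℂ} {F : ι → ℝ}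
  {F' : ι' → ℝ} {R : ι → ι → Prop} {R' : ι' → ι' → Prop} {K K' : ι → ι' → ℝ} {ρ : ℝ}

namespace CorrForms

variable [DecidableEq ι] [DecidableEq ι']

lemma flip (h : CorrForms μ X Y F F' R R' K K' ρ) :
    CorrForms μ Y X F' F R' R (flip K) (flip K') ρ where
  XX := h.YY
  YY := h.XX
  conjXX := h.conjYY
  conjYY := h.conjXX
  XY k l := by rw [← show _ = (ρ : ℂ) * (_root_.flip K k l : ℝ) from h.XY l k]; simp only [mul_comm]
  conjXY k l := by
    have := congrArg (starRingEnd ℂ) (h.conjXY l k)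
    rw [← integral_conj] at this
    simp only [map_mul, Complex.conj_conj, Complex.conj_ofReal] at this
    rw [← show _ = (ρ : ℂ) * (_root_.flip K' k l : ℝ) from this]
    simp only [mul_comm]
  nonneg k l := h.nonneg l k
  row := h.col
  col := h.row
  abs_le := h.abs_le

lemma nonneg_left (h : CorrForms μ X Y F F' R R' K K' ρ) (k : ι) : 0 ≤ F k :=
  (Finset.sum_nonneg fun _ _ => h.nonneg _ _).trans (h.row k)

lemma nonneg_right (h : CorrForms μ X Y F F' R R' K K' ρ) (l : ι') : 0 ≤ F' l :=
  (Finset.sum_nonneg fun _ _ => h.nonneg _ _).trans (h.col l)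

end CorrForms

lemma secondMoment_flip {a b : ℕ} (T : (Fin a → ι) → (Fin b → ι') → ℂ) :
    secondMoment μ Y X (flip T) = secondMoment μ X Y T := by
  simp only [secondMoment, bpoly_flip T]

variable [BorelSpace E] [CompleteSpace E] [SecondCountableTopology E] [IsGaussian μ]

lemma wderiv_bpoly {a b : ℕ} {T : (Fin a → ι) → (Fin b → ι') → ℂ} (hX : IsSymm T)
    (hY : ∀ i, IsSymm (T i)) (w : E →L[ℝ] ℂ) (e : E) :
    wderiv μ w (fun e => bpoly T (fun k => X k e) fun l => Y l e) e =
      ∑ k, (a : ℂ) * bpoly (del T k) (fun k => X k e) (fun l => Y l e) * ∫ e, w e * X k e ∂μ +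
      ∑ l, (b : ℂ) * bpoly (fun i => del (T i) l) (fun k => X k e) (fun l => Y l e) *
        ∫ e, w e * Y l e ∂μ := by
  rw [wderiv_of_hasFDerivAt (hasFDerivAt_bpoly hX hY X Y e)]
  simp only [← clm_covVec_add, add_apply, sum_apply, smul_apply, smul_eq_mul, mul_add,
    Finset.mul_sum, Finset.sum_add_distrib]
  simp only [mul_left_comm Complex.I]
  ring

lemma integrable_norm_sq_bpoly {a b : ℕ} (T : (Fin a → ι) → (Fin b → ι') → ℂ) :
    Integrable (fun e => ‖bpoly T (fun k => X k e) fun l => Y l e‖ ^ 2) μ := by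
  have h := testFun_bpoly T X Y
  refine (((h.mul h.star).integrable μ).re).congr (ae_of_all _ fun e => ?_)
  simp only [Complex.mul_conj, RCLike.re_eq_complex_re, Complex.ofReal_re,
    Complex.normSq_eq_norm_sq]

variable [DecidableEq ι] [DecidableEq ι']

/-- One step of the second moment estimate: expand one factor of `bpoly T X Y` in its last `X`
variable and integrate by parts. -/
lemma secondMoment_succ_le (hμ : ∫ x, x ∂μ = 0) (h : CorrForms μ X Y F F' R R' K K' ρ) {a b : ℕ}
    {T : (Fin (a + 1) → ι) → (Fin b → ι') → ℂ} (hT : GoodTensor R R' T) :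
    secondMoment μ X Y T ≤ b ^ 2 * secondMoment μ X Y (contr K T) +
      (2 * a + 2 + b) * ∑ k, F k * secondMoment μ X Y (del T k) +
      b * ∑ l, F' l * secondMoment μ X Y (fun i => del (T i) l) := by
  set q : E → ℂ := fun e => bpoly T (fun k => X k e) fun l => Y l e with hq
  set qc : E → ℂ := fun e => bpoly (contr K T) (fun k => X k e) fun l => Y l e with hqc
  set qX : ι → E → ℂ := fun k e => bpoly (del T k) (fun k => X k e) fun l => Y l e with hqX
  set qY : ι' → E → ℂ := fun l e => bpoly (fun i => del (T i) l) (fun k => X k e) fun l => Y l e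
    with hqY
  have tq : TestFun q := testFun_bpoly T X Y
  have tc : TestFun qc := testFun_bpoly _ X Y
  have tX : ∀ k, TestFun (qX k) := fun k => testFun_bpoly _ X Y
  have tY : ∀ k, TestFun (qY k) := fun k => testFun_bpoly _ X Y
  -- the result of the integration by parts, as a pointwise expression
  set G : E → ℂ := fun e => b * ρ * (qc e * conj (q e)) +
    ∑ k, (a + 1) * F k * (qX k e * conj (qX k e)) +
    ∑ k, ∑ l, b * ρ * K' k l * (qX k e * conj (qY l e)) with hG
  have hparts : ∫ e, q e * conj (q e) ∂μ = ∫ e, G e ∂μ := by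
    have e1 : ∀ e, q e * conj (q e) = ∑ k, X k e * (qX k e * conj (q e)) := fun e => by
      have : q e = ∑ k, X k e * qX k e := bpoly_succ T _ _
      rw [congrArg (· * conj (q e)) this, Finset.sum_mul]
      exact Finset.sum_congr rfl fun k _ => mul_assoc _ _ _
    have tXq : ∀ k, TestFun fun e => qX k e * conj (q e) := fun k => (tX k).mul tq.star
    have e2 : ∀ k e, wderiv μ (X k) (fun e => qX k e * conj (q e)) e =
        (∑ l, b * bpoly (fun i => del (del T k i) l) (fun k => X k e) (fun l => Y l e) *
          (ρ * K k l)) * conj (q e) +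
        qX k e * conj ((a + 1) * qX k e * F k + ∑ l, b * qY l e * (ρ * K' k l)) := by
      intro k e
      rw [wderiv_mul (tX k) tq.star, wderiv_conj tq]
      congr 2
      · rw [hqX]
        simp only []
        rw [wderiv_bpoly (hT.delX k).symX (hT.delX k).symY]
        simp only [h.XY]
        rw [Finset.sum_eq_zero, zero_add]
        intro m _
        by_cases hR : R k m
        · rw [hT.offX.del_del hR, bpoly_zero]; simp
        · rw [h.XX k m hR, mul_zero]
      · rw [hq, wderiv_bpoly hT.symX hT.symY]
        simp only [conjForm_apply, h.conjXX, h.conjXY]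
        simp [hqX, hqY]
    have e3 : ∀ e, G e = ∑ k, wderiv μ (X k) (fun e => qX k e * conj (q e)) e := by
      intro e
      simp only [e2, Finset.sum_add_distrib]
      rw [hG]
      simp only [add_assoc]
      congr 1
      · have : qc e = ∑ k, ∑ l, (K k l : ℂ) * bpoly (fun i => del (del T k i) l)
            (fun k => X k e) (fun l => Y l e) := bpoly_contr K T _ _
        rw [this, ← Finset.sum_mul, ← mul_assoc]
        simp only [Finset.mul_sum]
        congr 1
        exact Finset.sum_congr rfl fun k _ => Finset.sum_congr rfl fun l _ => by ring
      · rw [← Finset.sum_add_distrib]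
        refine Finset.sum_congr rfl fun k _ => ?_
        simp only [map_add, map_mul, map_sum, Complex.conj_ofReal, mul_add, Finset.mul_sum,
          map_natCast, map_one]
        congr 1
        · ring
        · exact Finset.sum_congr rfl fun l _ => by ring
    calc ∫ e, q e * conj (q e) ∂μ = ∫ e, ∑ k, X k e * (qX k e * conj (q e)) ∂μ := by simp only [e1]
      _ = ∑ k, ∫ e, X k e * (qX k e * conj (q e)) ∂μ :=
          integral_finsetSum _ fun k _ => ((TestFun.clm _).mul (tXq k)).integrable μ
      _ = ∑ k, ∫ e, wderiv μ (X k) (fun e => qX k e * conj (q e)) e ∂μ :=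
          Finset.sum_congr rfl fun k _ => integral_clm_mul μ hμ _ (tXq k)
      _ = ∫ e, ∑ k, wderiv μ (X k) (fun e => qX k e * conj (q e)) e ∂μ := by
          refine (integral_finsetSum _ fun k _ => ?_).symm
          refine (TestFun.integrable ?_ μ).congr (ae_of_all _ fun e => (e2 k e).symm)
          refine TestFun.add (TestFun.mul (TestFun.sum fun l _ => ?_) tq.star)
            ((tX k).mul (TestFun.star ?_))
          · exact ((TestFun.const _).mul (testFun_bpoly _ X Y)).mul (TestFun.const _)
          · exact (((TestFun.const _).mul (tX k)).mul (TestFun.const _)).add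
              (TestFun.sum fun l _ => ((TestFun.const _).mul (tY l)).mul (TestFun.const _))
      _ = ∫ e, G e ∂μ := by simp only [e3]
  have hGint : Integrable G μ := by
    refine TestFun.integrable ?_ μ
    refine ((TestFun.const _).mul (tc.mul tq.star)).add
      (TestFun.sum fun k _ => (TestFun.const _).mul ((tX k).mul (tX k).star)) |>.add ?_
    exact TestFun.sum fun k _ => TestFun.sum fun l _ =>
      (TestFun.const _).mul ((tX k).mul (tY l).star)
  have hre : ∀ z w : ℂ, |(z * conj w).re| ≤ (‖z‖ ^ 2 + ‖w‖ ^ 2) / 2 := fun z w => by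
    have h1 := Complex.abs_re_le_norm (z * conj w)
    rw [norm_mul, Complex.norm_conj] at h1
    nlinarith [sq_nonneg (‖z‖ - ‖w‖)]
  have hbound : ∀ e, (G e).re ≤ (1 / 2) * ‖q e‖ ^ 2 + (1 / 2) * (b ^ 2 * ‖qc e‖ ^ 2) +
      (a + 1 + b / 2) * ∑ k, F k * ‖qX k e‖ ^ 2 + b / 2 * ∑ l, F' l * ‖qY l e‖ ^ 2 := by
    intro e
    have t1 : ((b : ℂ) * ρ * (qc e * conj (q e))).re ≤
        (1 / 2) * ‖q e‖ ^ 2 + (1 / 2) * (b ^ 2 * ‖qc e‖ ^ 2) := by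
      have := hre ((b : ℂ) * ρ * qc e) (q e)
      rw [norm_mul, norm_mul, Complex.norm_real, Real.norm_eq_abs, Complex.norm_natCast,
        mul_assoc] at this
      have h2 : ((b : ℝ) * |ρ| * ‖qc e‖) ^ 2 ≤ b ^ 2 * ‖qc e‖ ^ 2 := by
        rw [← mul_pow]
        refine pow_le_pow_left₀ (by positivity) ?_ 2
        refine mul_le_mul_of_nonneg_right ?_ (norm_nonneg _)
        exact mul_le_of_le_one_right (by positivity) h.abs_le
      rw [← mul_assoc]
      rw [← mul_assoc] at this
      linarith [le_abs_self ((b : ℂ) * ρ * qc e * conj (q e)).re]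
    have t2 : (∑ k, ((a : ℂ) + 1) * F k * (qX k e * conj (qX k e))).re =
        (a + 1) * ∑ k, F k * ‖qX k e‖ ^ 2 := by
      rw [Complex.re_sum, Finset.mul_sum]
      refine Finset.sum_congr rfl fun k _ => ?_
      rw [Complex.mul_conj, Complex.normSq_eq_norm_sq]
      norm_cast
      ring
    have t3 : (∑ k, ∑ l, (b : ℂ) * ρ * K' k l * (qX k e * conj (qY l e))).re ≤
        b / 2 * (∑ k, F k * ‖qX k e‖ ^ 2 + ∑ l, F' l * ‖qY l e‖ ^ 2) := by
      have s1 : ∀ k l, ((b : ℂ) * ρ * K' k l * (qX k e * conj (qY l e))).re ≤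
          b / 2 * (K' k l * ‖qX k e‖ ^ 2 + K' k l * ‖qY l e‖ ^ 2) := by
        intro k l
        have h1 := hre (qX k e) (qY l e)
        have h2 : ((b : ℂ) * ρ * K' k l * (qX k e * conj (qY l e))).re =
            b * K' k l * (ρ * (qX k e * conj (qY l e)).re) := by
          rw [show (b : ℂ) * ρ * K' k l = ((b * ρ * K' k l : ℝ) : ℂ) by push_cast; ring,
            Complex.re_ofReal_mul]
          ring
        have h3 : ρ * (qX k e * conj (qY l e)).re ≤ (‖qX k e‖ ^ 2 + ‖qY l e‖ ^ 2) / 2 := by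
          refine (le_abs_self _).trans ?_
          rw [abs_mul]
          exact (mul_le_of_le_one_left (abs_nonneg _) h.abs_le).trans h1
        rw [h2]
        calc _ ≤ b * K' k l * ((‖qX k e‖ ^ 2 + ‖qY l e‖ ^ 2) / 2) :=
              mul_le_mul_of_nonneg_left h3 (mul_nonneg (by positivity) (h.nonneg k l))
          _ = _ := by ring
      rw [Complex.re_sum]
      simp only [Complex.re_sum]
      calc _ ≤ ∑ k, ∑ l, b / 2 * (K' k l * ‖qX k e‖ ^ 2 + K' k l * ‖qY l e‖ ^ 2) :=
            Finset.sum_le_sum fun k _ => Finset.sum_le_sum fun l _ => s1 k l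
        _ = b / 2 * (∑ k, (∑ l, K' k l) * ‖qX k e‖ ^ 2 + ∑ l, (∑ k, K' k l) * ‖qY l e‖ ^ 2) := by
            simp only [← Finset.mul_sum, Finset.sum_add_distrib, Finset.sum_mul]
            rw [Finset.sum_comm (f := fun k l => K' k l * ‖qY l e‖ ^ 2)]
        _ ≤ _ := by
            refine mul_le_mul_of_nonneg_left (add_le_add ?_ ?_) (by positivity)
            · exact Finset.sum_le_sum fun k _ =>
                mul_le_mul_of_nonneg_right (h.row k) (by positivity)
            · exact Finset.sum_le_sum fun k _ =>
                mul_le_mul_of_nonneg_right (h.col k) (by positivity)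
    rw [hG]
    simp only [Complex.add_re]
    rw [t2]
    linarith
  have iq : Integrable (fun e => ‖q e‖ ^ 2) μ := integrable_norm_sq_bpoly T
  have ic : Integrable (fun e => ‖qc e‖ ^ 2) μ := integrable_norm_sq_bpoly _
  have iX : ∀ k, Integrable (fun e => ‖qX k e‖ ^ 2) μ := fun k => integrable_norm_sq_bpoly _
  have iY : ∀ l, Integrable (fun e => ‖qY l e‖ ^ 2) μ := fun l => integrable_norm_sq_bpoly _
  have iXs : Integrable (fun e => ∑ k, F k * ‖qX k e‖ ^ 2) μ :=
    integrable_finsetSum _ fun k _ => (iX k).const_mul _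
  have iYs : Integrable (fun e => ∑ k, F' k * ‖qY k e‖ ^ 2) μ :=
    integrable_finsetSum _ fun k _ => (iY k).const_mul _
  have h1 : secondMoment μ X Y T = ∫ e, (G e).re ∂μ := by
    have : ((secondMoment μ X Y T : ℝ) : ℂ) = ∫ e, G e ∂μ := by
      rw [← hparts, secondMoment, ← integral_complex_ofReal]
      congr 1
      ext e
      rw [Complex.mul_conj, Complex.normSq_eq_norm_sq]
    rw [← Complex.ofReal_re (secondMoment μ X Y T), this]
    exact (integral_re hGint).symm
  have h2 : ∫ e, (G e).re ∂μ ≤ (1 / 2) * secondMoment μ X Y T +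
      (1 / 2) * (b ^ 2 * secondMoment μ X Y (contr K T)) +
      (a + 1 + b / 2) * ∑ k, F k * secondMoment μ X Y (del T k) +
      b / 2 * ∑ l, F' l * secondMoment μ X Y (fun i => del (T i) l) := by
    have i1 : Integrable (fun e => 1 / 2 * ‖q e‖ ^ 2) μ := iq.const_mul _
    have i2 : Integrable (fun e => 1 / 2 * ((b : ℝ) ^ 2 * ‖qc e‖ ^ 2)) μ :=
      (ic.const_mul _).const_mul _
    have i3 : Integrable (fun e => ((a : ℝ) + 1 + b / 2) * ∑ k, F k * ‖qX k e‖ ^ 2) μ :=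
      iXs.const_mul _
    have i4 : Integrable (fun e => (b : ℝ) / 2 * ∑ l, F' l * ‖qY l e‖ ^ 2) μ := iYs.const_mul _
    have i12 : Integrable (fun e => 1 / 2 * ‖q e‖ ^ 2 + 1 / 2 * ((b : ℝ) ^ 2 * ‖qc e‖ ^ 2)) μ :=
      i1.add i2
    have i123 : Integrable (fun e => 1 / 2 * ‖q e‖ ^ 2 + 1 / 2 * ((b : ℝ) ^ 2 * ‖qc e‖ ^ 2) +
        ((a : ℝ) + 1 + b / 2) * ∑ k, F k * ‖qX k e‖ ^ 2) μ := i12.add i3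
    have i1234 : Integrable (fun e => 1 / 2 * ‖q e‖ ^ 2 + 1 / 2 * ((b : ℝ) ^ 2 * ‖qc e‖ ^ 2) +
        ((a : ℝ) + 1 + b / 2) * ∑ k, F k * ‖qX k e‖ ^ 2 +
        (b : ℝ) / 2 * ∑ l, F' l * ‖qY l e‖ ^ 2) μ := i123.add i4
    refine (integral_mono hGint.re i1234 hbound).trans (le_of_eq ?_)
    rw [integral_add i123 i4, integral_add i12 i3, integral_add i1 i2,
      integral_const_mul, integral_const_mul, integral_const_mul, integral_const_mul,
      integral_const_mul, integral_finsetSum _ fun k _ => (iX k).const_mul _,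
      integral_finsetSum _ fun k _ => (iY k).const_mul _]
    simp only [integral_const_mul]
    rfl
  linarith

/-- Second moment estimate: up to a constant depending only on the orders, the second moment of
`bpoly T X Y` is bounded by the squared norms of all the contractions of `T`. -/
theorem secondMoment_le (hμ : ∫ x, x ∂μ = 0) (h : CorrForms μ X Y F F' R R' K K' ρ) (n : ℕ)
    {a b : ℕ} {T : (Fin a → ι) → (Fin b → ι') → ℂ} (hT : GoodTensor R R' T) (hab : a + b ≤ n) :
    secondMoment μ X Y T ≤
      3 ^ n * (n.factorial : ℝ) ^ 2 * ∑ r ∈ Finset.range (n + 1), contrNormSq K F F' r T := by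
  have hF := h.nonneg_left
  have hF' := h.nonneg_right
  have hN : ∀ (r : ℕ) {a b : ℕ} (T : (Fin a → ι) → (Fin b → ι') → ℂ),
      0 ≤ contrNormSq K F F' r T := fun r _ _ T => contrNormSq_nonneg hF hF' r T
  induction n generalizing a b with
  | zero =>
    obtain ⟨rfl, rfl⟩ : a = 0 ∧ b = 0 := by omega
    simp [secondMoment, contrNormSq, bpoly, mpoly]
  | succ n ih =>
    set C : ℝ := 3 ^ n * (n.factorial : ℝ) ^ 2 with hC
    have hC0 : 0 ≤ C := by positivity
    set S := ∑ r ∈ Finset.range (n + 2), contrNormSq K F F' r T with hS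
    have hS0 : 0 ≤ S := Finset.sum_nonneg fun r _ => hN r T
    have hC' : (3 : ℝ) ^ (n + 1) * ((n + 1).factorial : ℝ) ^ 2 = 3 * (n + 1) ^ 2 * C := by
      rw [Nat.factorial_succ]; push_cast; rw [hC]; ring
    have hle : ∑ r ∈ Finset.range (n + 1), contrNormSq K F F' r T ≤ S := by
      rw [hS, Finset.sum_range_succ _ (n + 1)]
      exact le_add_of_nonneg_right (hN _ _)
    have hX : a ≤ n + 1 → a + b ≤ n + 1 → 1 ≤ a →
        ∑ k, F k * secondMoment μ X Y (del T k) ≤ C * S := fun _ _ _ =>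
      calc _ ≤ ∑ k, F k * (C * ∑ r ∈ Finset.range (n + 1), contrNormSq K F F' r (del T k)) :=
            Finset.sum_le_sum fun k _ =>
              mul_le_mul_of_nonneg_left (ih (hT.delX k) (by omega)) (hF k)
        _ = C * ∑ r ∈ Finset.range (n + 1), ∑ k, F k * contrNormSq K F F' r (del T k) := by
            rw [Finset.sum_comm]
            simp only [Finset.mul_sum]
            exact Finset.sum_congr rfl fun _ _ => Finset.sum_congr rfl fun _ _ => by ring
        _ ≤ C * ∑ r ∈ Finset.range (n + 1), contrNormSq K F F' r T :=
            mul_le_mul_of_nonneg_left (Finset.sum_le_sum fun r _ =>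
              sum_contrNormSq_del_le hF hF' r hT) hC0
        _ ≤ C * S := mul_le_mul_of_nonneg_left hle hC0
    have hY : 1 ≤ b → ∑ l, F' l * secondMoment μ X Y (fun i => del (T i) l) ≤ C * S := fun _ =>
      calc _ ≤ ∑ l, F' l *
            (C * ∑ r ∈ Finset.range (n + 1), contrNormSq K F F' r (fun i => del (T i) l)) :=
            Finset.sum_le_sum fun l _ => mul_le_mul_of_nonneg_left
              (ih (hT.delY l) (by omega)) (hF' l)
        _ = C * ∑ r ∈ Finset.range (n + 1),
            ∑ l, F' l * contrNormSq K F F' r (fun i => del (T i) l) := by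
            rw [Finset.sum_comm]
            simp only [Finset.mul_sum]
            exact Finset.sum_congr rfl fun _ _ => Finset.sum_congr rfl fun _ _ => by ring
        _ ≤ C * ∑ r ∈ Finset.range (n + 1), contrNormSq K F F' r T :=
            mul_le_mul_of_nonneg_left (Finset.sum_le_sum fun r _ =>
              sum_contrNormSq_del_right_le hF hF' r hT) hC0
        _ ≤ C * S := mul_le_mul_of_nonneg_left hle hC0
    have hcon : a + b ≤ n + 1 → 1 ≤ a → secondMoment μ X Y (contr K T) ≤ C * S := fun _ _ => by
      refine (ih (hT.contr K) (by omega)).trans (mul_le_mul_of_nonneg_left ?_ hC0)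
      rw [hS, Finset.sum_range_succ' _ (n + 1)]
      exact le_add_of_nonneg_right (hN _ _)
    have hCS : 0 ≤ C * S := mul_nonneg hC0 hS0
    rw [hC', mul_assoc]
    have hn : (0 : ℝ) ≤ n := Nat.cast_nonneg n
    cases a with
    | succ a =>
      have hb : (b : ℝ) ≤ n := by exact_mod_cast (by omega : b ≤ n)
      have hab' : (a : ℝ) + 1 + b ≤ n + 1 := by exact_mod_cast hab
      have hb0 : (0 : ℝ) ≤ b := Nat.cast_nonneg b
      have ha0 : (0 : ℝ) ≤ a := Nat.cast_nonneg a
      have hYb : (b : ℝ) * ∑ l, F' l * secondMoment μ X Y (fun i => del (T i) l) ≤ b * (C * S) := by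
        rcases Nat.eq_zero_or_pos b with hb' | hb'
        · simp [hb']
        · exact mul_le_mul_of_nonneg_left (hY hb') hb0
      calc _ ≤ (b : ℝ) ^ 2 * (C * S) + (2 * a + 2 + b) * (C * S) + b * (C * S) :=
            (secondMoment_succ_le hμ h hT).trans (add_le_add (add_le_add
              (mul_le_mul_of_nonneg_left (hcon hab (by omega)) (by positivity))
              (mul_le_mul_of_nonneg_left (hX (by omega) hab (by omega)) (by positivity))) hYb)
        _ = ((b : ℝ) ^ 2 + (2 * a + 2 + b) + b) * (C * S) := by ring
        _ ≤ _ := mul_le_mul_of_nonneg_right (by nlinarith) hCS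
    | zero =>
      cases b with
      | zero =>
        refine (ih hT (by omega)).trans ((mul_le_mul_of_nonneg_left hle hC0).trans ?_)
        exact le_mul_of_one_le_left hCS (by nlinarith)
      | succ b =>
        have hb : (b : ℝ) + 1 ≤ n + 1 := by exact_mod_cast (by omega : b + 1 ≤ n + 1)
        have hstep := secondMoment_succ_le hμ h.flip hT.flip
        have e1 : ∀ l, secondMoment μ Y X (del (flip T) l) =
            secondMoment μ X Y (fun i => del (T i) l) := fun l => by
          rw [← secondMoment_flip]
          congr 1
        simp only [e1, secondMoment_flip] at hstep
        simp only [Nat.cast_zero, ne_eq, OfNat.ofNat_ne_zero, not_false_eq_true, zero_pow, zero_mul,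
          zero_add, add_zero] at hstep
        refine hstep.trans ?_
        calc _ ≤ (2 * (b : ℝ) + 2) * (C * S) :=
              mul_le_mul_of_nonneg_left (hY (by omega)) (by positivity)
          _ ≤ _ := mul_le_mul_of_nonneg_right (by nlinarith) hCS

end

/-! ### Interpolation by rotation -/

section Interpolation

variable {E : Type*} [NormedAddCommGroup E] [NormedSpace ℝ E]

/-- The rotated point `cos θ • x + sin θ • x'`. -/
def rotFst (E : Type*) [NormedAddCommGroup E] [NormedSpace ℝ E] (θ : ℝ) : E × E →L[ℝ] E :=
  Real.cos θ • ContinuousLinearMap.fst ℝ E E + Real.sin θ • ContinuousLinearMap.snd ℝ E E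

/-- The velocity `-sin θ • x + cos θ • x'` of `rotFst`. -/
def rotSnd (E : Type*) [NormedAddCommGroup E] [NormedSpace ℝ E] (θ : ℝ) : E × E →L[ℝ] E :=
  (-Real.sin θ) • ContinuousLinearMap.fst ℝ E E + Real.cos θ • ContinuousLinearMap.snd ℝ E E

@[simp] lemma rotFst_apply (θ : ℝ) (p : E × E) :
    rotFst E θ p = Real.cos θ • p.1 + Real.sin θ • p.2 := rfl

@[simp] lemma rotSnd_apply (θ : ℝ) (p : E × E) :
    rotSnd E θ p = (-Real.sin θ) • p.1 + Real.cos θ • p.2 := rfl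

lemma norm_smul_fst_add_smul_snd_le {c s : ℝ} (hc : |c| ≤ 1) (hs : |s| ≤ 1) (p : E × E) :
    ‖c • p.1 + s • p.2‖ ≤ 2 * ‖p‖ := by
  refine (norm_add_le _ _).trans ?_
  rw [norm_smul, norm_smul, Real.norm_eq_abs, Real.norm_eq_abs]
  have h1 := mul_le_mul hc (norm_fst_le p) (norm_nonneg _) zero_le_one
  have h2 := mul_le_mul hs (norm_snd_le p) (norm_nonneg _) zero_le_one
  linarith

lemma hasDerivAt_rotFst (θ : ℝ) (p : E × E) :
    HasDerivAt (fun θ => rotFst E θ p) (rotSnd E θ p) θ :=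
  ((Real.hasDerivAt_cos θ).smul_const p.1).add ((Real.hasDerivAt_sin θ).smul_const p.2)

variable [MeasurableSpace E] [BorelSpace E] [CompleteSpace E] [SecondCountableTopology E]

/-- Interpolation between a Gaussian vector and an independent copy of it: the covariance of
`Φ` and `Ψ` is controlled by the derivative of `θ ↦ E [Φ(x) Ψ(cos θ x + sin θ x')]`. -/
lemma norm_integral_mul_sub_le (μ : Measure E) [IsGaussian μ] {Φ Ψ : E → ℂ} (hΦ : TestFun Φ)
    (hΨ : TestFun Ψ) {B : ℝ}
    (hB : ∀ θ, ‖∫ p, Φ p.1 * fderiv ℝ Ψ (rotFst E θ p) (rotSnd E θ p) ∂(μ.prod μ)‖ ≤ B) :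
    ‖∫ x, Φ x * Ψ x ∂μ - (∫ x, Φ x ∂μ) * ∫ x, Ψ x ∂μ‖ ≤ B * (Real.pi / 2) := by
  set h : ℝ → ℂ := fun θ => ∫ p, Φ p.1 * Ψ (rotFst E θ p) ∂(μ.prod μ) with hh
  have hΦ1 : TestFun fun p : E × E => Φ p.1 := hΦ.comp_clm (ContinuousLinearMap.fst ℝ E E)
  have hder : ∀ θ, HasDerivAt h
      (∫ p, Φ p.1 * fderiv ℝ Ψ (rotFst E θ p) (rotSnd E θ p) ∂(μ.prod μ)) θ := by
    intro θ
    obtain ⟨C, m, hC⟩ := hΨ.bdd_fderiv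
    have hbd : PolyBdd fun p : E × E => |C| * (1 + 2 * ‖p‖) ^ m * (2 * ‖p‖) := by
      refine ⟨|C| * 2 ^ m * 2, m + 1, fun p => ?_⟩
      rw [Real.norm_of_nonneg (by positivity)]
      have h1 : (1 + 2 * ‖p‖) ^ m ≤ 2 ^ m * (1 + ‖p‖) ^ m := by
        rw [← mul_pow]
        exact pow_le_pow_left₀ (by positivity) (by linarith [norm_nonneg p]) m
      calc |C| * (1 + 2 * ‖p‖) ^ m * (2 * ‖p‖)
          ≤ |C| * (2 ^ m * (1 + ‖p‖) ^ m) * (2 * (1 + ‖p‖)) := by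
            gcongr
            linarith
        _ = _ := by ring
    have hmeas : ∀ θ, AEStronglyMeasurable (fun p : E × E =>
        Φ p.1 * fderiv ℝ Ψ (rotFst E θ p) (rotSnd E θ p)) (μ.prod μ) := by
      intro θ
      refine hΦ1.diff.continuous.aestronglyMeasurable.mul ?_
      -- the derivative along the velocity is a derivative of a composition, hence measurable
      have : (fun p : E × E => fderiv ℝ Ψ (rotFst E θ p) (rotSnd E θ p)) =
          fun p => deriv (fun t => Ψ (rotFst E t p)) θ := by
        ext p
        exact (((hΨ.diff _).hasFDerivAt.comp_hasDerivAt θ (hasDerivAt_rotFst θ p)).deriv).symm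
      rw [this]
      have hcont : Continuous fun q : (E × E) × ℝ => Ψ (rotFst E q.2 q.1) := by
        refine hΨ.diff.continuous.comp ?_
        simp only [rotFst_apply]
        fun_prop
      exact ((measurable_deriv_with_param (f := fun p t => Ψ (rotFst E t p)) hcont).comp
        (measurable_id.prodMk measurable_const)).aestronglyMeasurable
    refine (hasDerivAt_integral_of_dominated_loc_of_deriv_le (s := Set.univ)
      (F := fun θ p => Φ p.1 * Ψ (rotFst E θ p))
      (F' := fun θ p => Φ p.1 * fderiv ℝ Ψ (rotFst E θ p) (rotSnd E θ p))
      (bound := fun p : E × E => ‖Φ p.1‖ * (|C| * (1 + 2 * ‖p‖) ^ m * (2 * ‖p‖))) univ_mem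
      (Eventually.of_forall fun θ => ?_) ?_ (hmeas θ)
      (ae_of_all _ fun p θ _ => ?_) ?_ (ae_of_all _ fun p θ _ => ?_)).2
    · exact (hΦ1.mul (hΨ.comp_clm (rotFst E θ))).diff.continuous.aestronglyMeasurable
    · exact (hΦ1.mul (hΨ.comp_clm (rotFst E θ))).integrable _
    · rw [norm_mul]
      refine mul_le_mul_of_nonneg_left ?_ (norm_nonneg _)
      have n1 : ‖rotFst E θ p‖ ≤ 2 * ‖p‖ :=
        norm_smul_fst_add_smul_snd_le (Real.abs_cos_le_one θ) (Real.abs_sin_le_one θ) p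
      have n2 : ‖rotSnd E θ p‖ ≤ 2 * ‖p‖ :=
        norm_smul_fst_add_smul_snd_le (by simpa using Real.abs_sin_le_one θ)
          (Real.abs_cos_le_one θ) p
      refine (ContinuousLinearMap.le_opNorm _ _).trans ?_
      refine mul_le_mul ((hC _).trans ?_) n2 (norm_nonneg _) (by positivity)
      refine mul_le_mul (le_abs_self C) (pow_le_pow_left₀ (by positivity) (by linarith) m)
        (by positivity) (abs_nonneg _)
    · refine PolyBdd.integrable ((hΦ1.bdd).of_le_mul hbd fun p => ?_) ?_
      · rw [norm_mul, norm_norm]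
      · exact (hΦ1.diff.continuous.norm.mul (by fun_prop)).aestronglyMeasurable
    · exact ((hΨ.diff _).hasFDerivAt.comp_hasDerivAt θ (hasDerivAt_rotFst θ p)).const_mul _
  have hpi : (0 : ℝ) ≤ Real.pi / 2 := by positivity
  have hmain := norm_image_sub_le_of_norm_deriv_le_segment'
    (fun θ _ => (hder θ).hasDerivWithinAt (s := Set.Icc 0 (Real.pi / 2))) (fun θ _ => hB θ)
    (Real.pi / 2) (Set.right_mem_Icc.2 hpi)
  have h0 : h 0 = ∫ x, Φ x * Ψ x ∂μ := by
    simp only [hh, rotFst_apply, Real.cos_zero, Real.sin_zero, one_smul, zero_smul, add_zero]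
    rw [integral_fun_fst (fun x => Φ x * Ψ x)]
    simp
  have h1 : h (Real.pi / 2) = (∫ x, Φ x ∂μ) * ∫ x, Ψ x ∂μ := by
    simp only [hh, rotFst_apply, Real.cos_pi_div_two, Real.sin_pi_div_two, one_smul, zero_smul,
      zero_add]
    exact integral_prod_mul Φ Ψ
  rw [h0, h1, sub_zero] at hmain
  rwa [norm_sub_rev]

/-- Covariances of linear combinations of a centred Gaussian vector and an independent copy. -/
lemma integral_prod_forms (μ : Measure E) [IsGaussian μ] (hμ : ∫ x, x ∂μ = 0) (u v : E →L[ℝ] ℂ)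
    (α β γ δ : ℝ) :
    ∫ p : E × E, u (α • p.1 + β • p.2) * v (γ • p.1 + δ • p.2) ∂(μ.prod μ) =
      ((α * γ + β * δ : ℝ) : ℂ) * ∫ x, u x * v x ∂μ := by
  have h0 : ∀ w : E →L[ℝ] ℂ, ∫ x, w x ∂μ = 0 := fun w => by
    rw [w.integral_comp_comm (IsGaussian.integrable_fun_id (μ := μ)), hμ, map_zero]
  have i1 : Integrable (fun p : E × E => u p.1 * v p.1) (μ.prod μ) :=
    ((TestFun.clm (u.comp (.fst ℝ E E))).mul (TestFun.clm (v.comp (.fst ℝ E E)))).integrable _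
  have i2 : Integrable (fun p : E × E => u p.1 * v p.2) (μ.prod μ) :=
    ((TestFun.clm (u.comp (.fst ℝ E E))).mul (TestFun.clm (v.comp (.snd ℝ E E)))).integrable _
  have i3 : Integrable (fun p : E × E => u p.2 * v p.1) (μ.prod μ) :=
    ((TestFun.clm (u.comp (.snd ℝ E E))).mul (TestFun.clm (v.comp (.fst ℝ E E)))).integrable _
  have i4 : Integrable (fun p : E × E => u p.2 * v p.2) (μ.prod μ) :=
    ((TestFun.clm (u.comp (.snd ℝ E E))).mul (TestFun.clm (v.comp (.snd ℝ E E)))).integrable _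
  have e1 : ∫ p : E × E, u p.1 * v p.1 ∂(μ.prod μ) = ∫ x, u x * v x ∂μ := by
    rw [integral_fun_fst (fun x => u x * v x)]; simp
  have e4 : ∫ p : E × E, u p.2 * v p.2 ∂(μ.prod μ) = ∫ x, u x * v x ∂μ := by
    rw [integral_fun_snd (fun x => u x * v x)]; simp
  have e2 : ∫ p : E × E, u p.1 * v p.2 ∂(μ.prod μ) = 0 := by
    rw [integral_prod_mul (fun x => u x) fun x => v x, h0, zero_mul]
  have e3 : ∫ p : E × E, u p.2 * v p.1 ∂(μ.prod μ) = 0 := by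
    simp only [mul_comm (u _)]
    rw [integral_prod_mul (fun x => v x) fun x => u x, h0, zero_mul]
  have hexp : ∀ p : E × E, u (α • p.1 + β • p.2) * v (γ • p.1 + δ • p.2) =
      ((α * γ : ℝ) : ℂ) * (u p.1 * v p.1) + ((α * δ : ℝ) : ℂ) * (u p.1 * v p.2) +
      ((β * γ : ℝ) : ℂ) * (u p.2 * v p.1) + ((β * δ : ℝ) : ℂ) * (u p.2 * v p.2) := fun p => by
    simp only [map_add, map_smul, Complex.real_smul]
    push_cast
    ring
  simp only [hexp]
  have j12 : Integrable (fun p : E × E => ((α * γ : ℝ) : ℂ) * (u p.1 * v p.1) +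
      ((α * δ : ℝ) : ℂ) * (u p.1 * v p.2)) (μ.prod μ) := (i1.const_mul _).add (i2.const_mul _)
  have j123 : Integrable (fun p : E × E => ((α * γ : ℝ) : ℂ) * (u p.1 * v p.1) +
      ((α * δ : ℝ) : ℂ) * (u p.1 * v p.2) + ((β * γ : ℝ) : ℂ) * (u p.2 * v p.1)) (μ.prod μ) :=
    j12.add (i3.const_mul _)
  rw [integral_add j123 (i4.const_mul _), integral_add j12 (i3.const_mul _),
    integral_add (i1.const_mul _) (i2.const_mul _)]
  simp only [integral_const_mul, e1, e2, e3, e4]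
  push_cast
  ring

end Interpolation

/-! ### The covariance bound for polynomials in Gaussian forms -/

/-- The tensor product of two tensors, as a two-block tensor. -/
def tens {ι ι' : Type*} {p q : ℕ} (c : (Fin p → ι) → ℂ) (d : (Fin q → ι') → ℂ) :
    (Fin p → ι) → (Fin q → ι') → ℂ := fun i j => c i * d j

lemma del_del_tens {ι ι' : Type*} {p q : ℕ} (c : (Fin p → ι) → ℂ) (d : (Fin q → ι') → ℂ)
    (k : ι) (l : ι') (i : Fin (p - 1) → ι) :
    del (del (tens c d) k i) l = fun j => del c k i * del d l j := by
  cases p <;> cases q <;> simp [del, tens]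

lemma goodTensor_tens {ι ι' : Type*} {p q : ℕ} {c : (Fin p → ι) → ℂ} {d : (Fin q → ι') → ℂ}
    {R : ι → ι → Prop} {R' : ι' → ι' → Prop} (hc : IsSymm c) (hd : IsSymm d) (hc' : OffDiag R c)
    (hd' : OffDiag R' d) : GoodTensor R R' (tens c d) where
  symX π i := by ext j; simp only [tens, hc π i]
  symY i π j := by simp only [tens, hd π j]
  offX i a b hab h := by ext j; simp only [tens, hc' i a b hab h]; simp
  offY i j a b hab h := by simp only [tens, hd' j a b hab h]; simp

lemma bpoly_contr_tens {ι ι' : Type*} [Fintype ι] [Fintype ι'] {p q : ℕ} (c : (Fin p → ι) → ℂ)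
    (d : (Fin q → ι') → ℂ) (K : ι → ι' → ℝ) (x : ι → ℂ) (y : ι' → ℂ) :
    bpoly (contr K (tens c d)) x y =
      ∑ k, ∑ l, (K k l : ℂ) * (mpoly (del c k) x * mpoly (del d l) y) := by
  rw [bpoly_contr]
  simp only [del_del_tens, bpoly, mpoly_const_mul, mpoly_mul_const]

section Rotation

variable {E : Type*} [NormedAddCommGroup E] [NormedSpace ℝ E] [MeasurableSpace E] [BorelSpace E]
  [CompleteSpace E] [SecondCountableTopology E] {μ : Measure E} [IsGaussian μ]

lemma integral_prod_self_eq_zero (hμ : ∫ x, x ∂μ = 0) : ∫ x : E × E, x ∂(μ.prod μ) = 0 := by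
  have hi : Integrable (fun x : E × E => x) (μ.prod μ) := IsGaussian.integrable_fun_id
  refine Prod.ext ?_ ?_
  · have := (ContinuousLinearMap.fst ℝ E E).integral_comp_comm hi
    simp only [ContinuousLinearMap.coe_fst'] at this
    rw [← this, integral_fun_fst (fun x : E => x), hμ]
    simp
  · have := (ContinuousLinearMap.snd ℝ E E).integral_comp_comm hi
    simp only [ContinuousLinearMap.coe_snd'] at this
    rw [← this, integral_fun_snd (fun x : E => x), hμ]
    simp

/-- Rotating the second family towards an independent copy multiplies the correlations by
`cos θ`. -/
lemma CorrForms.rot {ι ι' : Type*} [Fintype ι] [Fintype ι'] [DecidableEq ι] [DecidableEq ι']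
    {X : ι → E →L[ℝ] ℂ} {Y : ι' → E →L[ℝ] ℂ} {F : ι → ℝ} {F' : ι' → ℝ} {R : ι → ι → Prop}
    {R' : ι' → ι' → Prop} {K K' : ι → ι' → ℝ} (hμ : ∫ x, x ∂μ = 0)
    (h : CorrForms μ X Y F F' R R' K K' 1) (θ : ℝ) :
    CorrForms (μ.prod μ) (fun k => (X k).comp (.fst ℝ E E)) (fun l => (Y l).comp (rotFst E θ))
      F F' R R' K K' (Real.cos θ) := by
  have key := integral_prod_forms μ hμ
  have hcs : Real.cos θ * Real.cos θ + Real.sin θ * Real.sin θ = 1 := by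
    nlinarith [Real.sin_sq_add_cos_sq θ]
  refine ⟨fun k m hR => ?_, fun k m hR => ?_, fun k m => ?_, fun k m => ?_, fun k l => ?_,
    fun k l => ?_, h.nonneg, h.row, h.col, Real.abs_cos_le_one θ⟩
  · simpa [h.XX k m hR] using key (X k) (X m) 1 0 1 0
  · simpa [h.YY k m hR, -map_add] using key (Y k) (Y m) (Real.cos θ) (Real.sin θ) (Real.cos θ)
      (Real.sin θ)
  · simpa [h.conjXX k m] using key (conjForm (X k)) (X m) 1 0 1 0
  · have := key (conjForm (Y k)) (Y m) (Real.cos θ) (Real.sin θ) (Real.cos θ) (Real.sin θ)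
    rw [hcs] at this
    simpa [h.conjYY k m, -map_add] using this
  · simpa [h.XY k l, -map_add] using key (X k) (Y l) 1 0 (Real.cos θ) (Real.sin θ)
  · simpa [h.conjXY k l, -map_add] using
      key (conjForm (X k)) (Y l) 1 0 (Real.cos θ) (Real.sin θ)

end Rotation

section Comb

variable {E : Type*} [NormedAddCommGroup E] [NormedSpace ℝ E]
variable {α : Type*} [Fintype α] {ι : α → Type*} [∀ a, Fintype (ι a)] {p : α → ℕ}

/-- The linear combination `∑ s_a mpoly (c_a) (X_a)` of homogeneous polynomials in forms. -/
def comb (s : α → ℝ) (c : ∀ a, (Fin (p a) → ι a) → ℂ) (X : ∀ a, ι a → E →L[ℝ] ℂ) (e : E) : ℂ :=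
  ∑ a, (s a : ℂ) * mpoly (c a) fun k => X a k e

lemma testFun_comb (s : α → ℝ) (c : ∀ a, (Fin (p a) → ι a) → ℂ) (X : ∀ a, ι a → E →L[ℝ] ℂ) :
    TestFun (comb s c X) :=
  TestFun.sum fun a _ => (TestFun.const _).mul (testFun_mpoly (c a) (X a))

lemma hasFDerivAt_comb (s : α → ℝ) {c : ∀ a, (Fin (p a) → ι a) → ℂ} (hc : ∀ a, IsSymm (c a))
    (X : ∀ a, ι a → E →L[ℝ] ℂ) (e : E) : HasFDerivAt (comb s c X)
      (∑ a, (s a : ℂ) • ∑ k, ((p a : ℂ) * mpoly (del (c a) k) fun k => X a k e) • X a k) e :=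
  HasFDerivAt.fun_sum fun a _ => (hasFDerivAt_mpoly (hc a) (X a) e).const_mul _

lemma comb_im (s : α → ℝ) {c : ∀ a, (Fin (p a) → ι a) → ℂ} {X : ∀ a, ι a → E →L[ℝ] ℂ} {e : E}
    (h : ∀ a, (mpoly (c a) fun k => X a k e).im = 0) : (comb s c X e).im = 0 := by
  rw [comb, Complex.im_sum]
  exact Finset.sum_eq_zero fun a _ => by rw [Complex.im_ofReal_mul, h, mul_zero]

variable [MeasurableSpace E] [BorelSpace E] [CompleteSpace E] [SecondCountableTopology E]
  {μ : Measure E} [IsGaussian μ]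

lemma wderiv_mpoly {κ : Type*} [Fintype κ] {q : ℕ} {c : (Fin q → κ) → ℂ} (hc : IsSymm c)
    (X : κ → E →L[ℝ] ℂ) (w : E →L[ℝ] ℂ) (e : E) :
    wderiv μ w (fun e => mpoly c fun k => X k e) e =
      ∑ k, (q : ℂ) * mpoly (del c k) (fun k => X k e) * ∫ e, w e * X k e ∂μ := by
  rw [wderiv_of_hasFDerivAt (hasFDerivAt_mpoly hc X e)]
  simp only [← clm_covVec_add, sum_apply, smul_apply, smul_eq_mul, mul_add,
    Finset.mul_sum, Finset.sum_add_distrib]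
  simp only [mul_left_comm Complex.I]

lemma wderiv_comb (s : α → ℝ) {c : ∀ a, (Fin (p a) → ι a) → ℂ} (hc : ∀ a, IsSymm (c a))
    (X : ∀ a, ι a → E →L[ℝ] ℂ) (w : E →L[ℝ] ℂ) (e : E) : wderiv μ w (comb s c X) e =
      ∑ a, (s a : ℂ) * ∑ k, (p a : ℂ) * mpoly (del (c a) k) (fun k => X a k e) *
        ∫ e, w e * X a k e ∂μ := by
  rw [wderiv_of_hasFDerivAt (hasFDerivAt_comb s hc X e)]
  simp only [← clm_covVec_add, sum_apply, smul_apply, smul_eq_mul, mul_add,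
    Finset.mul_sum, Finset.sum_add_distrib]
  simp only [mul_left_comm Complex.I]

lemma integral_norm_le_sqrt {f : E → ℂ} (hf : TestFun f) :
    ∫ e, ‖f e‖ ∂μ ≤ √(∫ e, ‖f e‖ ^ 2 ∂μ) := by
  have h2 : Integrable (fun e => ‖f e‖ ^ 2) μ := by
    refine ((hf.mul hf).integrable μ).norm.congr (ae_of_all _ fun e => ?_)
    simp [sq]
  have hm : MemLp (fun e => ‖f e‖) 2 μ :=
    (memLp_two_iff_integrable_sq hf.diff.continuous.norm.aestronglyMeasurable).2 h2
  have h := variance_nonneg (fun e => ‖f e‖) μ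
  rw [variance_eq_sub hm] at h
  refine Real.le_sqrt_of_sq_le ?_
  simpa using h

variable [∀ a, DecidableEq (ι a)] {w : ∀ a, ι a → E →L[ℝ] ℂ} {F : ∀ a, ι a → ℝ}
  {R : ∀ a, ι a → ι a → Prop} {K K' : ∀ a b, ι a → ι b → ℝ} {c : ∀ a, (Fin (p a) → ι a) → ℂ}

lemma norm_interpolation_deriv_le (hμ : ∫ x, x ∂μ = 0)
    (h : ∀ a b, CorrForms μ (w a) (w b) (F a) (F b) (R a) (R b) (K a b) (K' a b) 1)
    (hc : ∀ a, IsSymm (c a))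
    (hreal : ∀ a e, (mpoly (c a) fun k => w a k e).im = 0) (s t : α → ℝ) (θ : ℝ) :
    ‖∫ x : E × E, Complex.exp (Complex.I * comb s c w x.1) *
        fderiv ℝ (fun y => Complex.exp (Complex.I * comb t c w y)) (rotFst E θ x) (rotSnd E θ x)
        ∂(μ.prod μ)‖ ≤
      ∑ a, ∑ b, |s a| * |t b| * (p a * p b) * √(secondMoment (μ.prod μ)
        (fun k => (w a k).comp (.fst ℝ E E)) (fun l => (w b l).comp (rotFst E θ))
        (contr (K a b) (tens (c a) (c b)))) := by
  set X : ∀ a, ι a → E × E →L[ℝ] ℂ := fun a k => (w a k).comp (.fst ℝ E E) with hX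
  set Y : ∀ a, ι a → E × E →L[ℝ] ℂ := fun a k => (w a k).comp (rotFst E θ) with hY
  set Z : ∀ a, ι a → E × E →L[ℝ] ℂ := fun a k => (w a k).comp (rotSnd E θ) with hZ
  have hZX : ∀ b l a k, ∫ x, Z b l x * X a k x ∂(μ.prod μ) = -(Real.sin θ * K a b k l : ℝ) := by
    intro b l a k
    have h1 := integral_prod_forms μ hμ (w b l) (w a k) (-Real.sin θ) (Real.cos θ) 1 0
    have h2 := (h a b).XY k l
    simp only [mul_comm (w a k _)] at h2
    rw [h2] at h1
    have h3 : ∀ x : E × E, Z b l x * X a k x =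
        w b l (-Real.sin θ • x.1 + Real.cos θ • x.2) * w a k ((1 : ℝ) • x.1 + (0 : ℝ) • x.2) := by
      intro x; simp [hZ, hX]
    simp only [h3, h1]
    push_cast
    ring
  have hZY : ∀ b l a k, ∫ x, Z b l x * Y a k x ∂(μ.prod μ) = 0 := by
    intro b l a k
    have h1 := integral_prod_forms μ hμ (w b l) (w a k) (-Real.sin θ) (Real.cos θ) (Real.cos θ)
      (Real.sin θ)
    rw [show -Real.sin θ * Real.cos θ + Real.cos θ * Real.sin θ = 0 by ring, Complex.ofReal_zero,
      zero_mul] at h1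
    exact h1
  have hXim : ∀ x, (comb s c X x).im = 0 := fun x => comb_im s fun a => hreal a _
  have hYim : ∀ x, (comb t c Y x).im = 0 := fun x => comb_im t fun a => hreal a _
  set eX : E × E → ℂ := fun x => Complex.exp (Complex.I * comb s c X x) with heX
  set eY : E × E → ℂ := fun x => Complex.exp (Complex.I * comb t c Y x) with heY
  have teX : TestFun eX := (testFun_comb s c X).cexp hXim
  have teY : TestFun eY := (testFun_comb t c Y).cexp hYim
  have neX : ∀ x, ‖eX x‖ = 1 := fun x => by rw [heX, Complex.norm_exp]; simp [hXim]
  have neY : ∀ x, ‖eY x‖ = 1 := fun x => by rw [heY, Complex.norm_exp]; simp [hYim]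
  set m : ∀ b, ι b → E × E → ℂ := fun b l x => mpoly (del (c b) l) fun k => Y b k x with hm
  set n : ∀ b, ι b → E × E → ℂ := fun b l x => mpoly (del (c b) l) fun k => X b k x with hn
  have tm : ∀ b l, TestFun (m b l) := fun b l => testFun_mpoly _ _
  have tn : ∀ b l, TestFun (n b l) := fun b l => testFun_mpoly _ _
  set Q : α → α → E × E → ℂ := fun a b x => bpoly (contr (K a b) (tens (c a) (c b)))
    (fun k => X a k x) fun l => Y b l x with hQ
  have tQ : ∀ a b, TestFun (Q a b) := fun a b => testFun_bpoly _ _ _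
  -- the derivative of the second exponential
  have hd : ∀ x : E × E, Complex.exp (Complex.I * comb s c w x.1) *
      fderiv ℝ (fun y => Complex.exp (Complex.I * comb t c w y)) (rotFst E θ x) (rotSnd E θ x) =
      ∑ b, ∑ l, (Complex.I * t b * p b) * (Z b l x * (eX x * (eY x * m b l x))) := by
    intro x
    rw [((hasFDerivAt_comb t hc w (rotFst E θ x)).const_mul Complex.I).cexp.fderiv]
    simp only [smul_apply, sum_apply, smul_eq_mul, Finset.mul_sum]
    refine Finset.sum_congr rfl fun b _ => Finset.sum_congr rfl fun l _ => ?_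
    change eX x * (eY x * (Complex.I * (t b * (p b * m b l x * Z b l x)))) = _
    ring
  -- integration by parts along `Z b l`, which is uncorrelated with all the `Y a k`
  have hw : ∀ b l x, wderiv (μ.prod μ) (Z b l) (fun x => eX x * (eY x * m b l x)) x =
      Complex.I * (∑ a, (s a : ℂ) * ∑ k, (p a : ℂ) * n a k x *
        -(Real.sin θ * K a b k l : ℝ)) * eX x * (eY x * m b l x) := by
    intro b l x
    rw [wderiv_mul teX (teY.mul (tm b l)), wderiv_mul teY (tm b l),
      wderiv_cexp (testFun_comb s c X), wderiv_cexp (testFun_comb t c Y),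
      wderiv_comb s hc, wderiv_comb t hc, wderiv_mpoly ((hc b).del l)]
    simp only [hZX, hZY, mul_zero, Finset.sum_const_zero, zero_mul, add_zero]
    rfl
  have hμ2 := integral_prod_self_eq_zero hμ
  have hwi : ∀ b l, Integrable
      (wderiv (μ.prod μ) (Z b l) fun x => eX x * (eY x * m b l x)) (μ.prod μ) := by
    intro b l
    refine (TestFun.integrable ?_ _).congr (ae_of_all _ fun x => (hw b l x).symm)
    refine (((TestFun.const _).mul (TestFun.sum fun a _ => (TestFun.const _).mul
      (TestFun.sum fun k _ => ((TestFun.const _).mul (tn a k)).mul (TestFun.const _)))).mul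
        teX).mul (teY.mul (tm b l))
  have hmain : ∫ x : E × E, Complex.exp (Complex.I * comb s c w x.1) *
      fderiv ℝ (fun y => Complex.exp (Complex.I * comb t c w y)) (rotFst E θ x) (rotSnd E θ x)
      ∂(μ.prod μ) = ∫ x, ∑ a, ∑ b, ((s a * t b * (p a * p b) * Real.sin θ : ℝ) : ℂ) *
        (eX x * eY x * Q a b x) ∂(μ.prod μ) := by
    simp only [hd]
    rw [integral_finsetSum _ fun b _ => integrable_finsetSum _ fun l _ =>
      (((TestFun.clm (Z b l)).mul (teX.mul (teY.mul (tm b l)))).integrable _).const_mul _]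
    have e1 : ∀ b, ∫ x, ∑ l, (Complex.I * t b * p b) * (Z b l x * (eX x * (eY x * m b l x)))
        ∂(μ.prod μ) = ∫ x, ∑ l, (Complex.I * t b * p b) *
          wderiv (μ.prod μ) (Z b l) (fun x => eX x * (eY x * m b l x)) x ∂(μ.prod μ) := by
      intro b
      rw [integral_finsetSum _ fun l _ =>
        (((TestFun.clm (Z b l)).mul (teX.mul (teY.mul (tm b l)))).integrable _).const_mul _,
        integral_finsetSum _ fun l _ => (hwi b l).const_mul _]
      refine Finset.sum_congr rfl fun l _ => ?_
      rw [integral_const_mul, integral_const_mul,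
        integral_clm_mul _ hμ2 _ (teX.mul (teY.mul (tm b l)))]
    simp only [e1]
    rw [← integral_finsetSum _ fun b _ => integrable_finsetSum _ fun l _ => (hwi b l).const_mul _]
    congr 1
    ext x
    simp only [hw]
    rw [Finset.sum_comm (f := fun a b => ((s a * t b * (p a * p b) * Real.sin θ : ℝ) : ℂ) *
        (eX x * eY x * Q a b x))]
    refine Finset.sum_congr rfl fun b _ => ?_
    simp only [hQ, bpoly_contr_tens, Finset.mul_sum, Finset.sum_mul]
    rw [Finset.sum_comm]
    refine Finset.sum_congr rfl fun a _ => ?_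
    rw [Finset.sum_comm]
    refine Finset.sum_congr rfl fun k _ => Finset.sum_congr rfl fun l _ => ?_
    change _ = _ * (_ * ((K a b k l : ℂ) * (n a k x * m b l x)))
    push_cast
    linear_combination (-(t b : ℂ) * p b * s a * p a * n a k x * Complex.sin θ * K a b k l * eX x *
      eY x * m b l x) * Complex.I_sq
  rw [hmain]
  have hbd : ∀ x, ‖∑ a, ∑ b, ((s a * t b * (p a * p b) * Real.sin θ : ℝ) : ℂ) *
      (eX x * eY x * Q a b x)‖ ≤ ∑ a, ∑ b, |s a| * |t b| * (p a * p b) * ‖Q a b x‖ := by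
    intro x
    refine (norm_sum_le _ _).trans (Finset.sum_le_sum fun a _ => (norm_sum_le _ _).trans
      (Finset.sum_le_sum fun b _ => ?_))
    rw [norm_mul, norm_mul, norm_mul, neX, neY, one_mul, one_mul, Complex.norm_real,
      Real.norm_eq_abs, abs_mul, abs_mul, abs_mul, abs_of_nonneg (a := (p a : ℝ) * p b)
      (by positivity)]
    refine mul_le_mul_of_nonneg_right ?_ (norm_nonneg _)
    exact mul_le_of_le_one_right (by positivity) (Real.abs_sin_le_one θ)
  have iQ : ∀ a b, Integrable (fun x => |s a| * |t b| * (p a * p b) * ‖Q a b x‖) (μ.prod μ) :=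
    fun a b => ((tQ a b).integrable _).norm.const_mul _
  refine (norm_integral_le_of_norm_le (integrable_finsetSum _ fun a _ =>
    integrable_finsetSum _ fun b _ => iQ a b) (ae_of_all _ hbd)).trans ?_
  rw [integral_finsetSum _ fun a _ => integrable_finsetSum _ fun b _ => iQ a b]
  refine Finset.sum_le_sum fun a _ => ?_
  rw [integral_finsetSum _ fun b _ => iQ a b]
  refine Finset.sum_le_sum fun b _ => ?_
  rw [integral_const_mul]
  exact mul_le_mul_of_nonneg_left (integral_norm_le_sqrt (tQ a b)) (by positivity)

/-- The constant in the covariance bound for integrals of orders `p` and `q`. -/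
def covConst (p q : ℕ) : ℝ :=
  Real.pi / 2 * (p * q * √(3 ^ (p + q) * ((p + q).factorial : ℝ) ^ 2))

lemma covConst_nonneg (p q : ℕ) : 0 ≤ covConst p q := by unfold covConst; positivity

/-- Covariance bound for exponentials of polynomials in Gaussian forms, in terms of the norms of
the contractions of positive order of the coefficients. -/
theorem norm_integral_cexp_sub_le (hμ : ∫ x, x ∂μ = 0)
    (h : ∀ a b, CorrForms μ (w a) (w b) (F a) (F b) (R a) (R b) (K a b) (K' a b) 1)
    (hc : ∀ a, IsSymm (c a)) (hR : ∀ a, OffDiag (R a) (c a))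
    (hreal : ∀ a e, (mpoly (c a) fun k => w a k e).im = 0) (s t : α → ℝ) :
    ‖∫ x, Complex.exp (Complex.I * comb s c w x) * Complex.exp (Complex.I * comb t c w x) ∂μ -
      (∫ x, Complex.exp (Complex.I * comb s c w x) ∂μ) *
        ∫ x, Complex.exp (Complex.I * comb t c w x) ∂μ‖ ≤
      ∑ a, ∑ b, |s a| * |t b| * (covConst (p a) (p b) *
        √(∑ r ∈ Finset.range (p a + p b + 1),
          contrNormSq (K a b) (F a) (F b) (r + 1) (tens (c a) (c b)))) := by
  have hμ2 := integral_prod_self_eq_zero hμ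
  refine (norm_integral_mul_sub_le μ
    ((testFun_comb s c w).cexp fun x => comb_im s fun a => hreal a x)
    ((testFun_comb t c w).cexp fun x => comb_im t fun a => hreal a x)
    (fun θ => (norm_interpolation_deriv_le hμ h hc hreal s t θ).trans
      (Finset.sum_le_sum fun a _ => Finset.sum_le_sum fun b _ =>
        mul_le_mul_of_nonneg_left (Real.sqrt_le_sqrt
          (secondMoment_le hμ2 ((h a b).rot hμ θ) (p a + p b)
            ((goodTensor_tens (hc a) (hc b) (hR a) (hR b)).contr (K a b)) (by omega)))
          (by positivity)))).trans ?_
  rw [Finset.sum_mul]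
  refine Finset.sum_le_sum fun a _ => ?_
  rw [Finset.sum_mul]
  refine Finset.sum_le_sum fun b _ => le_of_eq ?_
  rw [Real.sqrt_mul (by positivity), covConst]
  simp only [contrNormSq]
  ring

end Comb

/-! ### Iterated contractions of tensors -/

section ContrFormula

variable {ι ι' : Type*}

lemma append_snoc {m r : ℕ} (i : Fin m → ι) (k : Fin r → ι) (x : ι) :
    (Fin.append i (Fin.snoc (α := fun _ => ι) k x : Fin (r + 1) → ι) : Fin (m + (r + 1)) → ι) =
      (Fin.snoc (α := fun _ => ι) (Fin.append i k : Fin (m + r) → ι) x : Fin (m + r + 1) → ι) := by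
  ext a
  change Fin.append i (Fin.snoc (α := fun _ => ι) k x : Fin (r + 1) → ι) a = _
  revert a
  intro (a : Fin (m + r + 1))
  refine Fin.lastCases ?_ (fun a => ?_) a
  · rw [Fin.snoc_last, show Fin.last (m + r) = Fin.natAdd m (Fin.last r) from rfl,
      Fin.append_right, Fin.snoc_last]
  · rw [Fin.snoc_castSucc]
    refine Fin.addCases (fun a => ?_) (fun a => ?_) a
    · rw [show (Fin.castAdd r a).castSucc = Fin.castAdd (r + 1) a from rfl, Fin.append_left,
        Fin.append_left]
    · rw [show (Fin.natAdd m a).castSucc = Fin.natAdd m a.castSucc from rfl, Fin.append_right,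
        Fin.append_right, Fin.snoc_castSucc]

lemma append_fin_zero {m : ℕ} (i : Fin m → ι) (k : Fin 0 → ι) : Fin.append i k = i := by
  rw [Fin.append_right_nil i k rfl]
  rfl

variable [Fintype ι] [Fintype ι'] {K : ι → ι' → ℝ} {F : ι → ℝ} {F' : ι' → ℝ}

lemma contrNormSq_eq (r : ℕ) {m m' : ℕ} (T : (Fin (m + r) → ι) → (Fin (m' + r) → ι') → ℂ) :
    contrNormSq K F F' r T = ∑ i : Fin m → ι, ∑ j : Fin m' → ι',
      (∏ a, F (i a)) * (∏ b, F' (j b)) * ‖∑ k : Fin r → ι, ∑ l : Fin r → ι',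
        ((∏ a, K (k a) (l a) : ℝ) : ℂ) * T (Fin.append i k) (Fin.append j l)‖ ^ 2 := by
  induction r with
  | zero =>
    simp only [contrNormSq, append_fin_zero, Finset.univ_eq_empty, Finset.prod_empty,
      Complex.ofReal_one, one_mul, Fintype.sum_unique]
    rfl
  | succ r ih =>
    rw [contrNormSq]
    refine (ih (contr K T)).trans ?_
    refine Finset.sum_congr rfl fun i _ => Finset.sum_congr rfl fun j _ => ?_
    congr 3
    simp only [sum_snoc (A := ℂ), append_snoc, Fin.prod_univ_castSucc, Fin.snoc_castSucc,
      Fin.snoc_last]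
    have h1 : ∀ (k : Fin r → ι) (l : Fin r → ι'),
        ((∏ a, K (k a) (l a) : ℝ) : ℂ) * contr K T (Fin.append i k) (Fin.append j l) =
        ∑ x, ∑ y, (((∏ a, K (k a) (l a)) * K x y : ℝ) : ℂ) *
          T (Fin.snoc (α := fun _ => ι) (Fin.append i k : Fin (m + r) → ι) x)
            (Fin.snoc (α := fun _ => ι') (Fin.append j l : Fin (m' + r) → ι') y) := by
      intro k l
      simp only [contr, Finset.mul_sum]
      refine Finset.sum_congr rfl fun x _ => Finset.sum_congr rfl fun y _ => ?_
      push_cast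
      rw [mul_assoc]
      rfl
    simp only [h1]
    refine .trans (Finset.sum_congr rfl fun k _ => ?_) Finset.sum_comm
    refine Finset.sum_comm.trans (Finset.sum_congr rfl fun x _ => ?_)
    exact Finset.sum_comm

lemma contrNormSq_eq_zero {r a b : ℕ} (h : a < r ∨ b < r) (T : (Fin a → ι) → (Fin b → ι') → ℂ) :
    contrNormSq K F F' r T = 0 := by
  induction r generalizing a b with
  | zero => omega
  | succ r ih =>
    rw [contrNormSq]
    by_cases h0 : a = 0 ∨ b = 0
    · have : contr K T = 0 := by
        ext i j
        rcases h0 with rfl | rfl <;> simp [contr, del_zero]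
      rw [this, contrNormSq_zero]
    · exact ih (by omega) _

end ContrFormula

/-! ### Contractions of simple kernels -/

section Append

variable {m r : ℕ}

lemma measurable_append {α : Type*} [MeasurableSpace α] {x : α → Fin m → ℝ} {s : α → Fin r → ℝ}
    (hx : Measurable x) (hs : Measurable s) : Measurable fun a => Fin.append (x a) (s a) := by
  refine measurable_pi_lambda _ fun a => ?_
  refine Fin.addCases (fun a => ?_) (fun a => ?_) a
  · simpa only [Fin.append_left] using measurable_pi_iff.1 hx a
  · simpa only [Fin.append_right] using measurable_pi_iff.1 hs a

lemma measurePreserving_append (F : Measure ℝ) [SigmaFinite F] (m r : ℕ) :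
    MeasurePreserving (fun z : (Fin m → ℝ) × (Fin r → ℝ) => Fin.append z.1 z.2)
      ((powMeasure F m).prod (powMeasure F r)) (powMeasure F (m + r)) := by
  have hm : Measurable fun z : (Fin m → ℝ) × (Fin r → ℝ) => Fin.append z.1 z.2 :=
    measurable_append measurable_fst measurable_snd
  refine ⟨hm, (Measure.pi_eq fun s hs => ?_).symm⟩
  rw [Measure.map_apply hm (MeasurableSet.univ_pi hs)]
  have : (fun z : (Fin m → ℝ) × (Fin r → ℝ) => Fin.append z.1 z.2) ⁻¹' Set.univ.pi s =
      (Set.univ.pi fun a => s (Fin.castAdd r a)) ×ˢ (Set.univ.pi fun a => s (Fin.natAdd m a)) := by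
    ext z
    simp only [Set.mem_preimage, Set.mem_pi, Set.mem_univ, true_imp_iff, Set.mem_prod]
    constructor
    · intro h
      exact ⟨fun a => by simpa using h (Fin.castAdd r a),
        fun a => by simpa using h (Fin.natAdd m a)⟩
    · rintro ⟨h1, h2⟩ a
      refine Fin.addCases (fun a => ?_) (fun a => ?_) a
      · simpa using h1 a
      · simpa using h2 a
  rw [this, Measure.prod_prod, Measure.pi_pi, Measure.pi_pi, Fin.prod_univ_add]

/-- The contraction norm of kernels of `m + r` and `m' + r` variables, with the contracted
variables appended to the free ones. -/
lemma contractionNorm_add (σ : ℝ → ℝ) (F : Measure ℝ) {m m' : ℕ} (f : (Fin (m + r) → ℝ) → ℂ)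
    (g : (Fin (m' + r) → ℝ) → ℂ) :
    contractionNorm σ F r f g = eLpNorm (fun z : (Fin m → ℝ) × (Fin m' → ℝ) =>
      ∫ s : Fin r → ℝ, f (Fin.append z.1 s) * g (Fin.append z.2 fun a => σ (s a)) ∂(powMeasure F r))
      2 ((powMeasure F m).prod (powMeasure F m')) := by
  have key : ∀ (d e : ℕ) (hd : d = m) (he : e = m'),
      eLpNorm (fun z : (Fin d → ℝ) × (Fin e → ℝ) => ∫ s : Fin r → ℝ,
        f (fun a => if h : (a : ℕ) < d then z.1 ⟨a, h⟩ else
          s ⟨a - d, by have := a.2; omega⟩) *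
        g (fun a => if h : (a : ℕ) < e then z.2 ⟨a, h⟩ else
          σ (s ⟨a - e, by have := a.2; omega⟩)) ∂(powMeasure F r))
        2 ((powMeasure F d).prod (powMeasure F e)) =
      eLpNorm (fun z : (Fin m → ℝ) × (Fin m' → ℝ) => ∫ s : Fin r → ℝ,
        f (Fin.append z.1 s) * g (Fin.append z.2 fun a => σ (s a)) ∂(powMeasure F r))
        2 ((powMeasure F m).prod (powMeasure F m')) := by
    have happ : ∀ {m : ℕ} (x : Fin m → ℝ) (s : Fin r → ℝ),
        (fun a : Fin (m + r) => if h : (a : ℕ) < m then x ⟨a, h⟩ else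
          s ⟨a - m, by have := a.2; omega⟩) = Fin.append x s := by
      intro m x s
      ext a
      refine Fin.addCases (fun a => ?_) (fun a => ?_) a
      · simp
      · simp
    intro d e hd he
    subst hd he
    congr 1
    ext z
    congr 1
    ext s
    rw [happ, happ z.2 fun a => σ (s a)]
  exact key _ _ (Nat.add_sub_cancel ..) (Nat.add_sub_cancel ..)

end Append

/-- The squared norm of a simple function given by pairwise disjoint sets. -/
lemma eLpNorm_sum_indicator_sq {X κ : Type*} [MeasurableSpace X] [Fintype κ] (μ : Measure X)
    {Q : κ → Set X} (hQ : ∀ k, MeasurableSet (Q k)) (hd : Pairwise fun k l => Disjoint (Q k) (Q l))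
    (S : κ → ℂ) :
    eLpNorm (fun z => ∑ k, (Q k).indicator (fun _ => S k) z) 2 μ ^ 2 =
      ∑ k, ‖S k‖ₑ ^ 2 * μ (Q k) := by
  have h := eLpNorm_nnreal_pow_eq_lintegral (μ := μ) (p := 2) two_ne_zero
    (f := fun z => ∑ k, (Q k).indicator (fun _ => S k) z)
  norm_num at h
  rw [h]
  have hpt : ∀ z, ‖∑ k, (Q k).indicator (fun _ => S k) z‖ₑ ^ 2 =
      ∑ k, (Q k).indicator (fun _ => ‖S k‖ₑ ^ 2) z := by
    intro z
    by_cases hz : ∃ k, z ∈ Q k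
    · obtain ⟨k, hk⟩ := hz
      have hne : ∀ l, l ≠ k → z ∉ Q l := fun l hl hzl => Set.disjoint_left.1 (hd hl) hzl hk
      rw [Fintype.sum_eq_single k fun l hl => Set.indicator_of_notMem (hne l hl) _,
        Fintype.sum_eq_single k fun l hl => Set.indicator_of_notMem (hne l hl) _,
        Set.indicator_of_mem hk, Set.indicator_of_mem hk]
    · push Not at hz
      simp [hz]
  simp only [hpt]
  rw [lintegral_finsetSum _ fun k _ => measurable_const.indicator (hQ k)]
  simp [lintegral_indicator, hQ]

namespace SimpleKernel

variable {σ : ℝ → ℝ} {F : Measure ℝ}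

lemma toFun_append {m r : ℕ} (g : SimpleKernel σ F (m + r)) (x : Fin m → ℝ) (s : Fin r → ℝ) :
    g.toFun (Fin.append x s) = ∑ i : Fin m → Fin g.n, ∑ k : Fin r → Fin g.n,
      g.coeff (Fin.append i k) * ((∏ a, (g.A (i a)).indicator (fun _ => (1 : ℂ)) (x a)) *
        ∏ a, (g.A (k a)).indicator (fun _ => (1 : ℂ)) (s a)) := by
  rw [toFun, ← (Fin.appendEquiv m r).sum_comp, Fintype.sum_prod_type]
  refine Finset.sum_congr rfl fun i _ => Finset.sum_congr rfl fun k _ => ?_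
  simp [Fin.appendEquiv, Fin.prod_univ_add]

/-- The matrix of the `F`-measures of the intersections `A_k ∩ σ⁻¹ B_l`. -/
def overlap {p q : ℕ} (g : SimpleKernel σ F p) (h : SimpleKernel σ F q) (k : Fin g.n)
    (l : Fin h.n) : ℝ := F.real (g.A k ∩ σ ⁻¹' h.A l)

/-- The `F`-measures of the sets of the system. -/
def mass {p : ℕ} (g : SimpleKernel σ F p) (k : Fin g.n) : ℝ := F.real (g.A k)

lemma disjoint_pi {p m : ℕ} (g : SimpleKernel σ F p) {i i' : Fin m → Fin g.n} (h : i ≠ i') :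
    Disjoint (Set.univ.pi fun a => g.A (i a)) (Set.univ.pi fun a => g.A (i' a)) := by
  obtain ⟨a, ha⟩ := Function.ne_iff.1 h
  exact Set.disjoint_univ_pi.2 ⟨a, g.disjoint ha⟩

lemma prod_indicator {p m : ℕ} (g : SimpleKernel σ F p) (i : Fin m → Fin g.n) (x : Fin m → ℝ) :
    ∏ a, (g.A (i a)).indicator (fun _ => (1 : ℂ)) (x a) =
      (Set.univ.pi fun a => g.A (i a)).indicator (fun _ => (1 : ℂ)) x := by
  by_cases hx : ∀ a, x a ∈ g.A (i a)
  · rw [Set.indicator_of_mem (by simpa using hx)]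
    exact Finset.prod_eq_one fun a _ => Set.indicator_of_mem (hx a) _
  · rw [Set.indicator_of_notMem (by simpa using hx)]
    push Not at hx
    obtain ⟨a, ha⟩ := hx
    exact Finset.prod_eq_zero (Finset.mem_univ a) (Set.indicator_of_notMem ha _)

variable [SigmaFinite F]

lemma integral_prod_indicator (hσ : Measurable σ) {p q r : ℕ} (g : SimpleKernel σ F p)
    (h : SimpleKernel σ F q) (k : Fin r → Fin g.n) (l : Fin r → Fin h.n) :
    Integrable (fun s : Fin r → ℝ => (∏ a, (g.A (k a)).indicator (fun _ => (1 : ℂ)) (s a)) *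
      ∏ a, (h.A (l a)).indicator (fun _ => (1 : ℂ)) (σ (s a))) (powMeasure F r) ∧
    ∫ s : Fin r → ℝ, (∏ a, (g.A (k a)).indicator (fun _ => (1 : ℂ)) (s a)) *
      ∏ a, (h.A (l a)).indicator (fun _ => (1 : ℂ)) (σ (s a)) ∂(powMeasure F r) =
      ((∏ a, overlap g h (k a) (l a) : ℝ) : ℂ) := by
  have hm : ∀ a, MeasurableSet (g.A (k a) ∩ σ ⁻¹' h.A (l a)) :=
    fun a => (g.measurableSet _).inter (hσ (h.measurableSet _))
  have e : ∀ s : Fin r → ℝ, (∏ a, (g.A (k a)).indicator (fun _ => (1 : ℂ)) (s a)) *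
      ∏ a, (h.A (l a)).indicator (fun _ => (1 : ℂ)) (σ (s a)) =
      ∏ a, (g.A (k a) ∩ σ ⁻¹' h.A (l a)).indicator (fun _ => (1 : ℂ)) (s a) := by
    intro s
    rw [← Finset.prod_mul_distrib]
    refine Finset.prod_congr rfl fun a _ => ?_
    by_cases h1 : s a ∈ g.A (k a) <;> by_cases h2 : σ (s a) ∈ h.A (l a) <;>
      simp [Set.indicator, h1, h2]
  simp only [e]
  constructor
  · refine Integrable.fintype_prod (f := fun a x =>
      (g.A (k a) ∩ σ ⁻¹' h.A (l a)).indicator (fun _ => (1 : ℂ)) x) fun a => ?_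
    exact (integrable_indicator_iff (hm a)).2
      (integrableOn_const ((measure_mono Set.inter_subset_left).trans_lt
        (g.measure_lt_top _)).ne)
  · rw [integral_fintype_prod_eq_prod (fun a x =>
      (g.A (k a) ∩ σ ⁻¹' h.A (l a)).indicator (fun _ => (1 : ℂ)) x)]
    push_cast
    refine Finset.prod_congr rfl fun a _ => ?_
    rw [integral_indicator (hm a)]
    simp [overlap]

lemma contraction_append (hσ : Measurable σ) {m m' r : ℕ} (g : SimpleKernel σ F (m + r))
    (h : SimpleKernel σ F (m' + r)) (x : Fin m → ℝ) (y : Fin m' → ℝ) :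
    ∫ s : Fin r → ℝ, g.toFun (Fin.append x s) * h.toFun (Fin.append y fun a => σ (s a))
        ∂(powMeasure F r) =
      ∑ i : Fin m → Fin g.n, ∑ j : Fin m' → Fin h.n,
        ((∏ a, (g.A (i a)).indicator (fun _ => (1 : ℂ)) (x a)) *
          ∏ a, (h.A (j a)).indicator (fun _ => (1 : ℂ)) (y a)) *
        ∑ k : Fin r → Fin g.n, ∑ l : Fin r → Fin h.n,
          ((∏ a, overlap g h (k a) (l a) : ℝ) : ℂ) *
            tens g.coeff h.coeff (Fin.append i k) (Fin.append j l) := by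
  set u : (Fin m → Fin g.n) → ℂ := fun i => ∏ a, (g.A (i a)).indicator (fun _ => (1 : ℂ)) (x a)
  set v : (Fin m' → Fin h.n) → ℂ := fun j => ∏ a, (h.A (j a)).indicator (fun _ => (1 : ℂ)) (y a)
  have e : ∀ s : Fin r → ℝ, g.toFun (Fin.append x s) * h.toFun (Fin.append y fun a => σ (s a)) =
      ∑ i, ∑ j, ∑ k, ∑ l, (u i * v j * tens g.coeff h.coeff (Fin.append i k) (Fin.append j l)) *
        ((∏ a, (g.A (k a)).indicator (fun _ => (1 : ℂ)) (s a)) *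
          ∏ a, (h.A (l a)).indicator (fun _ => (1 : ℂ)) (σ (s a))) := by
    intro s
    rw [toFun_append, toFun_append, Finset.sum_mul_sum]
    refine Finset.sum_congr rfl fun i _ => Finset.sum_congr rfl fun j _ => ?_
    rw [Finset.sum_mul_sum]
    refine Finset.sum_congr rfl fun k _ => Finset.sum_congr rfl fun l _ => ?_
    simp only [tens, u, v]
    ring
  have hi := fun k l => (integral_prod_indicator (F := F) hσ (r := r) g h k l).1
  simp only [e]
  rw [integral_finsetSum _ fun i _ => integrable_finsetSum _ fun j _ =>
    integrable_finsetSum _ fun k _ => integrable_finsetSum _ fun l _ => (hi k l).const_mul _]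
  refine Finset.sum_congr rfl fun i _ => ?_
  rw [integral_finsetSum _ fun j _ =>
    integrable_finsetSum _ fun k _ => integrable_finsetSum _ fun l _ => (hi k l).const_mul _]
  refine Finset.sum_congr rfl fun j _ => ?_
  rw [integral_finsetSum _ fun k _ =>
    integrable_finsetSum _ fun l _ => (hi k l).const_mul _, Finset.mul_sum]
  refine Finset.sum_congr rfl fun k _ => ?_
  rw [integral_finsetSum _ fun l _ => (hi k l).const_mul _, Finset.mul_sum]
  refine Finset.sum_congr rfl fun l _ => ?_
  rw [integral_const_mul, (integral_prod_indicator hσ g h k l).2]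
  ring

/-- The contraction norm of simple kernels in terms of the coefficients. -/
lemma contractionNorm_sq (hσ : Measurable σ) {p q r : ℕ} (g : SimpleKernel σ F p)
    (h : SimpleKernel σ F q) (hp : r ≤ p) (hq : r ≤ q) :
    contractionNorm σ F r g.toFun h.toFun ^ 2 =
      ENNReal.ofReal (contrNormSq (overlap g h) g.mass h.mass r (tens g.coeff h.coeff)) := by
  obtain ⟨m, rfl⟩ := Nat.exists_eq_add_of_le' hp
  obtain ⟨m', rfl⟩ := Nat.exists_eq_add_of_le' hq
  set S : (Fin m → Fin g.n) → (Fin m' → Fin h.n) → ℂ := fun i j =>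
    ∑ k : Fin r → Fin g.n, ∑ l : Fin r → Fin h.n, ((∏ a, overlap g h (k a) (l a) : ℝ) : ℂ) *
      tens g.coeff h.coeff (Fin.append i k) (Fin.append j l) with hS
  rw [contractionNorm_add, contrNormSq_eq]
  have e : (fun z : (Fin m → ℝ) × (Fin m' → ℝ) => ∫ s : Fin r → ℝ,
      g.toFun (Fin.append z.1 s) * h.toFun (Fin.append z.2 fun a => σ (s a)) ∂(powMeasure F r)) =
      fun z => ∑ c : (Fin m → Fin g.n) × (Fin m' → Fin h.n),
        ((Set.univ.pi fun a => g.A (c.1 a)) ×ˢ (Set.univ.pi fun a => h.A (c.2 a))).indicator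
          (fun _ => S c.1 c.2) z := by
    ext z
    rw [contraction_append hσ, Fintype.sum_prod_type]
    refine Finset.sum_congr rfl fun i _ => Finset.sum_congr rfl fun j _ => ?_
    rw [prod_indicator, prod_indicator]
    by_cases h1 : z.1 ∈ Set.univ.pi fun a => g.A (i a) <;>
      by_cases h2 : z.2 ∈ Set.univ.pi fun a => h.A (j a) <;>
      simp only [Set.indicator, Set.mem_prod, h1, h2, and_true, and_false, if_true, if_false,
        mul_one, one_mul, mul_zero, zero_mul]
    rfl
  rw [e, eLpNorm_sum_indicator_sq]
  · rw [Fintype.sum_prod_type, ENNReal.ofReal_sum_of_nonneg]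
    · refine Finset.sum_congr rfl fun i _ => ?_
      rw [ENNReal.ofReal_sum_of_nonneg]
      · refine Finset.sum_congr rfl fun j _ => ?_
        change ‖S i j‖ₑ ^ 2 * _ = ENNReal.ofReal ((∏ a, F.real _) * (∏ a, F.real _) * ‖S i j‖ ^ 2)
        rw [Measure.prod_prod, Measure.pi_pi, Measure.pi_pi, ENNReal.ofReal_mul (by positivity),
          ENNReal.ofReal_mul (by positivity),
          ENNReal.ofReal_prod_of_nonneg (fun _ _ => by positivity),
          ENNReal.ofReal_prod_of_nonneg (fun _ _ => by positivity),
          ENNReal.ofReal_pow (by positivity),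
          ofReal_norm, mul_comm]
        simp only [ofReal_measureReal (g.measure_lt_top _).ne,
          ofReal_measureReal (h.measure_lt_top _).ne]
      · exact fun j _ => by unfold mass; positivity
    · exact fun i _ => Finset.sum_nonneg fun j _ => by unfold mass; positivity
  · exact fun c => (MeasurableSet.univ_pi fun _ => g.measurableSet _).prod
      (MeasurableSet.univ_pi fun _ => h.measurableSet _)
  · rintro ⟨i, j⟩ ⟨i', j'⟩ hne
    rw [Set.disjoint_prod]
    by_cases hi : i = i'
    · exact Or.inr (h.disjoint_pi fun hj => hne (Prod.ext hi hj))
    · exact Or.inl (g.disjoint_pi hi)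

/-- The contractions of positive order of simple kernels, measured by the coefficients. -/
lemma sqrt_sum_contrNormSq_le (hσ : Measurable σ) {p q : ℕ} (g : SimpleKernel σ F p)
    (h : SimpleKernel σ F q) (n : ℕ) :
    ENNReal.ofReal √(∑ r ∈ Finset.range n,
        contrNormSq (overlap g h) g.mass h.mass (r + 1) (tens g.coeff h.coeff)) ≤
      ∑ r ∈ Finset.Icc 1 (min p q), contractionNorm σ F r g.toFun h.toFun := by
  have hnn : ∀ r, 0 ≤ contrNormSq (overlap g h) g.mass h.mass r (tens g.coeff h.coeff) :=
    fun r => contrNormSq_nonneg (fun _ => measureReal_nonneg) (fun _ => measureReal_nonneg) r _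
  have hsq : ∀ s : Finset ℕ, √(∑ r ∈ s,
      contrNormSq (overlap g h) g.mass h.mass (r + 1) (tens g.coeff h.coeff)) ≤
      ∑ r ∈ s, √(contrNormSq (overlap g h) g.mass h.mass (r + 1) (tens g.coeff h.coeff)) := by
    intro s
    induction s using Finset.cons_induction with
    | empty => simp
    | cons a s ha ih =>
      rw [Finset.sum_cons, Finset.sum_cons]
      have h1 := Real.sq_sqrt (hnn (a + 1))
      have h2 := Real.sq_sqrt (Finset.sum_nonneg fun r (_ : r ∈ s) => hnn (r + 1))
      refine (Real.sqrt_le_iff.2 ⟨by positivity, ?_⟩).trans (add_le_add_right ih _)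
      rw [add_sq, h1, h2]
      nlinarith [mul_nonneg (Real.sqrt_nonneg (contrNormSq (overlap g h) g.mass h.mass (a + 1)
        (tens g.coeff h.coeff))) (Real.sqrt_nonneg (∑ r ∈ s,
          contrNormSq (overlap g h) g.mass h.mass (r + 1) (tens g.coeff h.coeff)))]
  refine (ENNReal.ofReal_le_ofReal (hsq _)).trans ?_
  rw [ENNReal.ofReal_sum_of_nonneg fun _ _ => Real.sqrt_nonneg _]
  have hterm : ∀ r, r ≤ p → r ≤ q → ENNReal.ofReal
      √(contrNormSq (overlap g h) g.mass h.mass r (tens g.coeff h.coeff)) =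
      contractionNorm σ F r g.toFun h.toFun := by
    intro r hp hq
    refine (ENNReal.pow_right_strictMono two_ne_zero).injective ?_
    rw [contractionNorm_sq hσ g h hp hq, ← ENNReal.ofReal_pow (Real.sqrt_nonneg _),
      Real.sq_sqrt (hnn _)]
  have h0 : ∀ r, ¬(r ≤ p ∧ r ≤ q) →
      contrNormSq (overlap g h) g.mass h.mass r (tens g.coeff h.coeff) = 0 :=
    fun r hr => contrNormSq_eq_zero (by omega) _
  have hshift := Finset.sum_Ico_add' (fun r => ENNReal.ofReal
    √(contrNormSq (overlap g h) g.mass h.mass r (tens g.coeff h.coeff))) 0 n 1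
  rw [← Finset.range_eq_Ico] at hshift
  rw [hshift]
  refine (Finset.sum_le_sum_of_ne_zero (t := Finset.Icc 1 (min p q)) fun r hr hne => ?_).trans
    (Finset.sum_le_sum fun r hr => ?_)
  · have : r ≤ p ∧ r ≤ q := by
      by_contra hr
      exact hne (by simp [h0 r hr])
    simp only [Finset.mem_Ico] at hr
    simp only [Finset.mem_Icc, le_min_iff]
    omega
  · simp only [Finset.mem_Icc, le_min_iff] at hr
    exact (hterm r hr.2.1 hr.2.2).le

end SimpleKernel

/-! ### The Gaussian vector behind a family of simple kernels -/

namespace SimpleKernel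

variable {Ω : Type*} {σ : ℝ → ℝ} {F : Measure ℝ} {α : Type*} {p : α → ℕ}

/-- The values of `W` on all the sets of the systems of a family of simple kernels. -/
def sample (g : ∀ a, SimpleKernel σ F (p a)) (W : Set ℝ → Ω → ℂ) (ω : Ω) :
    (Σ a, Fin (g a).n) → ℂ := fun τ => W ((g τ.1).A τ.2) ω

/-- The linear form `x ↦ x_{a,k}`, symmetrized so that it satisfies the Hermitian symmetry
everywhere and not only almost everywhere. -/
def form (g : ∀ a, SimpleKernel σ F (p a)) (a : α) (k : Fin (g a).n) :
    ((Σ a, Fin (g a).n) → ℂ) →L[ℝ] ℂ :=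
  (1 / 2 : ℝ) • (ContinuousLinearMap.proj (R := ℝ) (φ := fun _ : Σ a, Fin (g a).n => ℂ) ⟨a, k⟩ +
    (Complex.conjCLE : ℂ →L[ℝ] ℂ).comp (ContinuousLinearMap.proj (R := ℝ)
      (φ := fun _ : Σ a, Fin (g a).n => ℂ) ⟨a, (g a).star k⟩))

lemma form_apply (g : ∀ a, SimpleKernel σ F (p a)) (a : α) (k : Fin (g a).n)
    (x : (Σ a, Fin (g a).n) → ℂ) :
    form g a k x = (1 / 2 : ℝ) * (x ⟨a, k⟩ + conj (x ⟨a, (g a).star k⟩)) := by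
  simp [form, mul_add]

lemma conj_form (g : ∀ a, SimpleKernel σ F (p a)) (a : α) (k : Fin (g a).n)
    (x : (Σ a, Fin (g a).n) → ℂ) : conj (form g a k x) = form g a ((g a).star k) x := by
  rw [form_apply, form_apply, (g a).star_star]
  rw [map_mul, map_add, Complex.conj_ofReal, Complex.conj_conj, add_comm]

/-- Polynomials in the forms with Hermitian coefficients are real. -/
lemma mpoly_form_im (g : ∀ a, SimpleKernel σ F (p a)) (a : α) (x : (Σ a, Fin (g a).n) → ℂ) :
    (mpoly (g a).coeff fun k => form g a k x).im = 0 := by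
  rw [← Complex.conj_eq_iff_im]
  let e : (Fin (p a) → Fin (g a).n) ≃ (Fin (p a) → Fin (g a).n) :=
    { toFun := fun i b => (g a).star (i b)
      invFun := fun i b => (g a).star (i b)
      left_inv := fun i => funext fun b => (g a).star_star _
      right_inv := fun i => funext fun b => (g a).star_star _ }
  rw [mpoly, map_sum, ← e.sum_comp fun i => (g a).coeff i * ∏ b, form g a (i b) x]
  refine Finset.sum_congr rfl fun i _ => ?_
  rw [map_mul, map_prod, ← (g a).coeff_star]
  simp only [conj_form]
  rfl

variable [MeasurableSpace Ω] {W : Set ℝ → Ω → ℂ} {P : Measure Ω}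

lemma form_sample (hW : IsGaussianRandomMeasure σ F W P) (g : ∀ a, SimpleKernel σ F (p a)) (a : α)
    (k : Fin (g a).n) : (fun ω => form g a k (sample g W ω)) =ᵐ[P] W ((g a).A k) := by
  have h := hW.reflection _ ((g a).measurableSet k) ((g a).measure_lt_top k)
  rw [← (g a).A_star] at h
  filter_upwards [h] with ω hω
  rw [form_apply]
  simp only [sample, hω, Complex.conj_conj]
  push_cast
  ring

variable [Fintype α]

lemma hasGaussianLaw_sample (hW : IsGaussianRandomMeasure σ F W P)
    (g : ∀ a, SimpleKernel σ F (p a)) : HasGaussianLaw (sample g W) P := by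
  have h := (hW.gaussian.comp_right fun τ : Σ a, Fin (g a).n =>
    (⟨(g τ.1).A τ.2, (g τ.1).measurableSet _, (g τ.1).measure_lt_top _⟩ :
      {A : Set ℝ // MeasurableSet A ∧ F A < ∞})).hasGaussianLaw Finset.univ
  exact h.map (ContinuousLinearMap.pi fun τ => ContinuousLinearMap.proj (R := ℝ)
    (φ := fun _ : (Finset.univ : Finset (Σ a, Fin (g a).n)) => ℂ) ⟨τ, Finset.mem_univ τ⟩)

lemma aemeasurable_sample (hW : IsGaussianRandomMeasure σ F W P)
    (g : ∀ a, SimpleKernel σ F (p a)) : AEMeasurable (sample g W) P :=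
  (hasGaussianLaw_sample hW g).aemeasurable

lemma integral_sample (hW : IsGaussianRandomMeasure σ F W P) (g : ∀ a, SimpleKernel σ F (p a)) :
    ∫ x, x ∂(P.map (sample g W)) = 0 := by
  have := (hasGaussianLaw_sample hW g).isGaussian_map
  have hi : Integrable (fun x => x) (P.map (sample g W)) := IsGaussian.integrable_fun_id
  ext τ
  have h := (ContinuousLinearMap.proj (R := ℝ)
    (φ := fun _ : Σ a, Fin (g a).n => ℂ) τ).integral_comp_comm hi
  simp only [ContinuousLinearMap.proj_apply] at h
  rw [← h, integral_map (aemeasurable_sample hW g) (continuous_apply τ).aestronglyMeasurable]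
  exact hW.centred _ ((g τ.1).measurableSet _) ((g τ.1).measure_lt_top _)

lemma integral_form_mul_form (hW : IsGaussianRandomMeasure σ F W P)
    (g : ∀ a, SimpleKernel σ F (p a)) (a b : α) (k : Fin (g a).n) (l : Fin (g b).n) :
    ∫ x, form g a k x * form g b l x ∂(P.map (sample g W)) = (overlap (g a) (g b) k l : ℂ) := by
  rw [integral_map (aemeasurable_sample hW g) (by fun_prop), overlap, ← (g b).A_star,
    ← hW.covariance _ _ ((g a).measurableSet _) ((g a).measure_lt_top _) ((g b).measurableSet _)
      ((g b).measure_lt_top _)]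
  refine integral_congr_ae ?_
  filter_upwards [form_sample hW g a k, form_sample hW g b ((g b).star l)] with ω h1 h2
  rw [h1, ← h2, conj_form, (g b).star_star]

lemma integral_conj_form_mul_form (hW : IsGaussianRandomMeasure σ F W P)
    (g : ∀ a, SimpleKernel σ F (p a)) (a b : α) (k : Fin (g a).n) (l : Fin (g b).n) :
    ∫ x, conj (form g a k x) * form g b l x ∂(P.map (sample g W)) =
      (F.real ((g a).A k ∩ (g b).A l) : ℂ) := by
  rw [integral_map (aemeasurable_sample hW g) (by fun_prop), Set.inter_comm,
    ← hW.covariance _ _ ((g b).measurableSet _) ((g b).measure_lt_top _) ((g a).measurableSet _)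
      ((g a).measure_lt_top _)]
  refine integral_congr_ae ?_
  filter_upwards [form_sample hW g a k, form_sample hW g b l] with ω h1 h2
  rw [h1, h2, mul_comm]

lemma sum_real_inter_le {q q' : ℕ} (g : SimpleKernel σ F q) (h : SimpleKernel σ F q')
    (k : Fin g.n) : ∑ l, F.real (g.A k ∩ h.A l) ≤ g.mass k := by
  rw [← measureReal_biUnion_finset (fun l _ l' _ hl => (h.disjoint hl).mono
      Set.inter_subset_right Set.inter_subset_right)
    (fun l _ => (g.measurableSet k).inter (h.measurableSet l))
    (fun l _ => ((measure_mono Set.inter_subset_left).trans_lt (g.measure_lt_top k)).ne)]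
  exact measureReal_mono (Set.iUnion₂_subset fun _ _ => Set.inter_subset_left)
    (g.measure_lt_top k).ne

lemma corrForms (hW : IsGaussianRandomMeasure σ F W P) (g : ∀ a, SimpleKernel σ F (p a))
    (a b : α) :
    CorrForms (P.map (sample g W)) (form g a) (form g b) (g a).mass (g b).mass
      (fun k m => k = (g a).star m) (fun k m => k = (g b).star m) (overlap (g a) (g b))
      (fun k l => F.real ((g a).A k ∩ (g b).A l)) 1 := by
  have hXX : ∀ (a : α) (k m : Fin (g a).n), ¬ k = (g a).star m →
      ∫ x, form g a k x * form g a m x ∂(P.map (sample g W)) = 0 := by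
    intro a k m h
    rw [integral_form_mul_form hW, overlap, ← (g a).A_star,
      Set.disjoint_iff_inter_eq_empty.1 ((g a).disjoint h)]
    simp
  have hcc : ∀ (a : α) (k m : Fin (g a).n),
      ∫ x, conj (form g a k x) * form g a m x ∂(P.map (sample g W)) =
        if k = m then ((g a).mass k : ℂ) else 0 := by
    intro a k m
    rw [integral_conj_form_mul_form hW]
    split_ifs with h
    · rw [h, Set.inter_self, mass]
    · rw [Set.disjoint_iff_inter_eq_empty.1 ((g a).disjoint h)]
      simp
  refine ⟨hXX a, hXX b, hcc a, hcc b, fun k l => ?_, fun k l => ?_, fun _ _ => measureReal_nonneg,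
    sum_real_inter_le _ _, fun l => ?_, by simp⟩
  · rw [integral_form_mul_form hW]; simp
  · rw [integral_conj_form_mul_form hW]; simp
  · exact (Finset.sum_congr rfl fun k _ => by rw [Set.inter_comm]).trans_le
      (sum_real_inter_le (g b) (g a) l)

variable [SigmaFinite F]

/-- Covariance bound for exponentials of multiple integrals of simple kernels with symmetric
coefficients. -/
theorem enorm_integral_cexp_sub_le (hσ : Measurable σ) (hW : IsGaussianRandomMeasure σ F W P)
    (g : ∀ a, SimpleKernel σ F (p a)) (hg : ∀ a, IsSymm (g a).coeff) (s t : α → ℝ) :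
    ‖∫ ω, Complex.exp (Complex.I * ∑ a, (s a : ℂ) * (g a).integral W ω) *
        Complex.exp (Complex.I * ∑ a, (t a : ℂ) * (g a).integral W ω) ∂P -
      (∫ ω, Complex.exp (Complex.I * ∑ a, (s a : ℂ) * (g a).integral W ω) ∂P) *
        ∫ ω, Complex.exp (Complex.I * ∑ a, (t a : ℂ) * (g a).integral W ω) ∂P‖ₑ ≤
      ∑ a, ∑ b, ENNReal.ofReal (|s a| * |t b| * covConst (p a) (p b)) *
        ∑ r ∈ Finset.Icc 1 (min (p a) (p b)), contractionNorm σ F r (g a).toFun (g b).toFun := by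
  have := (hasGaussianLaw_sample hW g).isGaussian_map
  have h := norm_integral_cexp_sub_le (μ := P.map (sample g W)) (c := fun a => (g a).coeff)
    (w := form g) (integral_sample hW g) (corrForms hW g) hg
    (fun a i b c hbc hR => (g a).coeff_diag i b c hbc (Or.inr hR)) (mpoly_form_im g) s t
  have hm := aemeasurable_sample hW g
  have hcont : ∀ s : α → ℝ, Continuous fun x =>
      Complex.exp (Complex.I * comb s (fun a => (g a).coeff) (form g) x) := fun s =>
    Complex.continuous_exp.comp (continuous_const.mul (testFun_comb s _ _).diff.continuous)
  have hst := (hcont s).mul (hcont t)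
  simp only [Pi.mul_def] at hst
  rw [integral_map hm hst.aestronglyMeasurable,
    integral_map hm (hcont s).aestronglyMeasurable,
    integral_map hm (hcont t).aestronglyMeasurable] at h
  have hcomb : ∀ᵐ ω ∂P, ∀ s : α → ℝ, comb s (fun a => (g a).coeff) (form g) (sample g W ω) =
      ∑ a, (s a : ℂ) * (g a).integral W ω := by
    have hall : ∀ᵐ ω ∂P, ∀ a k, form g a k (sample g W ω) = W ((g a).A k) ω :=
      ae_all_iff.2 fun a => ae_all_iff.2 fun k => form_sample hW g a k
    filter_upwards [hall] with ω hω s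
    simp only [comb, hω]
    rfl
  have e1 : ∀ s : α → ℝ, ∫ ω, Complex.exp (Complex.I *
      comb s (fun a => (g a).coeff) (form g) (sample g W ω)) ∂P =
      ∫ ω, Complex.exp (Complex.I * ∑ a, (s a : ℂ) * (g a).integral W ω) ∂P := fun s =>
    integral_congr_ae (hcomb.mono fun ω hω => by simp only [hω])
  have e2 : ∫ ω, Complex.exp (Complex.I *
      comb s (fun a => (g a).coeff) (form g) (sample g W ω)) * Complex.exp (Complex.I *
      comb t (fun a => (g a).coeff) (form g) (sample g W ω)) ∂P =
      ∫ ω, Complex.exp (Complex.I * ∑ a, (s a : ℂ) * (g a).integral W ω) *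
        Complex.exp (Complex.I * ∑ a, (t a : ℂ) * (g a).integral W ω) ∂P :=
    integral_congr_ae (hcomb.mono fun ω hω => by simp only [hω])
  rw [e1, e1, e2] at h
  rw [← ofReal_norm]
  refine (ENNReal.ofReal_le_ofReal h).trans ?_
  have hC := covConst_nonneg
  rw [ENNReal.ofReal_sum_of_nonneg fun a _ => Finset.sum_nonneg fun b _ =>
    mul_nonneg (by positivity) (mul_nonneg (hC _ _) (Real.sqrt_nonneg _))]
  refine Finset.sum_le_sum fun a _ => ?_
  rw [ENNReal.ofReal_sum_of_nonneg fun b _ =>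
    mul_nonneg (by positivity) (mul_nonneg (hC _ _) (Real.sqrt_nonneg _))]
  refine Finset.sum_le_sum fun b _ => ?_
  rw [← mul_assoc, ENNReal.ofReal_mul (mul_nonneg (by positivity) (hC _ _))]
  gcongr
  exact sqrt_sum_contrNormSq_le hσ _ _ _

end SimpleKernel

/-! ### Symmetrization of simple kernels -/

lemma measurePreserving_perm (F : Measure ℝ) [SigmaFinite F] {q : ℕ} (π : Equiv.Perm (Fin q)) :
    MeasurePreserving (fun (x : Fin q → ℝ) a => x (π a)) (powMeasure F q) (powMeasure F q) := by
  convert measurePreserving_piCongrLeft (fun _ : Fin q => F) π.symm using 1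
  ext x a
  have := MeasurableEquiv.piCongrLeft_apply_apply (β := fun _ : Fin q => ℝ) π.symm x (π a)
  rw [π.symm_apply_apply] at this
  exact this.symm

namespace SimpleKernel

variable {σ : ℝ → ℝ} {F : Measure ℝ} {q : ℕ}

lemma memLp_toFun [SigmaFinite F] (g : SimpleKernel σ F q) :
    MemLp g.toFun 2 (powMeasure F q) := by
  have h : g.toFun = fun x => ∑ i : Fin q → Fin g.n, g.coeff i *
      (Set.univ.pi fun a => g.A (i a)).indicator (fun _ => (1 : ℂ)) x := by
    ext x
    exact Finset.sum_congr rfl fun i _ => by rw [prod_indicator]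
  rw [h]
  refine memLp_finsetSum _ fun i _ => MemLp.const_mul (memLp_indicator_const 2
    (MeasurableSet.univ_pi fun _ => g.measurableSet _) 1 (Or.inr ?_)) _
  rw [Measure.pi_pi]
  exact (ENNReal.prod_lt_top fun a _ => g.measure_lt_top _).ne

/-- The symmetrization of a simple kernel. -/
def symm (g : SimpleKernel σ F q) : SimpleKernel σ F q :=
  { g with
    coeff := fun i => (q.factorial : ℂ)⁻¹ * ∑ π : Equiv.Perm (Fin q), g.coeff fun a => i (π a)
    coeff_diag := fun i a b hab h => by
      rw [Finset.sum_eq_zero fun π _ => g.coeff_diag _ (π.symm a) (π.symm b)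
        (π.symm.injective.ne hab) (by simpa using h), mul_zero]
    coeff_star := fun i => by
      rw [map_mul, map_inv₀, map_natCast, map_sum]
      exact congrArg _ (Finset.sum_congr rfl fun π _ => g.coeff_star _) }

lemma isSymm_symm (g : SimpleKernel σ F q) : IsSymm g.symm.coeff := fun π i => by
  change _ * _ = _ * _
  congr 1
  exact Equiv.sum_comp (Equiv.mulLeft π) fun τ : Equiv.Perm (Fin q) => g.coeff fun a => i (τ a)

lemma sum_symm (g : SimpleKernel σ F q) (v : Fin q → Fin g.n → ℂ) :
    ∑ i, g.symm.coeff i * ∏ a, v a (i a) =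
      (q.factorial : ℂ)⁻¹ * ∑ π : Equiv.Perm (Fin q), ∑ i, g.coeff i * ∏ a, v (π a) (i a) := by
  change ∑ i : Fin q → Fin g.n, (q.factorial : ℂ)⁻¹ *
    (∑ π : Equiv.Perm (Fin q), g.coeff fun a => i (π a)) * ∏ a, v a (i a) = _
  simp only [mul_assoc]
  rw [← Finset.mul_sum]
  congr 1
  simp only [Finset.sum_mul]
  rw [Finset.sum_comm]
  refine Finset.sum_congr rfl fun π _ => ?_
  rw [← (π.arrowCongr (Equiv.refl (Fin g.n))).sum_comp]
  refine Finset.sum_congr rfl fun i _ => ?_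
  congr 1
  · congr 1
    ext a
    simp
  · rw [← Equiv.prod_comp π]
    simp

lemma integral_symm {Ω : Type*} (g : SimpleKernel σ F q) (W : Set ℝ → Ω → ℂ) (ω : Ω) :
    g.symm.integral W ω = g.integral W ω := by
  refine (g.sum_symm fun _ k => W (g.A k) ω).trans ?_
  rw [Finset.sum_const, Finset.card_univ, Fintype.card_perm, Fintype.card_fin, nsmul_eq_mul,
    inv_mul_cancel_left₀ (by exact_mod_cast q.factorial_ne_zero)]
  rfl

lemma toFun_symm (g : SimpleKernel σ F q) (x : Fin q → ℝ) :
    g.symm.toFun x = (q.factorial : ℂ)⁻¹ * ∑ π : Equiv.Perm (Fin q), g.toFun fun a => x (π a) :=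
  g.sum_symm fun a k => (g.A k).indicator (fun _ => (1 : ℂ)) (x a)

/-- Symmetrization does not increase the distance to a symmetric kernel. -/
lemma eLpNorm_symm_sub_le [SigmaFinite F] (g : SimpleKernel σ F q) {f : (Fin q → ℝ) → ℂ}
    (hf : IsKernel σ F q f) :
    eLpNorm (fun x => g.symm.toFun x - f x) 2 (powMeasure F q) ≤
      eLpNorm (fun x => g.toFun x - f x) 2 (powMeasure F q) := by
  set d : (Fin q → ℝ) → ℂ := fun x => g.toFun x - f x with hd
  have hdm : MemLp d 2 (powMeasure F q) := g.memLp_toFun.sub hf.memLp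
  have hq : (q.factorial : ℂ) ≠ 0 := by exact_mod_cast q.factorial_ne_zero
  have e : (fun x => g.symm.toFun x - f x) =ᵐ[powMeasure F q]
      (q.factorial : ℂ)⁻¹ • ∑ π : Equiv.Perm (Fin q), d ∘ fun x a => x (π a) := by
    filter_upwards [ae_all_iff.2 fun π => hf.symmetric π] with x hx
    simp only [Pi.smul_apply, Finset.sum_apply, Function.comp, hd, hx, smul_eq_mul,
      Finset.sum_sub_distrib, toFun_symm, mul_sub]
    congr 1
    rw [Finset.sum_const, Finset.card_univ, Fintype.card_perm, Fintype.card_fin, nsmul_eq_mul,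
      inv_mul_cancel_left₀ hq]
  have hcomp : ∀ π : Equiv.Perm (Fin q),
      eLpNorm (d ∘ fun x a => x (π a)) 2 (powMeasure F q) = eLpNorm d 2 (powMeasure F q) :=
    fun π => eLpNorm_comp_measurePreserving hdm.1 (measurePreserving_perm F π)
  rw [eLpNorm_congr_ae e, eLpNorm_const_smul]
  refine (mul_le_mul_right (eLpNorm_sum_le (fun π _ =>
    hdm.1.comp_measurePreserving (measurePreserving_perm F π)) one_le_two) _).trans ?_
  simp only [hcomp]
  rw [Finset.sum_const, Finset.card_univ, Fintype.card_perm, Fintype.card_fin, nsmul_eq_mul,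
    ← mul_assoc, enorm_inv hq]
  refine (mul_le_mul_left (le_of_eq ?_) _).trans (one_mul _).le
  rw [show ‖(q.factorial : ℂ)‖ₑ = (q.factorial : ℝ≥0∞) by
    rw [← ofReal_norm, Complex.norm_natCast, ENNReal.ofReal_natCast]]
  exact ENNReal.inv_mul_cancel (by exact_mod_cast q.factorial_ne_zero) (by simp)

end SimpleKernel

/-! ### Continuity of contractions -/

lemma eLpNorm_two_sq {X : Type*} [MeasurableSpace X] (μ : Measure X) (f : X → ℂ) :
    eLpNorm f 2 μ ^ 2 = ∫⁻ x, ‖f x‖ₑ ^ 2 ∂μ := by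
  have h := eLpNorm_nnreal_pow_eq_lintegral (μ := μ) (p := 2) two_ne_zero (f := f)
  norm_num at h
  exact h

section Contraction

variable {F : Measure ℝ} [SigmaFinite F] {m m' r : ℕ}

lemma aestronglyMeasurable_append {f : (Fin (m + r) → ℝ) → ℂ}
    (hf : AEStronglyMeasurable f (powMeasure F (m + r))) :
    AEStronglyMeasurable (fun z : (Fin m → ℝ) × (Fin r → ℝ) => f (Fin.append z.1 z.2))
      ((powMeasure F m).prod (powMeasure F r)) :=
  hf.comp_measurePreserving (measurePreserving_append F m r)

lemma aestronglyMeasurable_slice {f : (Fin (m + r) → ℝ) → ℂ}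
    (hf : AEStronglyMeasurable f (powMeasure F (m + r))) :
    ∀ᵐ x ∂(powMeasure F m), AEStronglyMeasurable (fun s : Fin r → ℝ => f (Fin.append x s))
      (powMeasure F r) :=
  (aestronglyMeasurable_append hf).prodMk_left

/-- Fubini's theorem for the `L²` norms of the slices of a kernel. -/
lemma lintegral_slice {f : (Fin (m + r) → ℝ) → ℂ}
    (hf : AEStronglyMeasurable f (powMeasure F (m + r))) :
    ∫⁻ x, eLpNorm (fun s : Fin r → ℝ => f (Fin.append x s)) 2 (powMeasure F r) ^ 2
      ∂(powMeasure F m) = eLpNorm f 2 (powMeasure F (m + r)) ^ 2 := by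
  rw [← eLpNorm_comp_measurePreserving hf (measurePreserving_append F m r), eLpNorm_two_sq]
  simp only [eLpNorm_two_sq]
  exact (lintegral_prod _ ((aestronglyMeasurable_append hf).enorm.pow_const 2)).symm

lemma aemeasurable_slice {f : (Fin (m + r) → ℝ) → ℂ}
    (hf : AEStronglyMeasurable f (powMeasure F (m + r))) :
    AEMeasurable (fun x => eLpNorm (fun s : Fin r → ℝ => f (Fin.append x s)) 2 (powMeasure F r) ^ 2)
      (powMeasure F m) := by
  simp only [eLpNorm_two_sq]
  exact ((aestronglyMeasurable_append hf).enorm.pow_const 2).lintegral_prod_right'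

lemma memLp_slice {f : (Fin (m + r) → ℝ) → ℂ} (hf : MemLp f 2 (powMeasure F (m + r))) :
    ∀ᵐ x ∂(powMeasure F m), MemLp (fun s : Fin r → ℝ => f (Fin.append x s)) 2 (powMeasure F r) := by
  have h : ∀ᵐ x ∂(powMeasure F m),
      eLpNorm (fun s : Fin r → ℝ => f (Fin.append x s)) 2 (powMeasure F r) ^ 2 < ∞ := by
    refine ae_lt_top' (aemeasurable_slice hf.1) ?_
    rw [lintegral_slice hf.1]
    exact ENNReal.pow_ne_top hf.2.ne
  filter_upwards [h, aestronglyMeasurable_slice hf.1] with x h1 h2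
  exact ⟨h2, by simpa using h1⟩

variable {σ : ℝ → ℝ}

lemma measurePreserving_reflect (hσ : MeasurePreserving σ F F) (r : ℕ) :
    MeasurePreserving (fun (s : Fin r → ℝ) a => σ (s a)) (powMeasure F r) (powMeasure F r) :=
  measurePreserving_pi _ _ fun _ => hσ

lemma enorm_integral_mul_le {X : Type*} [MeasurableSpace X] {μ : Measure X} {u v : X → ℂ}
    (hu : AEStronglyMeasurable u μ) (hv : AEStronglyMeasurable v μ) :
    ‖∫ x, u x * v x ∂μ‖ₑ ≤ eLpNorm u 2 μ * eLpNorm v 2 μ := by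
  refine (enorm_integral_le_lintegral_enorm _).trans ?_
  rw [← eLpNorm_one_eq_lintegral_enorm]
  have h := eLpNorm_smul_le_mul_eLpNorm (𝕜 := ℂ) (p := 2) (q := 2) (r := 1) hv hu
  simpa only [smul_eq_mul] using! h

/-- Cauchy–Schwarz inequality for contractions. -/
lemma contractionNorm_add_le (hσ : MeasurePreserving σ F F) {f : (Fin (m + r) → ℝ) → ℂ}
    {g : (Fin (m' + r) → ℝ) → ℂ} (hf : AEStronglyMeasurable f (powMeasure F (m + r)))
    (hg : AEStronglyMeasurable g (powMeasure F (m' + r))) :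
    contractionNorm σ F r f g ≤
      eLpNorm f 2 (powMeasure F (m + r)) * eLpNorm g 2 (powMeasure F (m' + r)) := by
  have hpt : ∀ᵐ z ∂(powMeasure F m).prod (powMeasure F m'), ‖∫ s : Fin r → ℝ,
      f (Fin.append z.1 s) * g (Fin.append z.2 fun a => σ (s a)) ∂(powMeasure F r)‖ₑ ^ 2 ≤
      eLpNorm (fun s : Fin r → ℝ => f (Fin.append z.1 s)) 2 (powMeasure F r) ^ 2 *
        eLpNorm (fun s : Fin r → ℝ => g (Fin.append z.2 s)) 2 (powMeasure F r) ^ 2 := by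
    filter_upwards [Measure.quasiMeasurePreserving_fst.ae (aestronglyMeasurable_slice hf),
      Measure.quasiMeasurePreserving_snd.ae (aestronglyMeasurable_slice hg)] with z h1 h2
    have hσr := measurePreserving_reflect hσ r
    rw [← mul_pow, ← eLpNorm_comp_measurePreserving h2 hσr]
    gcongr
    exact enorm_integral_mul_le h1 (h2.comp_measurePreserving hσr)
  have h := lintegral_mono_ae hpt
  rw [lintegral_prod_mul (aemeasurable_slice hf) (aemeasurable_slice hg), lintegral_slice hf,
    lintegral_slice hg, ← eLpNorm_two_sq, ← contractionNorm_add, ← mul_pow] at h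
  exact (ENNReal.pow_le_pow_left_iff two_ne_zero).1 h

lemma aestronglyMeasurable_contraction (hσ : MeasurePreserving σ F F) {f : (Fin (m + r) → ℝ) → ℂ}
    {g : (Fin (m' + r) → ℝ) → ℂ} (hf : AEStronglyMeasurable f (powMeasure F (m + r)))
    (hg : AEStronglyMeasurable g (powMeasure F (m' + r))) :
    AEStronglyMeasurable (fun z : (Fin m → ℝ) × (Fin m' → ℝ) => ∫ s : Fin r → ℝ,
      f (Fin.append z.1 s) * g (Fin.append z.2 fun a => σ (s a)) ∂(powMeasure F r))
      ((powMeasure F m).prod (powMeasure F m')) := by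
  have h1 := (aestronglyMeasurable_append hf).comp_quasiMeasurePreserving
    (QuasiMeasurePreserving.prodMap
      (Measure.quasiMeasurePreserving_fst (μ := powMeasure F m) (ν := powMeasure F m'))
      (Measure.QuasiMeasurePreserving.id (powMeasure F r)))
  have h2 := (aestronglyMeasurable_append hg).comp_quasiMeasurePreserving
    (QuasiMeasurePreserving.prodMap
      (Measure.quasiMeasurePreserving_snd (μ := powMeasure F m) (ν := powMeasure F m'))
      (measurePreserving_reflect hσ r).quasiMeasurePreserving)
  exact (h1.mul h2).integral_prod_right'

lemma contraction_split (hσ : MeasurePreserving σ F F) {f f' : (Fin (m + r) → ℝ) → ℂ}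
    {g g' : (Fin (m' + r) → ℝ) → ℂ} (hf : MemLp f 2 (powMeasure F (m + r)))
    (hf' : MemLp f' 2 (powMeasure F (m + r))) (hg : MemLp g 2 (powMeasure F (m' + r)))
    (hg' : MemLp g' 2 (powMeasure F (m' + r))) :
    (fun z : (Fin m → ℝ) × (Fin m' → ℝ) => ∫ s : Fin r → ℝ,
      f (Fin.append z.1 s) * g (Fin.append z.2 fun a => σ (s a)) ∂(powMeasure F r))
      =ᵐ[(powMeasure F m).prod (powMeasure F m')]
    (fun z => ∫ s : Fin r → ℝ,
      f' (Fin.append z.1 s) * g' (Fin.append z.2 fun a => σ (s a)) ∂(powMeasure F r)) +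
    ((fun z => ∫ s : Fin r → ℝ,
      (f - f') (Fin.append z.1 s) * g (Fin.append z.2 fun a => σ (s a)) ∂(powMeasure F r)) +
    fun z => ∫ s : Fin r → ℝ,
      f' (Fin.append z.1 s) * (g - g') (Fin.append z.2 fun a => σ (s a)) ∂(powMeasure F r)) := by
  have hσr := measurePreserving_reflect hσ r
  filter_upwards [Measure.quasiMeasurePreserving_fst.ae (memLp_slice hf),
    Measure.quasiMeasurePreserving_fst.ae (memLp_slice hf'),
    Measure.quasiMeasurePreserving_snd.ae (memLp_slice hg),
    Measure.quasiMeasurePreserving_snd.ae (memLp_slice hg')] with z h1 h2 h3 h4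
  have h3' := h3.comp_measurePreserving hσr
  have h4' := h4.comp_measurePreserving hσr
  simp only [Pi.add_apply]
  rw [← integral_add, ← integral_add]
  · refine integral_congr_ae (ae_of_all _ fun s => ?_)
    simp only [Pi.sub_apply]
    ring
  · exact h2.integrable_mul h4'
  · exact ((h1.sub h2).integrable_mul h3').add (h2.integrable_mul (h3'.sub h4'))
  · exact (h1.sub h2).integrable_mul h3'
  · exact h2.integrable_mul (h3'.sub h4')

/-- Continuity of the contraction norm in `L²`. -/
lemma contractionNorm_le_add (hσ : MeasurePreserving σ F F) {p q r : ℕ} (hp : r ≤ p) (hq : r ≤ q)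
    {f f' : (Fin p → ℝ) → ℂ} {g g' : (Fin q → ℝ) → ℂ} (hf : MemLp f 2 (powMeasure F p))
    (hf' : MemLp f' 2 (powMeasure F p)) (hg : MemLp g 2 (powMeasure F q))
    (hg' : MemLp g' 2 (powMeasure F q)) :
    contractionNorm σ F r f g ≤ contractionNorm σ F r f' g' +
      (eLpNorm (f - f') 2 (powMeasure F p) * eLpNorm g 2 (powMeasure F q) +
        eLpNorm f' 2 (powMeasure F p) * eLpNorm (g - g') 2 (powMeasure F q)) := by
  obtain ⟨m, rfl⟩ := Nat.exists_eq_add_of_le' hp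
  obtain ⟨m', rfl⟩ := Nat.exists_eq_add_of_le' hq
  have hff := hf.sub hf'
  have hgg := hg.sub hg'
  refine le_trans ?_ (add_le_add_right (add_le_add (contractionNorm_add_le hσ hff.1 hg.1)
    (contractionNorm_add_le hσ hf'.1 hgg.1)) _)
  simp only [contractionNorm_add]
  rw [eLpNorm_congr_ae (contraction_split hσ hf hf' hg hg')]
  have m1 := aestronglyMeasurable_contraction hσ hf'.1 hg'.1
  have m2 := aestronglyMeasurable_contraction hσ hff.1 hg.1
  have m3 := aestronglyMeasurable_contraction hσ hf'.1 hgg.1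
  exact (eLpNorm_add_le m1 (m2.add m3) one_le_two).trans
    (add_le_add_right (eLpNorm_add_le m2 m3 one_le_two) _)

end Contraction

/-! ### The covariance bound for multiple integrals -/

/-- The multiple integrals of simple kernels are almost surely real. -/
lemma SimpleKernel.integral_im {Ω : Type*} [MeasurableSpace Ω] {P : Measure Ω} {σ : ℝ → ℝ}
    {F : Measure ℝ} {W : Set ℝ → Ω → ℂ} (hW : IsGaussianRandomMeasure σ F W P) {q : ℕ}
    (g : SimpleKernel σ F q) : ∀ᵐ ω ∂P, (g.integral W ω).im = 0 := by
  have h : ∀ᵐ ω ∂P, ∀ k, form (fun _ : Unit => g) () k (sample (fun _ : Unit => g) W ω) =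
      W (g.A k) ω := ae_all_iff.2 fun k => form_sample hW (fun _ : Unit => g) () k
  filter_upwards [h] with ω hω
  have := mpoly_form_im (fun _ : Unit => g) () (sample (fun _ : Unit => g) W ω)
  simp only [hω] at this
  exact this

lemma norm_cexp_sub_cexp_le {u v : ℂ} (hu : u.im = 0) (hv : v.im = 0) :
    ‖Complex.exp (Complex.I * u) - Complex.exp (Complex.I * v)‖ ≤ ‖u - v‖ := by
  obtain ⟨x, rfl⟩ : ∃ x : ℝ, u = x := ⟨u.re, Complex.ext rfl (by simpa using hu)⟩
  obtain ⟨y, rfl⟩ : ∃ y : ℝ, v = y := ⟨v.re, Complex.ext rfl (by simpa using hv)⟩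
  have : Complex.exp (Complex.I * x) - Complex.exp (Complex.I * y) =
      Complex.exp (Complex.I * y) * (Complex.exp (Complex.I * ((x - y : ℝ) : ℂ)) - 1) := by
    rw [mul_sub, ← Complex.exp_add, mul_one]
    congr 2
    push_cast
    ring
  rw [this, norm_mul, mul_comm Complex.I, Complex.norm_exp_ofReal_mul_I, one_mul,
    ← Complex.ofReal_sub, Complex.norm_real]
  exact Real.norm_exp_I_mul_ofReal_sub_one_le

section Limit

variable {Ω : Type*} [MeasurableSpace Ω] {P : Measure Ω} {σ : ℝ → ℝ}
  {F : Measure ℝ} {W : Set ℝ → Ω → ℂ}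

lemma SimpleKernel.aestronglyMeasurable_integral (hW : IsGaussianRandomMeasure σ F W P) {q : ℕ}
    (g : SimpleKernel σ F q) : AEStronglyMeasurable (fun ω => g.integral W ω) P := by
  have h : ∀ k, AEStronglyMeasurable (W (g.A k)) P := fun k =>
    (hW.gaussian.aemeasurable ⟨g.A k, g.measurableSet k, g.measure_lt_top k⟩).aestronglyMeasurable
  unfold SimpleKernel.integral
  fun_prop

variable [IsProbabilityMeasure P] {α : Type*} [Fintype α] {p : α → ℕ}

/-- Convergence in `L²(P)` of the multiple integrals implies convergence of the characteristic
functions of their linear combinations. -/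
lemma tendsto_integral_cexp (hW : IsGaussianRandomMeasure σ F W P)
    (g : ∀ a, ℕ → SimpleKernel σ F (p a)) {X : α → Ω → ℝ} (hX : ∀ a, MemLp (X a) 2 P)
    (hg : ∀ a, Tendsto (fun n => eLpNorm (fun ω => (g a n).integral W ω - (X a ω : ℂ)) 2 P)
      atTop (𝓝 0)) (s : α → ℝ) :
    Tendsto (fun n => ∫ ω, Complex.exp (Complex.I * ∑ a, (s a : ℂ) * (g a n).integral W ω) ∂P)
      atTop (𝓝 (∫ ω, Complex.exp (Complex.I * ∑ a, (s a : ℂ) * (X a ω : ℂ)) ∂P)) := by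
  have hXm : ∀ a, AEStronglyMeasurable (fun ω => (X a ω : ℂ)) P := fun a =>
    Complex.continuous_ofReal.comp_aestronglyMeasurable (hX a).1
  have hZm := fun a n => (g a n).aestronglyMeasurable_integral hW
  have him : ∀ n, ∀ᵐ ω ∂P, (∑ a, (s a : ℂ) * (g a n).integral W ω).im = 0 := by
    intro n
    filter_upwards [ae_all_iff.2 fun a => (g a n).integral_im hW] with ω hω
    rw [Complex.im_sum]
    exact Finset.sum_eq_zero fun a _ => by rw [Complex.im_ofReal_mul, hω, mul_zero]
  have him' : ∀ ω, (∑ a, (s a : ℂ) * (X a ω : ℂ)).im = 0 := fun ω => by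
    rw [Complex.im_sum]
    exact Finset.sum_eq_zero fun a _ => by simp
  have hint : ∀ Z : Ω → ℂ, AEStronglyMeasurable Z P → (∀ᵐ ω ∂P, (Z ω).im = 0) →
      Integrable (fun ω => Complex.exp (Complex.I * Z ω)) P := by
    intro Z hZ h0
    refine Integrable.of_bound (Complex.continuous_exp.comp_aestronglyMeasurable
      (hZ.const_mul _)) 1 ?_
    filter_upwards [h0] with ω hω
    rw [Complex.norm_exp]
    simp [hω]
  have hsm : ∀ Z : α → Ω → ℂ, (∀ a, AEStronglyMeasurable (Z a) P) →
      AEStronglyMeasurable (fun ω => ∑ a, (s a : ℂ) * Z a ω) P := fun Z hZ => by fun_prop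
  rw [tendsto_iff_edist_tendsto_0]
  refine tendsto_of_tendsto_of_tendsto_of_le_of_le tendsto_const_nhds
    (h := fun n => ∑ a, ‖(s a : ℂ)‖ₑ *
      eLpNorm (fun ω => (g a n).integral W ω - (X a ω : ℂ)) 2 P) ?_ (fun _ => zero_le) fun n => ?_
  · have : Tendsto (fun n => ∑ a, ‖(s a : ℂ)‖ₑ *
        eLpNorm (fun ω => (g a n).integral W ω - (X a ω : ℂ)) 2 P) atTop
        (𝓝 (∑ a, ‖(s a : ℂ)‖ₑ * 0)) :=
      tendsto_finsetSum _ fun a _ => ENNReal.Tendsto.const_mul (hg a) (Or.inr enorm_ne_top)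
    simpa using this
  · change edist _ _ ≤ _
    rw [edist_eq_enorm_sub, ← integral_sub (hint _ (hsm _ fun a => hZm a n) (him n))
      (hint _ (hsm _ hXm) (ae_of_all _ him'))]
    refine (enorm_integral_le_lintegral_enorm _).trans ?_
    calc ∫⁻ ω, ‖Complex.exp (Complex.I * ∑ a, (s a : ℂ) * (g a n).integral W ω) -
          Complex.exp (Complex.I * ∑ a, (s a : ℂ) * (X a ω : ℂ))‖ₑ ∂P
        ≤ ∫⁻ ω, ∑ a, ‖(s a : ℂ)‖ₑ * ‖(g a n).integral W ω - (X a ω : ℂ)‖ₑ ∂P := by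
          refine lintegral_mono_ae ?_
          filter_upwards [him n] with ω hω
          refine (enorm_le_iff_norm_le.2 (norm_cexp_sub_cexp_le hω (him' ω))).trans ?_
          rw [← Finset.sum_sub_distrib]
          refine (enorm_sum_le _ _).trans (Finset.sum_le_sum fun a _ => ?_)
          rw [← mul_sub, enorm_mul]
      _ = ∑ a, ‖(s a : ℂ)‖ₑ * eLpNorm (fun ω => (g a n).integral W ω - (X a ω : ℂ)) 1 P := by
          have hd : ∀ a, AEMeasurable (fun ω => ‖(g a n).integral W ω - (X a ω : ℂ)‖ₑ) P :=
            fun a => ((hZm a n).sub (hXm a)).enorm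
          rw [lintegral_finsetSum' _ fun a _ => (hd a).const_mul _]
          refine Finset.sum_congr rfl fun a _ => ?_
          rw [lintegral_const_mul'' _ (hd a), eLpNorm_one_eq_lintegral_enorm]
      _ ≤ _ := Finset.sum_le_sum fun a _ => mul_le_mul_right
          (eLpNorm_le_eLpNorm_of_exponent_le one_le_two ((hZm a n).sub (hXm a))) _

variable [SigmaFinite F]

/-- Covariance bound for exponentials of multiple integrals: the joint characteristic function
differs from the product of the characteristic functions by at most a multiple of the norms of the
contractions. -/
theorem enorm_integral_cexp_sub_le (hσ : MeasurePreserving σ F F)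
    (hW : IsGaussianRandomMeasure σ F W P) {f : ∀ a, (Fin (p a) → ℝ) → ℂ} {X : α → Ω → ℝ}
    (hf : ∀ a, IsKernel σ F (p a) (f a))
    (hX : ∀ a, IsMultipleIntegral σ F W P (p a) (f a) (X a)) (s t : α → ℝ) :
    ‖∫ ω, Complex.exp (Complex.I * ∑ a, (s a : ℂ) * (X a ω : ℂ)) *
        Complex.exp (Complex.I * ∑ a, (t a : ℂ) * (X a ω : ℂ)) ∂P -
      (∫ ω, Complex.exp (Complex.I * ∑ a, (s a : ℂ) * (X a ω : ℂ)) ∂P) *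
        ∫ ω, Complex.exp (Complex.I * ∑ a, (t a : ℂ) * (X a ω : ℂ)) ∂P‖ₑ ≤
      ∑ a, ∑ b, ENNReal.ofReal (|s a| * |t b| * covConst (p a) (p b)) *
        ∑ r ∈ Finset.Icc 1 (min (p a) (p b)), contractionNorm σ F r (f a) (f b) := by
  choose hXm g hgf hgX using hX
  have hprod : ∀ Z : α → Ω → ℂ,
      (∫ ω, Complex.exp (Complex.I * ∑ a, (s a : ℂ) * Z a ω) *
        Complex.exp (Complex.I * ∑ a, (t a : ℂ) * Z a ω) ∂P) =
      ∫ ω, Complex.exp (Complex.I * ∑ a, ((s a + t a : ℝ) : ℂ) * Z a ω) ∂P := by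
    intro Z
    congr 1
    ext ω
    rw [← Complex.exp_add, ← mul_add, ← Finset.sum_add_distrib]
    congr 3
    ext a
    push_cast
    ring
  set δ : α → ℕ → ℝ≥0∞ := fun a n =>
    eLpNorm ((g a n).symm.toFun - f a) 2 (powMeasure F (p a)) with hδ
  have hδ0 : ∀ a, Tendsto (δ a) atTop (𝓝 0) := fun a =>
    tendsto_of_tendsto_of_tendsto_of_le_of_le tendsto_const_nhds (hgf a) (fun _ => zero_le)
      fun n => (g a n).eLpNorm_symm_sub_le (hf a)
  have hlim := tendsto_integral_cexp hW g hXm hgX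
  have hL : Tendsto (fun n => ‖∫ ω, Complex.exp (Complex.I * ∑ a, (s a : ℂ) *
        (g a n).symm.integral W ω) *
        Complex.exp (Complex.I * ∑ a, (t a : ℂ) * (g a n).symm.integral W ω) ∂P -
      (∫ ω, Complex.exp (Complex.I * ∑ a, (s a : ℂ) * (g a n).symm.integral W ω) ∂P) *
        ∫ ω, Complex.exp (Complex.I * ∑ a, (t a : ℂ) * (g a n).symm.integral W ω) ∂P‖ₑ) atTop
      (𝓝 ‖∫ ω, Complex.exp (Complex.I * ∑ a, (s a : ℂ) * (X a ω : ℂ)) *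
        Complex.exp (Complex.I * ∑ a, (t a : ℂ) * (X a ω : ℂ)) ∂P -
      (∫ ω, Complex.exp (Complex.I * ∑ a, (s a : ℂ) * (X a ω : ℂ)) ∂P) *
        ∫ ω, Complex.exp (Complex.I * ∑ a, (t a : ℂ) * (X a ω : ℂ)) ∂P‖ₑ) := by
    simp only [hprod, SimpleKernel.integral_symm]
    exact ((hlim fun a => s a + t a).sub ((hlim s).mul (hlim t))).enorm
  have hfin : ∀ a, eLpNorm (f a) 2 (powMeasure F (p a)) ≠ ∞ := fun a => (hf a).memLp.2.ne
  have hR : Tendsto (fun n => ∑ a, ∑ b, ENNReal.ofReal (|s a| * |t b| * covConst (p a) (p b)) *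
        ∑ r ∈ Finset.Icc 1 (min (p a) (p b)), (contractionNorm σ F r (f a) (f b) +
          (δ a n * (eLpNorm (f b) 2 (powMeasure F (p b)) + δ b n) +
            eLpNorm (f a) 2 (powMeasure F (p a)) * δ b n))) atTop
      (𝓝 (∑ a, ∑ b, ENNReal.ofReal (|s a| * |t b| * covConst (p a) (p b)) *
        ∑ r ∈ Finset.Icc 1 (min (p a) (p b)), (contractionNorm σ F r (f a) (f b) +
          (0 * (eLpNorm (f b) 2 (powMeasure F (p b)) + 0) +
            eLpNorm (f a) 2 (powMeasure F (p a)) * 0)))) := by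
    refine tendsto_finsetSum _ fun a _ => tendsto_finsetSum _ fun b _ =>
      ENNReal.Tendsto.const_mul (tendsto_finsetSum _ fun r _ => tendsto_const_nhds.add
        (Tendsto.add ?_ ?_)) (Or.inr ENNReal.ofReal_ne_top)
    · exact ENNReal.Tendsto.mul (hδ0 a) (Or.inr (by simpa using hfin b))
        (tendsto_const_nhds.add (hδ0 b)) (Or.inr (by simp))
    · exact ENNReal.Tendsto.const_mul (hδ0 b) (Or.inr (hfin a))
  simp only [zero_mul, mul_zero, add_zero] at hR
  refine le_of_tendsto_of_tendsto' hL hR fun n => ?_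
  refine (SimpleKernel.enorm_integral_cexp_sub_le hσ.measurable hW (fun a => (g a n).symm)
    (fun a => (g a n).isSymm_symm) s t).trans ?_
  gcongr with a _ b _ r hr
  simp only [Finset.mem_Icc, le_min_iff] at hr
  have hG := fun a => (g a n).symm.memLp_toFun
  refine (contractionNorm_le_add hσ hr.2.1 hr.2.2 (hG a) (hf a).memLp (hG b) (hf b).memLp).trans ?_
  gcongr
  have := eLpNorm_add_le (hf b).memLp.1 ((hG b).sub (hf b).memLp).1 one_le_two
  rwa [add_sub_cancel] at this

end Limit

/-! ### Characteristic functions and convergence in distribution -/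

section Levy

lemma charFun_map_toLp {Ω : Type*} [MeasurableSpace Ω] {P : Measure Ω} {τ : Type*} [Fintype τ]
    {Y : Ω → τ → ℝ} (hY : AEMeasurable Y P)
    (t : EuclideanSpace ℝ τ) : charFun (P.map (WithLp.toLp 2 ∘ Y)) t =
      ∫ ω, Complex.exp (Complex.I * ∑ i, (t i : ℂ) * (Y ω i : ℂ)) ∂P := by
  have hm : Measurable (WithLp.toLp 2 : (τ → ℝ) → EuclideanSpace ℝ τ) := by fun_prop
  rw [charFun_apply, integral_map (hm.comp_aemeasurable hY) (by fun_prop)]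
  congr 1
  ext ω
  rw [mul_comm, PiLp.inner_apply]
  simp

variable {Ω Ω' : Type*} [MeasurableSpace Ω] [MeasurableSpace Ω'] {P : Measure Ω}
  [IsProbabilityMeasure P] {P' : Measure Ω'} [IsProbabilityMeasure P']

lemma tendsto_integral_cexp_of_tendstoInDistribution {E : Type*} [TopologicalSpace E]
    [MeasurableSpace E] [OpensMeasurableSpace E] {X : ℕ → Ω → E} {Z : Ω' → E}
    (h : TendstoInDistribution X atTop Z (fun _ => P) P') {e : E → ℝ} (he : Continuous e) :
    Tendsto (fun n => ∫ ω, Complex.exp (Complex.I * (e (X n ω) : ℂ)) ∂P) atTop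
      (𝓝 (∫ ω, Complex.exp (Complex.I * (e (Z ω) : ℂ)) ∂P')) := by
  have hc : Continuous fun x => Complex.exp (Complex.I * (e x : ℂ)) := by fun_prop
  have := (ProbabilityMeasure.tendsto_iff_forall_integral_rclike_tendsto ℂ).1 h.tendsto
    (BoundedContinuousFunction.ofNormedAddCommGroup _ hc 1 fun x => by
      rw [mul_comm, Complex.norm_exp_ofReal_mul_I])
  simp only [ProbabilityMeasure.coe_mk, BoundedContinuousFunction.coe_ofNormedAddCommGroup] at this
  rw [integral_map h.aemeasurable_limit hc.measurable.aestronglyMeasurable] at this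
  refine this.congr fun n => ?_
  rw [integral_map (h.forall_aemeasurable n) hc.measurable.aestronglyMeasurable]

/-- Lévy's convergence theorem for vectors with finitely many real components. -/
lemma tendstoInDistribution_of_tendsto_integral_cexp {τ : Type*} [Fintype τ] {X : ℕ → Ω → τ → ℝ}
    {Z : Ω' → τ → ℝ} (hX : ∀ n, AEMeasurable (X n) P) (hZ : AEMeasurable Z P')
    (h : ∀ s : τ → ℝ, Tendsto
      (fun n => ∫ ω, Complex.exp (Complex.I * ∑ i, (s i : ℂ) * (X n ω i : ℂ)) ∂P) atTop
      (𝓝 (∫ ω, Complex.exp (Complex.I * ∑ i, (s i : ℂ) * (Z ω i : ℂ)) ∂P'))) :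
    TendstoInDistribution X atTop Z (fun _ => P) P' := by
  have hm : Measurable (WithLp.toLp 2 : (τ → ℝ) → EuclideanSpace ℝ τ) := by fun_prop
  have key : TendstoInDistribution (fun n => WithLp.toLp 2 ∘ X n) atTop (WithLp.toLp 2 ∘ Z)
      (fun _ => P) P' (E := EuclideanSpace ℝ τ) := by
    refine ⟨fun n => hm.comp_aemeasurable (hX n), hm.comp_aemeasurable hZ, ?_⟩
    refine ProbabilityMeasure.tendsto_of_tendsto_charFun fun t => ?_
    simp only [ProbabilityMeasure.coe_mk, charFun_map_toLp hZ, charFun_map_toLp (hX _)]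
    exact h fun i => t i
  exact key.continuous_comp (g := fun x : EuclideanSpace ℝ τ => (x : τ → ℝ)) (by fun_prop)

end Levy

section Blocks

variable {Ω : Type*} [MeasurableSpace Ω] {P : Measure Ω} [IsProbabilityMeasure P] {σ : ℝ → ℝ}
  {F : Measure ℝ} [SigmaFinite F] {W : Set ℝ → Ω → ℂ} {α β : Type*} [Fintype α] [DecidableEq β]
  {q : α → ℕ} {f : ∀ a, ℕ → (Fin (q a) → ℝ) → ℂ} {X : α → ℕ → Ω → ℝ}

/-- The vector `s` restricted to the indices whose block lies in `B`. -/
def restrictBlocks (blk : α → β) (s : α → ℝ) (B : Finset β) (a : α) : ℝ :=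
  if blk a ∈ B then s a else 0

/-- If the contractions between different blocks vanish asymptotically, then so does the
difference between the joint characteristic function and the product over the blocks. -/
lemma tendsto_integral_cexp_blocks (hσ : MeasurePreserving σ F F)
    (hW : IsGaussianRandomMeasure σ F W P) (hf : ∀ a N, IsKernel σ F (q a) (f a N))
    (hX : ∀ a N, IsMultipleIntegral σ F W P (q a) (f a N) (X a N)) (blk : α → β)
    (hcontr : ∀ a b, blk a ≠ blk b → ∀ r, 1 ≤ r → r ≤ min (q a) (q b) →
      Tendsto (fun N => contractionNorm σ F r (f a N) (f b N)) atTop (𝓝 0))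
    (s : α → ℝ) {ψ : β → ℂ} (hψ : ∀ j, Tendsto (fun N => ∫ ω, Complex.exp (Complex.I *
      ∑ a, (restrictBlocks blk s {j} a : ℂ) * (X a N ω : ℂ)) ∂P) atTop (𝓝 (ψ j)))
    (B : Finset β) :
    Tendsto (fun N => ∫ ω, Complex.exp (Complex.I *
      ∑ a, (restrictBlocks blk s B a : ℂ) * (X a N ω : ℂ)) ∂P) atTop (𝓝 (∏ j ∈ B, ψ j)) := by
  induction B using Finset.cons_induction with
  | empty => simp [restrictBlocks]
  | cons j B hj ih =>
    set φ : (α → ℝ) → ℕ → ℂ := fun s N =>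
      ∫ ω, Complex.exp (Complex.I * ∑ a, (s a : ℂ) * (X a N ω : ℂ)) ∂P with hφ
    set u := restrictBlocks blk s {j} with hu
    set v := restrictBlocks blk s B with hv
    have huv : ∀ a, restrictBlocks blk s (Finset.cons j B hj) a = u a + v a := by
      intro a
      by_cases h1 : blk a = j
      · subst h1
        simp [hu, hv, restrictBlocks, hj]
      · simp [hu, hv, restrictBlocks, h1]
    have hdiff : Tendsto (fun N => φ (restrictBlocks blk s (Finset.cons j B hj)) N -
        φ u N * φ v N) atTop (𝓝 0) := by
      rw [tendsto_zero_iff_enorm_tendsto_zero]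
      have hR : Tendsto (fun N => ∑ a, ∑ b, ENNReal.ofReal (|u a| * |v b| * covConst (q a) (q b)) *
          ∑ r ∈ Finset.Icc 1 (min (q a) (q b)), contractionNorm σ F r (f a N) (f b N)) atTop
          (𝓝 (∑ _a : α, ∑ _b : α, 0)) := by
        refine tendsto_finsetSum _ fun a _ => tendsto_finsetSum _ fun b _ => ?_
        by_cases hab : blk a = j ∧ blk b ∈ B
        · have hne : blk a ≠ blk b := fun h => hj (hab.1 ▸ h ▸ hab.2)
          have := tendsto_finsetSum (Finset.Icc 1 (min (q a) (q b))) fun r hr =>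
            hcontr a b hne r (Finset.mem_Icc.1 hr).1 (Finset.mem_Icc.1 hr).2
          rw [Finset.sum_const_zero] at this
          simpa using ENNReal.Tendsto.const_mul
            (a := ENNReal.ofReal (|u a| * |v b| * covConst (q a) (q b))) this
            (Or.inr ENNReal.ofReal_ne_top)
        · have h0 : |u a| * |v b| = 0 := by
            rcases not_and_or.1 hab with h | h <;> simp [hu, hv, restrictBlocks, h]
          simp [h0]
      simp only [Finset.sum_const_zero] at hR
      refine tendsto_of_tendsto_of_tendsto_of_le_of_le tendsto_const_nhds hR (fun _ => zero_le)
        fun N => ?_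
      refine le_trans (le_of_eq ?_) (enorm_integral_cexp_sub_le hσ hW (fun a => hf a N)
        (fun a => hX a N) u v)
      simp only [hφ, huv]
      congr 3
      ext ω
      rw [← Complex.exp_add, ← mul_add, ← Finset.sum_add_distrib]
      congr 3
      ext a
      push_cast
      ring
    rw [Finset.prod_cons]
    have h := hdiff.add ((hψ j).mul ih)
    rw [zero_add] at h
    exact h.congr fun N => sub_add_cancel _ _

end Blocks

end WienerIto

end

theorem mainTheorem8
    {Ω : Type*} [MeasurableSpace Ω] (P : Measure Ω) [IsProbabilityMeasure P]
    -- the two settings: real (`σ = id`) and complex Hermitian (`σ x = -x`) random measures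
    (σ : ℝ → ℝ) (hσ : σ = id ∨ σ = fun x => -x)
    (F : Measure ℝ) [IsLocallyFiniteMeasure F] [NullSingletonClass F] (hF : F.map σ = F)
    (W : Set ℝ → Ω → ℂ) (hW : WienerIto.IsGaussianRandomMeasure σ F W P)
    -- `J` vectors; the `j`-th one has `I j` components, of orders `q j i`
    (J : ℕ) (I : Fin J → ℕ) (q : (j : Fin J) → Fin (I j) → ℕ)
    (f : (j : Fin J) → (i : Fin (I j)) → ℕ → (Fin (q j i) → ℝ) → ℂ)
    (hf : ∀ j i N, WienerIto.IsKernel σ F (q j i) (f j i N))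
    (U : (j : Fin J) → ℕ → Ω → Fin (I j) → ℝ)
    (hU : ∀ j i N,
      WienerIto.IsMultipleIntegral σ F W P (q j i) (f j i N) (fun ω => U j N ω i))
    -- the contraction condition
    (hcontr : ∀ (j₁ j₂ : Fin J), j₁ ≠ j₂ → ∀ (i₁ : Fin (I j₁)) (i₂ : Fin (I j₂)) (r : ℕ),
      1 ≤ r → r ≤ min (q j₁ i₁) (q j₂ i₂) →
      Tendsto (fun N => WienerIto.contractionNorm σ F r (f j₁ i₁ N) (f j₂ i₂ N)) atTop (𝓝 0))
    -- each vector converges in distribution to a law with moment-determinate components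
    (ν : (j : Fin J) → Measure (Fin (I j) → ℝ)) [∀ j, IsProbabilityMeasure (ν j)]
    (hconv : ∀ j, TendstoInDistribution (U j) atTop id (fun _ => P) (ν j))
    (hdet : ∀ (j : Fin J) (i : Fin (I j)),
      WienerIto.MomentDeterminate ((ν j).map fun u => u i)) :
    ∃ (Ω' : Type) (_ : MeasurableSpace Ω') (P' : Measure Ω') (_ : IsProbabilityMeasure P')
      (V : (j : Fin J) → Ω' → Fin (I j) → ℝ),
      (∀ j, HasLaw (V j) (ν j) P') ∧
      iIndepFun V P' ∧
      TendstoInDistribution (fun N ω j => U j N ω) atTop (fun ω' j => V j ω') (fun _ => P) P' := by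
  classical
  have hσm : Measurable σ := by
    rcases hσ with rfl | rfl
    · exact measurable_id
    · exact measurable_neg
  -- the vectors of all the components, and of their limits under the product of the laws
  let X : (Σ j, Fin (I j)) → ℕ → Ω → ℝ := fun a N ω => U a.1 N ω a.2
  let Z : ((j : Fin J) → Fin (I j) → ℝ) → (Σ j, Fin (I j)) → ℝ := fun v a => v a.1 a.2
  refine ⟨(j : Fin J) → Fin (I j) → ℝ, inferInstance, Measure.pi ν, inferInstance,
    fun j v => v j, fun j => (measurePreserving_eval ν j).hasLaw,
    iIndepFun_pi (X := fun _ => id) fun j => aemeasurable_id, ?_⟩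
  have hXm : ∀ N, AEMeasurable (fun ω a => X a N ω) P := fun N =>
    aemeasurable_pi_lambda _ fun a => (hU a.1 a.2 N).1.1.aemeasurable
  have hZm : AEMeasurable Z (Measure.pi ν) := by fun_prop
  refine (WienerIto.tendstoInDistribution_of_tendsto_integral_cexp hXm hZm fun s => ?_
    ).continuous_comp (g := fun (y : (Σ j, Fin (I j)) → ℝ) j i => y ⟨j, i⟩) (by fun_prop)
  have hblock := fun j => WienerIto.tendsto_integral_cexp_of_tendstoInDistribution (hconv j)
    (e := fun u => ∑ i, s ⟨j, i⟩ * u i) (by fun_prop)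
  have hall := WienerIto.tendsto_integral_cexp_blocks (X := X) ⟨hσm, hF⟩ hW
    (fun a N => hf a.1 a.2 N) (fun a N => hU a.1 a.2 N) Sigma.fst
    (fun a b hab r h1 hr => hcontr a.1 b.1 hab a.2 b.2 r h1 hr) s (ψ := fun j =>
      ∫ u, Complex.exp (Complex.I * ((∑ i, s ⟨j, i⟩ * u i : ℝ) : ℂ)) ∂(ν j)) (fun j => ?_)
    Finset.univ
  · have hlim : ∫ v, Complex.exp (Complex.I * ∑ a, (s a : ℂ) * (Z v a : ℂ)) ∂(Measure.pi ν) =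
        ∏ j, ∫ u, Complex.exp (Complex.I * ((∑ i, s ⟨j, i⟩ * u i : ℝ) : ℂ)) ∂(ν j) := by
      rw [← integral_fintype_prod_eq_prod (fun j (u : Fin (I j) → ℝ) =>
        Complex.exp (Complex.I * ((∑ i, s ⟨j, i⟩ * u i : ℝ) : ℂ)))]
      congr 1
      ext v
      rw [← Complex.exp_sum, ← Finset.mul_sum, Fintype.sum_sigma]
      push_cast
      rfl
    rw [hlim]
    simpa [WienerIto.restrictBlocks] using hall
  · refine (hblock j).congr fun N => ?_
    congr 1
    ext ω
    congr 2
    rw [Fintype.sum_sigma, Fintype.sum_eq_single j]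
    · simp [WienerIto.restrictBlocks, X]
    · intro k hk
      simp [WienerIto.restrictBlocks, hk]
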